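/- **Setting.** Let $1\le K$, let $\Theta\in[0,1]^{n\times K}$ have rows summing to $1$ and, for each $k\le K$, at least one row equal to the $k$-th unit vector ("pure node"), let $B\in[0,1]^{K\times K}$ be symmetric of full rank, and put $P=\Theta B\Theta^{T}$. Let $A$ be a symmetric $n\times n$ matrix (e.g. the adjacency matrix of a graph). Denote by $\|\cdot\|$ the spectral norm, by $\|\cdot\|_F$ the Frobenius norm, by $\lambda_k(M)$ the $k$-th largest singular value of $M$, and put $\lambda_{\max}=\lambda_1$, $\kappa(M)=\lambda_1(M)/\lambda_K(M)$. Let $U,\hat U\in\mathbb R^{n\times K}$ have as columns orthonormal eigenvectors of $P$ and $A$, respectively, for the $K$ eigenvalues largest in absolute value, let $F$ be the $K\times K$ matrix with $U=\Theta F$, and let $$\beta(A,P)=\max_{1\le i\le n}\Bigl[23K^{1/2}\kappa(P)\frac{\|e_i^{T}A\|_F\,\|A-P\|}{\lambda_K^2(P)}+\frac{\|e_i^{T}(A-P)U\|_F}{\lambda_K(P)}\Bigr].$$ The SPOC algorithm runs the preconditioned successive projection algorithm on the rows $\hat u_1,\dots,\hat u_n$ of $\hat U$: with $\{x: x^{T}Lx\le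 1\}$ the origin-centred ellipsoid of minimum volume containing all $\hat u_i$, it selects successively $K$ indices $J=(j_1,\dots,j_K)$, where $j_k$ maximizes over $i$ the norm of the projection of $L^{1/2}\hat u_i$ onto the orthogonal complement of the span of $L^{1/2}\hat u_{j_1},\dots,L^{1/2}\hat u_{j_{k-1}}$ (ties broken arbitrarily). It then sets $\hat F=\hat U[J,:]$ and outputs $\hat\Theta=\hat U\hat F^{T}(\hat F\hat F^{T})^{-1}$. **Theorem.** There are absolute constants $c_1,C>0$ and, for each $K$, a constant $C_K>0$ depending only on $K$, such that the following holds in every such setting with $\|A-P\|\le\frac12\lambda_K(P)$. The matrix $\hat F\hat F^{T}$ is invertible, and there is a $K\times K$ permutation matrix $\Pi_F$ such that $$\|\hat\Theta-\Theta\Pi_F^{T}\|_F\le C' K^{1/2}\kappa^3(\Theta)\lambda_{\max}^2(\Theta)\,\beta(A,P)+C' K^{1/2}\kappa(\Theta)\lambda_{\max}(\Theta)\frac{\|A-P\|}{\lambda_K(P)}$$ holds with $C'=C_K$ and, if moreover $\beta(A,P)\le c_1\lambda_K(F)/K^{1/2}$, also with the absolute constant $C'=C$. -/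

import Mathlib

noncomputable section

namespace SPOC

open Matrix

/-- Frobenius norm of a real matrix. -/
def frobNorm {m n : ℕ} (M : Matrix (Fin m) (Fin n) ℝ) : ℝ :=
  Real.sqrt (∑ i, ∑ j, M i j ^ 2)

/-- Frobenius (that is, Euclidean) norm of a vector. -/
def vecNorm {n : ℕ} (v : Fin n → ℝ) : ℝ :=
  Real.sqrt (∑ j, v j ^ 2)

/-- Spectral norm: the operator norm between Euclidean spaces. -/
def specNorm {m n : ℕ} (M : Matrix (Fin m) (Fin n) ℝ) : ℝ :=
  ‖LinearMap.toContinuousLinearMap (Matrix.toEuclideanLin M)‖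

/-- The `k`-th largest singular value of `M`, counted from `k = 1`. -/
def singVal {m n : ℕ} (M : Matrix (Fin m) (Fin n) ℝ) (k : ℕ) : ℝ :=
  (Matrix.toEuclideanLin M).singularValues (k - 1)

/-- Condition number of a matrix of rank `K`: the ratio of its largest singular value to its
`K`-th largest (i.e. smallest nonzero) one. -/
def condNumber {m n : ℕ} (K : ℕ) (M : Matrix (Fin m) (Fin n) ℝ) : ℝ :=
  singVal M 1 / singVal M K

/-- `Θ` is the membership matrix and `B` the community matrix of an MMSB satisfying the
identifiability conditions. -/
structure IsIdentifiableMMSB {n K : ℕ} (Θ : Matrix (Fin n) (Fin K) ℝ)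
    (B : Matrix (Fin K) (Fin K) ℝ) : Prop where
  mem_Icc : ∀ i k, Θ i k ∈ Set.Icc (0 : ℝ) 1
  row_sum : ∀ i, ∑ k, Θ i k = 1
  pure_node : ∀ k, ∃ i, Θ i k = 1
  B_mem_Icc : ∀ k l, B k l ∈ Set.Icc (0 : ℝ) 1
  B_symm : B.IsSymm
  B_rank : B.rank = K

/-- `U diag(d) Uᵀ` is a rank-`K` eigenvalue decomposition of `M` by `K` leading eigenvalues: the
columns of `U` are orthonormal eigenvectors with eigenvalues `d`, and no eigenvalue of `M` on the
orthogonal complement of these columns exceeds any of the `d k` in absolute value. -/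
structure IsLeadingEigen {n K : ℕ} (M : Matrix (Fin n) (Fin n) ℝ)
    (U : Matrix (Fin n) (Fin K) ℝ) (d : Fin K → ℝ) : Prop where
  orthonormal : Uᵀ * U = 1
  eigen : M * U = U * Matrix.diagonal d
  leading : ∀ (v : Fin n → ℝ) (μ : ℝ), v ≠ 0 → M *ᵥ v = μ • v → Uᵀ *ᵥ v = 0 →
    ∀ k, |μ| ≤ |d k|

/-- `β_i(A, P)`, with `U` the matrix of leading eigenvectors of `P`. -/
def betaRow {n K : ℕ} (A P : Matrix (Fin n) (Fin n) ℝ) (U : Matrix (Fin n) (Fin K) ℝ)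
    (i : Fin n) : ℝ :=
  23 * Real.sqrt K * condNumber K P * (vecNorm (A i) * specNorm (A - P) / singVal P K ^ 2)
    + vecNorm (((A - P) * U) i) / singVal P K

/-- `β(A, P) = max_i β_i(A, P)`. -/
def beta {n K : ℕ} (A P : Matrix (Fin n) (Fin n) ℝ) (U : Matrix (Fin n) (Fin K) ℝ) : ℝ :=
  ⨆ i, betaRow A P U i

/-- `J 0, J 1, …, J (K - 1)` is a possible outcome (for some way to break ties) of `K` steps of the
successive projection algorithm on the points `x i`: each step selects a point of maximum norm
after projection to the orthogonal complement of the points selected before. -/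
def IsSPAOutput {n r K : ℕ} (x : Fin n → EuclideanSpace ℝ (Fin r)) (J : Fin K → Fin n) : Prop :=
  Function.Injective J ∧
    ∀ (k : Fin K) (i : Fin n),
      ‖(Submodule.span ℝ {y | ∃ l < k, y = x (J l)})ᗮ.starProjection (x i)‖ ≤
        ‖(Submodule.span ℝ {y | ∃ l < k, y = x (J l)})ᗮ.starProjection (x (J k))‖

/-- `{y | yᵀ L y ≤ 1}` is the origin-centred ellipsoid of minimum volume containing all the rows of
`X` (the volume is a constant times `(det L) ^ (-1/2)`). -/
def IsMinVolEllipsoid {n r : ℕ} (X : Matrix (Fin n) (Fin r) ℝ)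
    (L : Matrix (Fin r) (Fin r) ℝ) : Prop :=
  L.PosDef ∧ (∀ i, X i ⬝ᵥ L *ᵥ X i ≤ 1) ∧
    ∀ M : Matrix (Fin r) (Fin r) ℝ, M.PosDef → (∀ i, X i ⬝ᵥ M *ᵥ X i ≤ 1) → M.det ≤ L.det

/-- `J` is an outcome of the preconditioned successive projection algorithm on the rows of `X`
(the columns of `Xᵀ`): with `Q = L ^ (1/2)` for the minimum volume enclosing ellipsoid `L`,
the successive projection algorithm is run on the points `Q xᵢ`. -/
def IsPrecondSPAOutput {n r K : ℕ} (X : Matrix (Fin n) (Fin r) ℝ) (J : Fin K → Fin n) : Prop :=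
  ∃ Q : Matrix (Fin r) (Fin r) ℝ, Q.PosDef ∧ IsMinVolEllipsoid X (Q * Q) ∧
    IsSPAOutput (fun i => WithLp.toLp 2 (Q *ᵥ X i)) J

/-- `F̂ = Û[J, :]`. -/
def spocF {n K : ℕ} (Uhat : Matrix (Fin n) (Fin K) ℝ) (J : Fin K → Fin n) :
    Matrix (Fin K) (Fin K) ℝ :=
  Uhat.submatrix J id

/-- `Θ̂ = Û F̂ᵀ (F̂ F̂ᵀ)⁻¹`. -/
def spocTheta {n K : ℕ} (Uhat : Matrix (Fin n) (Fin K) ℝ) (J : Fin K → Fin n) :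
    Matrix (Fin n) (Fin K) ℝ :=
  Uhat * (spocF Uhat J)ᵀ * (spocF Uhat J * (spocF Uhat J)ᵀ)⁻¹

/-- The error bound with constant `C`:
`C K^{1/2} κ(Θ)³ λ_max(Θ)² β(A, P) + C K^{1/2} κ(Θ) λ_max(Θ) ‖A - P‖ / λ_K(P)`. -/
def nodeBound {n K : ℕ} (C : ℝ) (Θ : Matrix (Fin n) (Fin K) ℝ) (A P : Matrix (Fin n) (Fin n) ℝ)
    (U : Matrix (Fin n) (Fin K) ℝ) : ℝ :=
  C * Real.sqrt K * condNumber K Θ ^ 3 * singVal Θ 1 ^ 2 * beta A P U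
    + C * Real.sqrt K * condNumber K Θ * singVal Θ 1 * (specNorm (A - P) / singVal P K)

end SPOC

end

namespace SPOC

open Matrix

/-! ### Euclidean, Frobenius and operator norm bounds -/

section VecNorm

variable {n m l : ℕ}

/-! Since `U = Θ * F` has orthonormal columns, `F` is invertible with `F⁻¹ = Uᵀ * Θ`. Eigenvector
perturbation gives an invertible `O` with `Uhat` close to `U * O`, both in operator norm and row by
row. With `G = F * O` and `Y = Uhat * G⁻¹`, the rows of `Y` lie within `η = 2 λ_max(Θ) β` of the
rows of `Θ`, which are points of the standard simplex including all of its vertices. Preconditioned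
successive projection does not see the change of coordinates `G`, so it can be studied on `Y`.

Suppose `√K * η` is below an absolute constant. Then the minimum volume ellipsoid of the rows of `Y`
is close to the unit ball with absolute constants (`IsMinVolEllipsoid.quad_bounds`). The tool is a
first order condition in place of John's theorem: if a symmetric `D` has nonpositive quadratic form
at all contact points of the optimal `L`, then `tr (L⁻¹ D) ≤ 0`. Each estimate comes from a suitable
test matrix `D`. Points of the simplex away from the vertices turn out to be interior to the
ellipsoid, and uniqueness of the ellipsoid removes them. After preconditioning the simplex is almost
isometric to the standard one. Strong convexity of the squared norm then forces each projection step
to select a row within `24 η` of a new vertex (`IsSPAOutput.exists_perm`). The selected matrix is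
thus a small perturbation of a permutation matrix, and inverting it gives the bound with an absolute
constant.

If `√K * η` is not small, the same first order condition shows that each selected residual has norm
at least `1 / √K`. Hence the selected rows are independent, and the entries of the estimate are
bounded in terms of `K` alone (`abs_spocTheta_le`). The error is then at most a `K`-dependent
multiple of `λ_max(Θ)`, and a factor `√K * η` bounded below may be inserted for free. Finally
`λ_K(F) λ_max(Θ) ≤ 1`, so the stated condition on `β` places the problem in the first regime. -/

lemma vecNorm_eq_norm (v : Fin n → ℝ) :
    vecNorm v = ‖(WithLp.toLp 2 v : EuclideanSpace ℝ (Fin n))‖ := by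
  simp [vecNorm, EuclideanSpace.norm_eq]

lemma norm_eq_vecNorm (v : EuclideanSpace ℝ (Fin n)) : ‖v‖ = vecNorm v.ofLp := by
  simp [vecNorm, EuclideanSpace.norm_eq]

lemma vecNorm_nonneg (v : Fin n → ℝ) : 0 ≤ vecNorm v := Real.sqrt_nonneg _

lemma vecNorm_sq (v : Fin n → ℝ) : vecNorm v ^ 2 = v ⬝ᵥ v := by
  rw [vecNorm, Real.sq_sqrt (Finset.sum_nonneg fun _ _ => sq_nonneg _)]
  simp [dotProduct, sq]

lemma vecNorm_add_le (v w : Fin n → ℝ) : vecNorm (v + w) ≤ vecNorm v + vecNorm w := by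
  simp only [vecNorm_eq_norm, WithLp.toLp_add]
  exact norm_add_le _ _

lemma vecNorm_sub_le (v w : Fin n → ℝ) : vecNorm (v - w) ≤ vecNorm v + vecNorm w := by
  simp only [vecNorm_eq_norm, WithLp.toLp_sub]
  exact norm_sub_le _ _

lemma vecNorm_smul (a : ℝ) (v : Fin n → ℝ) : vecNorm (a • v) = |a| * vecNorm v := by
  simp only [vecNorm_eq_norm, WithLp.toLp_smul, norm_smul, Real.norm_eq_abs]

lemma vecNorm_neg (v : Fin n → ℝ) : vecNorm (-v) = vecNorm v := by
  simp [vecNorm]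

lemma vecNorm_zero : vecNorm (0 : Fin n → ℝ) = 0 := by
  simp [vecNorm]

lemma vecNorm_eq_zero {v : Fin n → ℝ} : vecNorm v = 0 ↔ v = 0 := by
  simp [vecNorm_eq_norm]

lemma vecNorm_pos {v : Fin n → ℝ} (hv : v ≠ 0) : 0 < vecNorm v :=
  lt_of_le_of_ne (vecNorm_nonneg v) fun h => hv (vecNorm_eq_zero.1 h.symm)

lemma vecNorm_single (k : Fin n) (a : ℝ) : vecNorm (Pi.single k a) = |a| := by
  rw [vecNorm, Finset.sum_eq_single k (by intro j _ hj; simp [hj]) (by simp), Pi.single_eq_same,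
    Real.sqrt_sq_eq_abs]

lemma abs_dotProduct_le (v w : Fin n → ℝ) : |v ⬝ᵥ w| ≤ vecNorm v * vecNorm w := by
  have h := abs_real_inner_le_norm (WithLp.toLp 2 v : EuclideanSpace ℝ (Fin n)) (WithLp.toLp 2 w)
  rw [← vecNorm_eq_norm, ← vecNorm_eq_norm] at h
  rw [dotProduct_comm]
  simpa [PiLp.inner_apply, dotProduct] using h

lemma dotProduct_le (v w : Fin n → ℝ) : v ⬝ᵥ w ≤ vecNorm v * vecNorm w :=
  (le_abs_self _).trans (abs_dotProduct_le v w)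

lemma abs_apply_le_vecNorm (v : Fin n → ℝ) (i : Fin n) : |v i| ≤ vecNorm v := by
  rw [vecNorm_eq_norm]
  simpa using PiLp.norm_apply_le (WithLp.toLp 2 v : EuclideanSpace ℝ (Fin n)) i

lemma vecNorm_sum_le {ι : Type*} (s : Finset ι) (f : ι → Fin n → ℝ) :
    vecNorm (∑ i ∈ s, f i) ≤ ∑ i ∈ s, vecNorm (f i) := by
  simp only [vecNorm_eq_norm, WithLp.toLp_sum]
  exact norm_sum_le _ _

lemma frobNorm_nonneg (M : Matrix (Fin m) (Fin n) ℝ) : 0 ≤ frobNorm M := Real.sqrt_nonneg _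

lemma frobNorm_sq (M : Matrix (Fin m) (Fin n) ℝ) : frobNorm M ^ 2 = ∑ i, vecNorm (M i) ^ 2 := by
  have h : 0 ≤ ∑ i, ∑ j, M i j ^ 2 :=
    Finset.sum_nonneg fun _ _ => Finset.sum_nonneg fun _ _ => sq_nonneg _
  refine (Real.sq_sqrt h).trans (Finset.sum_congr rfl fun i _ => ?_)
  exact (Real.sq_sqrt (Finset.sum_nonneg fun _ _ => sq_nonneg _)).symm

lemma frobNorm_transpose (M : Matrix (Fin m) (Fin n) ℝ) : frobNorm Mᵀ = frobNorm M := by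
  rw [frobNorm, frobNorm, Finset.sum_comm]
  rfl

lemma frobNorm_le_of_rows {M : Matrix (Fin m) (Fin n) ℝ} {a : ℝ} (ha : 0 ≤ a)
    (h : ∀ i, vecNorm (M i) ≤ a) : frobNorm M ≤ √m * a := by
  refine abs_le_of_sq_le_sq' ?_ (by positivity) |>.2
  rw [frobNorm_sq, mul_pow, Real.sq_sqrt (by positivity)]
  calc ∑ i, vecNorm (M i) ^ 2 ≤ ∑ _i : Fin m, a ^ 2 :=
        Finset.sum_le_sum fun i _ => pow_le_pow_left₀ (vecNorm_nonneg _) (h i) 2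
    _ = m * a ^ 2 := by simp

lemma frobNorm_add_le (M N : Matrix (Fin m) (Fin n) ℝ) :
    frobNorm (M + N) ≤ frobNorm M + frobNorm N := by
  have key : ∀ M : Matrix (Fin m) (Fin n) ℝ,
      frobNorm M = ‖(WithLp.toLp 2 (fun i => WithLp.toLp 2 (M i)) :
        PiLp 2 fun _ : Fin m => EuclideanSpace ℝ (Fin n))‖ := by
    intro M
    rw [PiLp.norm_eq_of_L2, ← Real.sqrt_sq (frobNorm_nonneg M), frobNorm_sq]
    simp [vecNorm_eq_norm]
  rw [key, key, key]
  exact norm_add_le (WithLp.toLp 2 (fun i => WithLp.toLp 2 (M i)) :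
        PiLp 2 fun _ : Fin m => EuclideanSpace ℝ (Fin n))
        (WithLp.toLp 2 (fun i => WithLp.toLp 2 (N i)))

lemma frobNorm_neg (M : Matrix (Fin m) (Fin n) ℝ) : frobNorm (-M) = frobNorm M := by
  simp [frobNorm]

lemma frobNorm_sub_le (M N : Matrix (Fin m) (Fin n) ℝ) :
    frobNorm (M - N) ≤ frobNorm M + frobNorm N := by
  rw [sub_eq_add_neg, ← frobNorm_neg N]
  exact frobNorm_add_le _ _

/-- `M` has spectral norm at most `a`. -/
def OpLe (M : Matrix (Fin m) (Fin n) ℝ) (a : ℝ) : Prop :=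
  ∀ v, vecNorm (M *ᵥ v) ≤ a * vecNorm v

lemma OpLe.mono {M : Matrix (Fin m) (Fin n) ℝ} {a b : ℝ} (h : OpLe M a) (hab : a ≤ b) :
    OpLe M b := fun v =>
  (h v).trans (mul_le_mul_of_nonneg_right hab (vecNorm_nonneg v))

lemma OpLe.mul {M : Matrix (Fin m) (Fin n) ℝ} {N : Matrix (Fin n) (Fin l) ℝ} {a b : ℝ}
    (ha : 0 ≤ a) (hM : OpLe M a) (hN : OpLe N b) : OpLe (M * N) (a * b) := fun v => by
  rw [← mulVec_mulVec, mul_assoc]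
  exact (hM _).trans (mul_le_mul_of_nonneg_left (hN v) ha)

lemma OpLe.add {M N : Matrix (Fin m) (Fin n) ℝ} {a b : ℝ} (hM : OpLe M a) (hN : OpLe N b) :
    OpLe (M + N) (a + b) := fun v => by
  rw [add_mulVec, add_mul]
  exact (vecNorm_add_le _ _).trans (add_le_add (hM v) (hN v))

lemma OpLe.neg {M : Matrix (Fin m) (Fin n) ℝ} {a : ℝ} (hM : OpLe M a) : OpLe (-M) a := fun v => by
  rw [neg_mulVec, vecNorm_neg]
  exact hM v

lemma OpLe.sub {M N : Matrix (Fin m) (Fin n) ℝ} {a b : ℝ} (hM : OpLe M a) (hN : OpLe N b) :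
    OpLe (M - N) (a + b) := by
  rw [sub_eq_add_neg]
  exact hM.add hN.neg

lemma OpLe.transpose {M : Matrix (Fin m) (Fin n) ℝ} {a : ℝ} (ha : 0 ≤ a) (hM : OpLe M a) :
    OpLe Mᵀ a := by
  intro w
  have h1 : vecNorm (Mᵀ *ᵥ w) ^ 2 ≤ (a * vecNorm w) * vecNorm (Mᵀ *ᵥ w) := by
    rw [vecNorm_sq]
    have : (Mᵀ *ᵥ w) ⬝ᵥ (Mᵀ *ᵥ w) = w ⬝ᵥ (M *ᵥ (Mᵀ *ᵥ w)) := by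
      rw [mulVec_transpose, dotProduct_mulVec]
    rw [this]
    calc w ⬝ᵥ (M *ᵥ (Mᵀ *ᵥ w)) ≤ vecNorm w * vecNorm (M *ᵥ (Mᵀ *ᵥ w)) := dotProduct_le _ _
      _ ≤ vecNorm w * (a * vecNorm (Mᵀ *ᵥ w)) :=
        mul_le_mul_of_nonneg_left (hM _) (vecNorm_nonneg w)
      _ = _ := by ring
  rcases (vecNorm_nonneg (Mᵀ *ᵥ w)).eq_or_lt with h0 | h0
  · rw [← h0]
    exact mul_nonneg ha (vecNorm_nonneg w)
  · rw [sq] at h1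
    exact le_of_mul_le_mul_right h1 h0

lemma opLe_one : OpLe (1 : Matrix (Fin n) (Fin n) ℝ) 1 := fun v => by simp

lemma opLe_specNorm (M : Matrix (Fin m) (Fin n) ℝ) : OpLe M (specNorm M) := fun v => by
  have := (LinearMap.toContinuousLinearMap (Matrix.toEuclideanLin M)).le_opNorm (WithLp.toLp 2 v)
  rw [vecNorm_eq_norm, vecNorm_eq_norm]
  exact this

lemma specNorm_nonneg (M : Matrix (Fin m) (Fin n) ℝ) : 0 ≤ specNorm M := norm_nonneg _

/-- Multiplication on the left by a matrix with bounded spectral norm. -/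
lemma OpLe.vecNorm_row_mul {M : Matrix (Fin n) (Fin l) ℝ} {a : ℝ} (hM : OpLe Mᵀ a)
    (N : Matrix (Fin m) (Fin n) ℝ) (i : Fin m) : vecNorm ((N * M) i) ≤ a * vecNorm (N i) := by
  have : (N * M) i = Mᵀ *ᵥ N i := by
    rw [mulVec_transpose]; rfl
  rw [this]
  exact hM _

lemma frobNorm_mul_le_right {M : Matrix (Fin n) (Fin l) ℝ} {a : ℝ} (ha : 0 ≤ a) (hM : OpLe Mᵀ a)
    (N : Matrix (Fin m) (Fin n) ℝ) : frobNorm (N * M) ≤ a * frobNorm N := by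
  refine abs_le_of_sq_le_sq' ?_ (mul_nonneg ha (frobNorm_nonneg _)) |>.2
  rw [mul_pow, frobNorm_sq, frobNorm_sq, Finset.mul_sum]
  refine Finset.sum_le_sum fun i _ => ?_
  rw [← mul_pow]
  exact pow_le_pow_left₀ (vecNorm_nonneg _) (hM.vecNorm_row_mul N i) 2

lemma frobNorm_mul_le_left {M : Matrix (Fin m) (Fin n) ℝ} {a : ℝ} (ha : 0 ≤ a) (hM : OpLe M a)
    (N : Matrix (Fin n) (Fin l) ℝ) : frobNorm (M * N) ≤ a * frobNorm N := by
  rw [← frobNorm_transpose, transpose_mul, ← frobNorm_transpose N]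
  exact frobNorm_mul_le_right ha (by rwa [transpose_transpose]) _

lemma OpLe.frobNorm_le {M : Matrix (Fin m) (Fin n) ℝ} {a : ℝ} (ha : 0 ≤ a) (hM : OpLe M a) :
    frobNorm M ≤ √n * a := by
  rw [← frobNorm_transpose]
  refine frobNorm_le_of_rows ha fun i => ?_
  have : Mᵀ i = M *ᵥ Pi.single i 1 := by ext j; simp
  rw [this]
  simpa [vecNorm_single] using hM (Pi.single i 1)

lemma opLe_frobNorm (M : Matrix (Fin m) (Fin n) ℝ) : OpLe M (frobNorm M) := fun v => by
  refine abs_le_of_sq_le_sq' ?_ (mul_nonneg (frobNorm_nonneg _) (vecNorm_nonneg _)) |>.2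
  rw [mul_pow, frobNorm_sq, Finset.sum_mul]
  nth_rw 1 [vecNorm]
  rw [Real.sq_sqrt (Finset.sum_nonneg fun _ _ => sq_nonneg _)]
  refine Finset.sum_le_sum fun i _ => ?_
  rw [← mul_pow, ← sq_abs]
  exact pow_le_pow_left₀ (abs_nonneg _) (abs_dotProduct_le _ _) 2

/-- A matrix with orthonormal columns preserves the norm. -/
lemma vecNorm_mulVec_of_orthonormal {U : Matrix (Fin m) (Fin n) ℝ} (hU : Uᵀ * U = 1)
    (v : Fin n → ℝ) : vecNorm (U *ᵥ v) = vecNorm v := by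
  have : vecNorm (U *ᵥ v) ^ 2 = vecNorm v ^ 2 := by
    rw [vecNorm_sq, vecNorm_sq, dotProduct_mulVec, ← mulVec_transpose, mulVec_mulVec, hU,
      one_mulVec]
  exact (pow_left_inj₀ (vecNorm_nonneg _) (vecNorm_nonneg _) two_ne_zero).1 this

lemma opLe_of_orthonormal {U : Matrix (Fin m) (Fin n) ℝ} (hU : Uᵀ * U = 1) : OpLe U 1 :=
  fun v => by rw [vecNorm_mulVec_of_orthonormal hU, one_mul]

lemma opLe_one_sub_proj {U : Matrix (Fin m) (Fin n) ℝ} (hU : Uᵀ * U = 1) :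
    OpLe (1 - U * Uᵀ) 1 := fun v => by
  have key : vecNorm ((1 - U * Uᵀ) *ᵥ v) ^ 2 + vecNorm (Uᵀ *ᵥ v) ^ 2 = vecNorm v ^ 2 := by
    have h1 : (U * Uᵀ) *ᵥ v = U *ᵥ (Uᵀ *ᵥ v) := (mulVec_mulVec _ _ _).symm
    rw [sub_mulVec, one_mulVec, h1, vecNorm_sq, vecNorm_sq, vecNorm_sq]
    have h2 : (U *ᵥ (Uᵀ *ᵥ v)) ⬝ᵥ (U *ᵥ (Uᵀ *ᵥ v)) = (Uᵀ *ᵥ v) ⬝ᵥ (Uᵀ *ᵥ v) := by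
      rw [← vecNorm_sq, ← vecNorm_sq, vecNorm_mulVec_of_orthonormal hU]
    have h3 : v ⬝ᵥ (U *ᵥ (Uᵀ *ᵥ v)) = (Uᵀ *ᵥ v) ⬝ᵥ (Uᵀ *ᵥ v) := by
      rw [dotProduct_mulVec, mulVec_transpose]
    have h4 := dotProduct_comm v (U *ᵥ (Uᵀ *ᵥ v))
    rw [sub_dotProduct, dotProduct_sub, dotProduct_sub, h2, ← h4, h3]
    ring
  rw [one_mul]
  exact abs_le_of_sq_le_sq' (by nlinarith [sq_nonneg (vecNorm (Uᵀ *ᵥ v))]) (vecNorm_nonneg _) |>.2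

end VecNorm

/-! ### Singular values -/

section SingVal

variable {m n : ℕ}

/-- The columns of `W` form an eigenbasis of `Mᵀ * M`, which diagonalises the form `‖M x‖²`; the
singular value bounds for norms and subspaces are read off from it. The shift `j + 1` reconciles
counting from one in `singVal` with `Fin`. -/
lemma exists_right_singular_basis (M : Matrix (Fin m) (Fin n) ℝ) :
    ∃ W : Matrix (Fin n) (Fin n) ℝ, Wᵀ * W = 1 ∧
      ∀ y : Fin n → ℝ, vecNorm (M *ᵥ (W *ᵥ y)) ^ 2 =
        ∑ j : Fin n, (singVal M (j + 1) * y j) ^ 2 := by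
  set T := Matrix.toEuclideanLin M with hT
  have hn : Module.finrank ℝ (EuclideanSpace ℝ (Fin n)) = n := by simp
  set b := T.isSymmetric_adjoint_comp_self.eigenvectorBasis hn with hb
  have hlam : ∀ j, T.isSymmetric_adjoint_comp_self.eigenvalues hn j = singVal M (j + 1) ^ 2 := by
    intro j
    rw [singVal, Nat.add_sub_cancel, T.sq_singularValues_fin hn j]
  refine ⟨Matrix.of fun i j => b j i, ?_, fun y => ?_⟩
  · ext i j
    have := orthonormal_iff_ite.1 b.orthonormal i j
    rw [Matrix.one_apply, ← this]
    simp only [Matrix.mul_apply, PiLp.inner_apply, transpose_apply, of_apply]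
    exact Finset.sum_congr rfl fun x _ => mul_comm _ _
  · have h1 : (WithLp.toLp 2 ((Matrix.of fun i j => b j i) *ᵥ y) :
        EuclideanSpace ℝ (Fin n)) = ∑ j, y j • b j := by
      ext i
      simp [mulVec, dotProduct, mul_comm]
    have h2 : vecNorm (M *ᵥ ((Matrix.of fun i j => b j i) *ᵥ y))
        = ‖T (∑ j, y j • b j)‖ := by
      rw [vecNorm_eq_norm, ← h1]; rfl
    rw [h2, ← real_inner_self_eq_norm_sq, ← LinearMap.adjoint_inner_left]
    have h3 : (LinearMap.adjoint T) (T (∑ j, y j • b j))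
        = ∑ j : Fin n, (singVal M (j + 1) ^ 2 * y j) • b j := by
      rw [map_sum, map_sum]
      refine Finset.sum_congr rfl fun j _ => ?_
      have := T.isSymmetric_adjoint_comp_self.apply_eigenvectorBasis hn j
      rw [map_smul, map_smul, ← LinearMap.comp_apply, this, hlam, smul_smul, mul_comm]
      rfl
    rw [h3, b.orthonormal.inner_sum]
    refine Finset.sum_congr rfl fun j _ => ?_
    simp only [conj_trivial]
    ring

lemma singVal_nonneg (M : Matrix (Fin m) (Fin n) ℝ) (k : ℕ) : 0 ≤ singVal M k :=
  LinearMap.singularValues_nonneg _ _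

lemma singVal_anti (M : Matrix (Fin m) (Fin n) ℝ) {j k : ℕ} (h : j ≤ k) :
    singVal M k ≤ singVal M j :=
  LinearMap.singularValues_antitone _ (Nat.sub_le_sub_right h 1)

lemma opLe_singVal_one (M : Matrix (Fin m) (Fin n) ℝ) : OpLe M (singVal M 1) := fun v => by
  obtain ⟨W, hW, h⟩ := exists_right_singular_basis M
  have hW' : W * Wᵀ = 1 := mul_eq_one_comm.1 hW
  have hv : v = W *ᵥ (Wᵀ *ᵥ v) := by rw [mulVec_mulVec, hW', one_mulVec]
  set y := Wᵀ *ᵥ v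
  rw [hv, vecNorm_mulVec_of_orthonormal hW]
  refine abs_le_of_sq_le_sq' ?_ (mul_nonneg (singVal_nonneg _ _) (vecNorm_nonneg _)) |>.2
  rw [h, mul_pow, vecNorm_sq, dotProduct, Finset.mul_sum]
  refine Finset.sum_le_sum fun j _ => ?_
  rw [mul_pow, ← sq]
  exact mul_le_mul_of_nonneg_right
    (pow_le_pow_left₀ (singVal_nonneg _ _) (singVal_anti M (Nat.le_add_left 1 j)) 2) (sq_nonneg _)

lemma singVal_one_le {M : Matrix (Fin m) (Fin n) ℝ} {a : ℝ} (ha : 0 ≤ a) (hM : OpLe M a) :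
    singVal M 1 ≤ a := by
  rcases Nat.eq_zero_or_pos n with rfl | hn
  · have : singVal M 1 = 0 := LinearMap.singularValues_of_finrank_le _ (by simp)
    rwa [this]
  · obtain ⟨W, hW, h⟩ := exists_right_singular_basis M
    have h1 := h (Pi.single ⟨0, hn⟩ 1)
    rw [Finset.sum_eq_single ⟨0, hn⟩ (by intro j _ hj; simp [hj]) (by simp)] at h1
    simp only [zero_add, Pi.single_eq_same, mul_one] at h1
    have h2 := hM (W *ᵥ Pi.single ⟨0, hn⟩ 1)
    rw [vecNorm_mulVec_of_orthonormal hW, vecNorm_single, abs_one, mul_one] at h2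
    rw [pow_left_inj₀ (vecNorm_nonneg _) (singVal_nonneg _ _) two_ne_zero] at h1
    rwa [← h1]

/-- The first `k` right singular vectors span a space on which `M` is bounded below by its `k`-th
singular value. -/
lemma exists_singVal_subspace (M : Matrix (Fin m) (Fin n) ℝ) {k : ℕ} (hk : k ≤ n) :
    ∃ V : Matrix (Fin n) (Fin k) ℝ, Vᵀ * V = 1 ∧
      ∀ y : Fin k → ℝ, singVal M k * vecNorm y ≤ vecNorm (M *ᵥ (V *ᵥ y)) := by
  obtain ⟨W, hW, h⟩ := exists_right_singular_basis M
  refine ⟨W.submatrix id (Fin.castLE hk), ?_, fun y => ?_⟩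
  · ext i j
    have := congrFun (congrFun hW (Fin.castLE hk i)) (Fin.castLE hk j)
    rw [Matrix.mul_apply] at this ⊢
    simp only [transpose_apply, submatrix_apply, id] at this ⊢
    rw [this, Matrix.one_apply, Matrix.one_apply]
    simp [Fin.ext_iff]
  · set z : Fin n → ℝ := fun j => if hj : (j : ℕ) < k then y ⟨j, hj⟩ else 0 with hz
    have hz1 : ∀ f : Fin n → ℝ, ∑ j, f j * z j = ∑ j, f (Fin.castLE hk j) * y j := by
      intro f
      have hinj : Function.Injective (Fin.castLE hk) := Fin.castLE_injective hk
      rw [← Finset.sum_subset (Finset.subset_univ (Finset.univ.map ⟨_, hinj⟩)), Finset.sum_map]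
      · refine Finset.sum_congr rfl fun j _ => ?_
        simp [hz]
      · intro j _ hj
        have : ¬ (j : ℕ) < k := by
          intro hjk
          exact hj (Finset.mem_map.2 ⟨⟨j, hjk⟩, Finset.mem_univ _, rfl⟩)
        simp [hz, this]
    have h1 : W.submatrix id (Fin.castLE hk) *ᵥ y = W *ᵥ z := by
      ext i
      simp only [mulVec, dotProduct, submatrix_apply, id]
      rw [hz1]
    rw [h1]
    refine abs_le_of_sq_le_sq' ?_ (vecNorm_nonneg _) |>.2
    rw [h, mul_pow, vecNorm_sq, dotProduct, Finset.mul_sum]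
    have h2 : ∑ j : Fin n, (singVal M (j + 1) * z j) ^ 2 =
        ∑ j : Fin n, (singVal M (j + 1) ^ 2 * z j) * z j :=
      Finset.sum_congr rfl fun _ _ => by ring
    rw [h2, hz1]
    refine Finset.sum_le_sum fun j _ => ?_
    have h3 : z (Fin.castLE hk j) = y j := by simp [hz]
    rw [h3, mul_assoc]
    exact mul_le_mul_of_nonneg_right
      (pow_le_pow_left₀ (singVal_nonneg _ _) (singVal_anti M (by simp)) 2)
      (mul_self_nonneg _)

lemma singVal_pos_of_rank {M : Matrix (Fin m) (Fin n) ℝ} {k : ℕ} (hk : 1 ≤ k) (h : k ≤ M.rank) :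
    0 < singVal M k := by
  rw [singVal, LinearMap.singularValues_pos_iff_lt_finrank_range]
  rw [Matrix.rank_eq_finrank_range_toLin M (EuclideanSpace.basisFun (Fin m) ℝ).toBasis
    (EuclideanSpace.basisFun (Fin n) ℝ).toBasis] at h
  rw [toEuclideanLin_eq_toLin_orthonormal]
  omega

end SingVal

/-! ### Quadratic forms of positive definite matrices -/

section PosDef

variable {n r : ℕ}

open scoped MatrixOrder in
lemma exists_factor {L : Matrix (Fin r) (Fin r) ℝ} (hL : L.PosSemidef) :
    ∃ R : Matrix (Fin r) (Fin r) ℝ, L = Rᵀ * R := by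
  refine ⟨CFC.sqrt L, ?_⟩
  have h1 : (CFC.sqrt L).IsHermitian := (nonneg_iff_posSemidef.1 (CFC.sqrt_nonneg L)).1
  rw [IsHermitian, conjTranspose_eq_transpose_of_trivial] at h1
  rw [h1, CFC.sqrt_mul_sqrt_self L (nonneg_iff_posSemidef.2 hL)]

lemma exists_isUnit_factor {L : Matrix (Fin r) (Fin r) ℝ} (hL : L.PosDef) :
    ∃ R : Matrix (Fin r) (Fin r) ℝ, IsUnit R ∧ L = Rᵀ * R := by
  obtain ⟨R, hR⟩ := exists_factor hL.posSemidef
  refine ⟨R, ?_, hR⟩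
  have h := hL.det_pos
  rw [hR, det_mul, det_transpose] at h
  rw [isUnit_iff_isUnit_det, isUnit_iff_ne_zero]
  rintro h0
  simp [h0] at h

lemma dotProduct_factor {L R : Matrix (Fin r) (Fin r) ℝ} (h : L = Rᵀ * R) (x y : Fin r → ℝ) :
    x ⬝ᵥ L *ᵥ y = (R *ᵥ x) ⬝ᵥ (R *ᵥ y) := by
  rw [h, ← mulVec_mulVec, dotProduct_mulVec, ← mulVec_transpose, transpose_transpose]

lemma vecNorm_factor_sq {L R : Matrix (Fin r) (Fin r) ℝ} (h : L = Rᵀ * R) (x : Fin r → ℝ) :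
    vecNorm (R *ᵥ x) ^ 2 = x ⬝ᵥ L *ᵥ x := by
  rw [vecNorm_sq, dotProduct_factor h]

lemma posDef_isSymm {L : Matrix (Fin r) (Fin r) ℝ} (hL : L.PosDef) : Lᵀ = L := by
  have h := hL.1
  rwa [IsHermitian, conjTranspose_eq_transpose_of_trivial] at h

lemma posDef_quad_nonneg {L : Matrix (Fin r) (Fin r) ℝ} (hL : L.PosDef) (x : Fin r → ℝ) :
    0 ≤ x ⬝ᵥ L *ᵥ x := by
  have := hL.posSemidef.dotProduct_mulVec_nonneg x
  simpa using this

lemma posDef_of_quad {L : Matrix (Fin r) (Fin r) ℝ} (h1 : Lᵀ = L)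
    (h2 : ∀ x, x ≠ 0 → 0 < x ⬝ᵥ L *ᵥ x) : L.PosDef := by
  refine PosDef.of_dotProduct_mulVec_pos ?_ fun x hx => ?_
  · rwa [IsHermitian, conjTranspose_eq_transpose_of_trivial]
  · simpa using h2 x hx

lemma posSemidef_of_quad {L : Matrix (Fin r) (Fin r) ℝ} (h1 : Lᵀ = L)
    (h2 : ∀ x, 0 ≤ x ⬝ᵥ L *ᵥ x) : L.PosSemidef := by
  refine PosSemidef.of_dotProduct_mulVec_nonneg ?_ fun x => ?_
  · rwa [IsHermitian, conjTranspose_eq_transpose_of_trivial]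
  · simpa using h2 x

/-- The Cauchy–Schwarz inequality for the dual norms given by `L` and `L⁻¹`. -/
lemma dotProduct_sq_le_quad_mul_quad_inv {L : Matrix (Fin r) (Fin r) ℝ} (hL : L.PosDef)
    (x y : Fin r → ℝ) : (x ⬝ᵥ y) ^ 2 ≤ (x ⬝ᵥ L *ᵥ x) * (y ⬝ᵥ L⁻¹ *ᵥ y) := by
  obtain ⟨R, hR, h⟩ := exists_isUnit_factor hL
  have hR' := (isUnit_iff_isUnit_det R).1 hR
  have h2 : L⁻¹ = (R⁻¹ᵀ)ᵀ * R⁻¹ᵀ := by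
    rw [h, Matrix.mul_inv_rev, transpose_transpose, transpose_nonsing_inv]
  have h3 : x ⬝ᵥ y = (R *ᵥ x) ⬝ᵥ (R⁻¹ᵀ *ᵥ y) := by
    rw [mulVec_transpose, dotProduct_comm (R *ᵥ x), ← dotProduct_mulVec, mulVec_mulVec,
      nonsing_inv_mul R hR', one_mulVec, dotProduct_comm]
  rw [← vecNorm_factor_sq h, ← vecNorm_factor_sq h2, h3, ← mul_pow, ← sq_abs]
  exact pow_le_pow_left₀ (abs_nonneg _) (abs_dotProduct_le _ _) 2

lemma abs_quad_le (M : Matrix (Fin r) (Fin r) ℝ) (x : Fin r → ℝ) :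
    |x ⬝ᵥ M *ᵥ x| ≤ frobNorm M * vecNorm x ^ 2 := by
  refine (abs_dotProduct_le _ _).trans ?_
  have := mul_le_mul_of_nonneg_left (opLe_frobNorm M x) (vecNorm_nonneg x)
  linarith

/-- Cauchy–Schwarz for the dual forms at `y = x` gives `‖x‖⁴ ≤ (xᵀ L x)(xᵀ L⁻¹ x)`, so an upper
bound for `L⁻¹` becomes a lower bound for `L`. -/
lemma quad_inv_le_of_le_quad {L : Matrix (Fin r) (Fin r) ℝ} (hL : L.PosDef) {a : ℝ}
    (h : ∀ x, x ⬝ᵥ L⁻¹ *ᵥ x ≤ a * vecNorm x ^ 2) (x : Fin r → ℝ) :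
    vecNorm x ^ 2 ≤ a * (x ⬝ᵥ L *ᵥ x) := by
  have h1 := dotProduct_sq_le_quad_mul_quad_inv hL x x
  rw [← vecNorm_sq] at h1
  rcases (sq_nonneg (vecNorm x)).eq_or_lt with h0 | h0
  · have hx : x = 0 := vecNorm_eq_zero.1 (pow_eq_zero_iff two_ne_zero |>.1 h0.symm)
    simp [hx, vecNorm_zero]
  · have h2 := mul_le_mul_of_nonneg_left (h x) (posDef_quad_nonneg hL x)
    nlinarith

lemma exists_pos_le_quad {L : Matrix (Fin r) (Fin r) ℝ} (hL : L.PosDef) :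
    ∃ m > 0, ∀ x, m * vecNorm x ^ 2 ≤ x ⬝ᵥ L *ᵥ x := by
  have hf := frobNorm_nonneg L⁻¹
  refine ⟨(frobNorm L⁻¹ + 1)⁻¹, by positivity, fun x => ?_⟩
  have := quad_inv_le_of_le_quad hL (a := frobNorm L⁻¹ + 1) (fun y =>
    ((le_abs_self _).trans (abs_quad_le _ _)).trans
      (mul_le_mul_of_nonneg_right (by linarith) (sq_nonneg _))) x
  rw [inv_mul_le_iff₀ (by positivity)]
  exact this

/-- The quadratic form of `L` is bounded above if that of `L⁻¹` is bounded below. -/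
lemma quad_le_of_le_quad_inv {L : Matrix (Fin r) (Fin r) ℝ} (hL : L.PosDef) {a : ℝ} (ha : 0 < a)
    (h : ∀ x, a * vecNorm x ^ 2 ≤ x ⬝ᵥ L⁻¹ *ᵥ x) (x : Fin r → ℝ) :
    a * (x ⬝ᵥ L *ᵥ x) ≤ vecNorm x ^ 2 := by
  have hu : IsUnit L.det := hL.det_pos.ne'.isUnit
  -- At the vector `L x`, the form of `L⁻¹` equals the form of `L` at `x`.
  have h1 := h (L *ᵥ x)
  have h2 : (L *ᵥ x) ⬝ᵥ L⁻¹ *ᵥ (L *ᵥ x) = x ⬝ᵥ L *ᵥ x := by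
    rw [mulVec_mulVec, nonsing_inv_mul L hu, one_mulVec, dotProduct_comm]
  rw [h2] at h1
  have h3 := dotProduct_le x (L *ᵥ x)
  have h4 := posDef_quad_nonneg hL x
  set q := x ⬝ᵥ L *ᵥ x
  have h5 : q ^ 2 ≤ vecNorm x ^ 2 * vecNorm (L *ᵥ x) ^ 2 := by
    rw [← mul_pow]
    exact pow_le_pow_left₀ h4 h3 2
  rcases h4.eq_or_lt with h0 | h0
  · rw [← h0, mul_zero]
    exact sq_nonneg _
  · have h6 : (a * q) * q ≤ vecNorm x ^ 2 * q := by
      nlinarith [sq_nonneg (vecNorm x)]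
    exact le_of_mul_le_mul_right h6 h0

lemma trace_factor {L R : Matrix (Fin r) (Fin r) ℝ} (h : L = Rᵀ * R) :
    L.trace = ∑ k, vecNorm (R *ᵥ Pi.single k 1) ^ 2 := by
  rw [Matrix.trace]
  refine Finset.sum_congr rfl fun k _ => ?_
  rw [vecNorm_factor_sq h]
  simp

lemma quad_le_trace {L : Matrix (Fin r) (Fin r) ℝ} (hL : L.PosSemidef) (x : Fin r → ℝ) :
    x ⬝ᵥ L *ᵥ x ≤ L.trace * vecNorm x ^ 2 := by
  obtain ⟨R, h⟩ := exists_factor hL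
  have h1 : L.trace = frobNorm R ^ 2 := by
    rw [trace_factor h, ← frobNorm_transpose, frobNorm_sq]
    refine Finset.sum_congr rfl fun k _ => ?_
    congr 2
    ext j
    simp
  rw [← vecNorm_factor_sq h, h1, ← mul_pow]
  exact pow_le_pow_left₀ (vecNorm_nonneg _) (opLe_frobNorm R x) 2

end PosDef

/-! ### Minimum volume ellipsoids: optimality, uniqueness, existence -/

section Ellipsoid

variable {n r : ℕ} {X : Matrix (Fin n) (Fin r) ℝ} {L : Matrix (Fin r) (Fin r) ℝ}

open Filter Topology in
/-- First order optimality condition for the minimum volume ellipsoid. -/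
lemma IsMinVolEllipsoid.trace_inv_mul_nonpos (h : IsMinVolEllipsoid X L)
    {D : Matrix (Fin r) (Fin r) ℝ} (hD : Dᵀ = D)
    (hc : ∀ i, X i ⬝ᵥ L *ᵥ X i = 1 → X i ⬝ᵥ D *ᵥ X i ≤ 0) : (L⁻¹ * D).trace ≤ 0 := by
  obtain ⟨hL, hX, hmax⟩ := h
  have hu : IsUnit L.det := hL.det_pos.ne'.isUnit
  -- Otherwise `L + t • D` beats `L` for small `t > 0`: its determinant is larger to first order, it
  -- is still positive definite, and it is still feasible.
  by_contra! hpos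
  have hquad : ∀ (t : ℝ) x, x ⬝ᵥ (L + t • D) *ᵥ x = x ⬝ᵥ L *ᵥ x + t * (x ⬝ᵥ D *ᵥ x) := by
    intro t x
    rw [add_mulVec, smul_mulVec, dotProduct_add, dotProduct_smul, smul_eq_mul]
  have hdet : ∀ᶠ t : ℝ in 𝓝[>] 0, L.det < (L + t • D).det := by
    -- The second order remainder in `det (1 + t M) = 1 + t tr M + t² p(t)`.
    set p := (det (1 + (Polynomial.X : Polynomial ℝ) •
      (L⁻¹ * D).map Polynomial.C)).divX.divX with hp
    have h1 : ∀ t : ℝ, (L + t • D).det = L.det *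
        (1 + t * ((L⁻¹ * D).trace + p.eval t * t)) := by
      intro t
      have : L + t • D = L * (1 + t • (L⁻¹ * D)) := by
        rw [mul_add, mul_one, mul_smul_comm, ← mul_assoc, mul_nonsing_inv L hu, one_mul]
      rw [this, det_mul, det_one_add_smul]
      ring
    have h2 : Tendsto (fun t : ℝ => (L⁻¹ * D).trace + p.eval t * t) (𝓝 0)
        (𝓝 ((L⁻¹ * D).trace + p.eval 0 * 0)) := by
      refine Continuous.tendsto ?_ 0
      have := p.continuous
      fun_prop
    rw [mul_zero, add_zero] at h2
    have h3 := (h2.eventually (lt_mem_nhds hpos)).filter_mono (nhdsWithin_le_nhds (s := Set.Ioi 0))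
    filter_upwards [h3, self_mem_nhdsWithin] with t ht ht0
    rw [h1]
    have : 0 < t * ((L⁻¹ * D).trace + p.eval t * t) := mul_pos ht0 ht
    nlinarith [hL.det_pos]
  have hpd : ∀ᶠ t : ℝ in 𝓝[>] 0, (L + t • D).PosDef := by
    obtain ⟨m, hm, hm'⟩ := exists_pos_le_quad hL
    have h1 : ∀ᶠ t : ℝ in 𝓝[>] 0, t < m / (frobNorm D + 1) := by
      refine Filter.Eventually.filter_mono nhdsWithin_le_nhds (gt_mem_nhds ?_)
      have := frobNorm_nonneg D
      positivity
    filter_upwards [h1, self_mem_nhdsWithin] with t ht ht0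
    have ht0' : 0 < t := ht0
    refine posDef_of_quad ?_ fun x hx => ?_
    · rw [transpose_add, transpose_smul, hD, posDef_isSymm hL]
    · rw [hquad]
      have hx' := vecNorm_pos hx
      have hf := frobNorm_nonneg D
      rw [lt_div_iff₀ (by positivity)] at ht
      have h2 := (abs_le.1 (abs_quad_le D x)).1
      have h3 : t * (-(frobNorm D * vecNorm x ^ 2)) ≤ t * (x ⬝ᵥ D *ᵥ x) :=
        mul_le_mul_of_nonneg_left h2 ht0'.le
      have h4 := hm' x
      have h5 : 0 < (m - t * frobNorm D) * vecNorm x ^ 2 := by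
        have : 0 < m - t * frobNorm D := by nlinarith
        positivity
      nlinarith
  have hfeas : ∀ᶠ t : ℝ in 𝓝[>] 0, ∀ i, X i ⬝ᵥ (L + t • D) *ᵥ X i ≤ 1 := by
    rw [eventually_all]
    intro i
    -- Active constraints survive by the sign of `D` there, inactive ones by continuity.
    rcases (hX i).eq_or_lt with h1 | h1
    · filter_upwards [self_mem_nhdsWithin] with t ht
      rw [hquad, h1]
      have ht' : 0 < t := ht
      nlinarith [hc i h1]
    · have h2 : Tendsto (fun t : ℝ => X i ⬝ᵥ L *ᵥ X i + t * (X i ⬝ᵥ D *ᵥ X i)) (𝓝 0)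
          (𝓝 (X i ⬝ᵥ L *ᵥ X i + 0 * (X i ⬝ᵥ D *ᵥ X i))) :=
        Continuous.tendsto (by fun_prop) 0
      rw [zero_mul, add_zero] at h2
      filter_upwards [(h2.eventually (gt_mem_nhds h1)).filter_mono nhdsWithin_le_nhds] with t ht
      rw [hquad]
      exact ht.le
  obtain ⟨t, h1, h2, h3⟩ := (hdet.and (hpd.and hfeas)).exists
  exact absurd (hmax _ h2 h3) (not_le.2 h1)

/-- The equality case of AM–GM for the eigenvalues: the numbers `λ - 1 - log λ` are nonnegative,
vanish only at `λ = 1`, and here have sum at most zero. -/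
lemma eq_one_of_trace_le_of_one_le_det {N : Matrix (Fin r) (Fin r) ℝ} (hN : N.PosDef)
    (ht : N.trace ≤ r) (hd : 1 ≤ N.det) : N = 1 := by
  have hlam := hN.eigenvalues_pos
  have ht' := hN.1.trace_eq_sum_eigenvalues
  have hd' := hN.1.det_eq_prod_eigenvalues
  set lam := hN.1.eigenvalues
  simp only [RCLike.ofReal_real_eq_id, id] at ht' hd'
  have hlog : 0 ≤ ∑ i, Real.log (lam i) := by
    rw [← Real.log_prod fun i _ => (hlam i).ne', ← hd']
    exact Real.log_nonneg hd
  have h0 : ∀ i, 0 ≤ lam i - 1 - Real.log (lam i) := fun i => by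
    linarith [Real.log_le_sub_one_of_pos (hlam i)]
  have hsum : ∑ i, (lam i - 1 - Real.log (lam i)) ≤ 0 := by
    rw [Finset.sum_sub_distrib, Finset.sum_sub_distrib, ← ht']
    simp
    linarith
  have h1 : ∀ i, lam i = 1 := by
    intro i
    have h2 := (Finset.sum_eq_zero_iff_of_nonneg fun i _ => h0 i).1
      (le_antisymm hsum (Finset.sum_nonneg fun i _ => h0 i)) i (Finset.mem_univ i)
    by_contra hne
    linarith [Real.log_lt_sub_one_of_pos (hlam i) hne]
  have h3 := hN.1.spectral_theorem
  have h4 : hN.1.eigenvalues = fun _ => 1 := funext h1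
  rw [h4] at h3
  have h5 : (diagonal (RCLike.ofReal ∘ fun _ => 1) : Matrix (Fin r) (Fin r) ℝ) = 1 := by
    ext i j
    simp [diagonal_apply, one_apply]
  rw [h5, map_one] at h3
  exact h3

/-- Uniqueness of the minimum volume ellipsoid. -/
lemma IsMinVolEllipsoid.eq_of_det_le (h : IsMinVolEllipsoid X L) {M : Matrix (Fin r) (Fin r) ℝ}
    (hM : M.PosDef) (hX : ∀ i, X i ⬝ᵥ M *ᵥ X i ≤ 1) (hd : L.det ≤ M.det) : M = L := by
  have hL := h.1
  -- The test matrix `M - L` is nonpositive at the contact points of `L`, so `tr (L⁻¹ M) ≤ r`.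
  -- Together with `det (L⁻¹ M) ≥ 1` this is the equality case of AM–GM, applied below to the
  -- symmetric matrix `R⁻¹ᵀ M R⁻¹`.
  have htr : (L⁻¹ * (M - L)).trace ≤ 0 := by
    refine h.trace_inv_mul_nonpos ?_ fun i hi => ?_
    · rw [transpose_sub, posDef_isSymm hL, posDef_isSymm hM]
    · rw [sub_mulVec, dotProduct_sub, hi]
      linarith [hX i]
  have hu : IsUnit L.det := hL.det_pos.ne'.isUnit
  rw [mul_sub, nonsing_inv_mul L hu, trace_sub, trace_one, Fintype.card_fin] at htr
  obtain ⟨R, hR, hLR⟩ := exists_isUnit_factor hL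
  have hR' := (isUnit_iff_isUnit_det R).1 hR
  have hRt : IsUnit Rᵀ.det := by rwa [det_transpose]
  have h1 : R⁻¹ᵀ * Rᵀ = 1 := by rw [← transpose_mul, mul_nonsing_inv R hR', transpose_one]
  have h1' : Rᵀ * R⁻¹ᵀ = 1 := by rw [← transpose_mul, nonsing_inv_mul R hR', transpose_one]
  have h2 : L⁻¹ = R⁻¹ * R⁻¹ᵀ := by
    rw [hLR, Matrix.mul_inv_rev, transpose_nonsing_inv]
  have hN : (R⁻¹ᵀ * M * R⁻¹) = 1 := by
    refine eq_one_of_trace_le_of_one_le_det ?_ ?_ ?_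
    · have h3 := hM.conjTranspose_mul_mul_same (B := R⁻¹)
        (mulVec_injective_of_isUnit (isUnit_nonsing_inv_iff.2 hR))
      rwa [conjTranspose_eq_transpose_of_trivial] at h3
    · rw [trace_mul_comm, ← mul_assoc, ← h2]
      linarith
    · have h4 : M.det = R.det ^ 2 * (R⁻¹ᵀ * M * R⁻¹).det := by
        have h5 : R.det * R⁻¹.det = 1 := by rw [← det_mul, mul_nonsing_inv R hR', det_one]
        rw [det_mul, det_mul, det_transpose]
        linear_combination (-M.det) * (R.det * R⁻¹.det + 1) * h5
      have h6 : L.det = R.det ^ 2 := by rw [hLR, det_mul, det_transpose, sq]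
      have h7 := hL.det_pos
      rw [h4, h6] at hd
      rw [h6] at h7
      nlinarith
  calc M = (Rᵀ * R⁻¹ᵀ) * M * (R⁻¹ * R) := by rw [h1', nonsing_inv_mul R hR', one_mul, mul_one]
    _ = Rᵀ * (R⁻¹ᵀ * M * R⁻¹) * R := by simp only [mul_assoc]
    _ = L := by rw [hN, mul_one, hLR]

/-- Change of coordinates for minimum volume ellipsoids. -/
lemma IsMinVolEllipsoid.of_mul {F : Matrix (Fin r) (Fin r) ℝ} (hF : IsUnit F)
    (h : IsMinVolEllipsoid (X * F) L) : IsMinVolEllipsoid X (F * L * Fᵀ) := by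
  obtain ⟨hL, hX, hmax⟩ := h
  have hF' := (isUnit_iff_isUnit_det F).1 hF
  have hquad : ∀ (G M : Matrix (Fin r) (Fin r) ℝ) x,
      x ⬝ᵥ (G * M * Gᵀ) *ᵥ x = (x ᵥ* G) ⬝ᵥ M *ᵥ (x ᵥ* G) := by
    intro G M x
    rw [← mulVec_mulVec, ← mulVec_mulVec, dotProduct_mulVec, mulVec_transpose]
  have hpd : ∀ G M : Matrix (Fin r) (Fin r) ℝ, IsUnit G → M.PosDef → (G * M * Gᵀ).PosDef := by
    intro G M hG hM
    refine posDef_of_quad ?_ fun x hx => ?_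
    · rw [transpose_mul, transpose_mul, transpose_transpose, posDef_isSymm hM, mul_assoc]
    · rw [hquad]
      have h1 : x ᵥ* G ≠ 0 := by
        intro h0
        have : x = x ᵥ* G ᵥ* G⁻¹ := by
          rw [vecMul_vecMul, mul_nonsing_inv G ((isUnit_iff_isUnit_det G).1 hG), vecMul_one]
        rw [h0, zero_vecMul] at this
        exact hx this
      simpa using hM.dotProduct_mulVec_pos h1
  have hrow : ∀ i, (X * F) i = X i ᵥ* F := fun i => rfl
  refine ⟨hpd F L hF hL, fun i => ?_, fun M hM hMX => ?_⟩
  · rw [hquad, ← hrow]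
    exact hX i
  · have hFi : IsUnit F⁻¹ := isUnit_nonsing_inv_iff.2 hF
    have h1 := hmax (F⁻¹ * M * F⁻¹ᵀ) (hpd _ _ hFi hM) fun i => by
      rw [hquad, hrow, vecMul_vecMul, mul_nonsing_inv F hF', vecMul_one]
      exact hMX i
    have h5 : F.det * F⁻¹.det = 1 := by rw [← det_mul, mul_nonsing_inv F hF', det_one]
    rw [det_mul, det_mul, det_transpose] at h1
    rw [det_mul, det_mul, det_transpose]
    have h6 : M.det = F.det ^ 2 * (F⁻¹.det * M.det * F⁻¹.det) := by
      linear_combination (-M.det) * (F.det * F⁻¹.det + 1) * h5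
    rw [h6]
    nlinarith [sq_nonneg F.det]

/-- Existence of the minimum volume ellipsoid, if the feasible matrices are bounded. -/
lemma exists_isMinVolEllipsoid (X : Matrix (Fin n) (Fin r) ℝ) (c : ℝ)
    (hc : ∀ M : Matrix (Fin r) (Fin r) ℝ, M.PosSemidef → (∀ i, X i ⬝ᵥ M *ᵥ X i ≤ 1) →
      M.trace ≤ c) : ∃ L, IsMinVolEllipsoid X L := by
  -- Relaxing to semidefinite matrices makes the feasible set closed, and the trace bound makes it
  -- compact. A maximiser of the determinant is definite because a small multiple of the identity is
  -- feasible.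
  set S : Set (Matrix (Fin r) (Fin r) ℝ) :=
    {M | M.PosSemidef ∧ ∀ i, X i ⬝ᵥ M *ᵥ X i ≤ 1} with hS
  have hcont : ∀ x : Fin r → ℝ, Continuous fun M : Matrix (Fin r) (Fin r) ℝ => x ⬝ᵥ M *ᵥ x := by
    intro x
    exact continuous_const.dotProduct (continuous_id.matrix_mulVec continuous_const)
  have hclosed : IsClosed S := by
    have : S = {M | Mᵀ = M} ∩ ((⋂ x : Fin r → ℝ, {M | 0 ≤ x ⬝ᵥ M *ᵥ x}) ∩
        ⋂ i, {M | X i ⬝ᵥ M *ᵥ X i ≤ 1}) := by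
      ext M
      simp only [hS, Set.mem_ofPred_eq, Set.mem_inter_iff, Set.mem_iInter]
      constructor
      · rintro ⟨h1, h2⟩
        refine ⟨?_, fun x => ?_, h2⟩
        · have h := h1.1
          rwa [IsHermitian, conjTranspose_eq_transpose_of_trivial] at h
        · simpa using h1.dotProduct_mulVec_nonneg x
      · rintro ⟨h1, h2, h3⟩
        exact ⟨posSemidef_of_quad h1 h2, h3⟩
    rw [this]
    refine (isClosed_eq continuous_id.matrix_transpose continuous_id).inter
      ((isClosed_iInter fun x => isClosed_le continuous_const (hcont x)).inter
        (isClosed_iInter fun i => isClosed_le (hcont _) continuous_const))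
  have hcomp : IsCompact S := by
    have hbox : IsCompact (Set.univ.pi fun _ : Fin r => Set.univ.pi fun _ : Fin r =>
        Set.Icc (-c) c) := isCompact_univ_pi fun _ => isCompact_univ_pi fun _ => isCompact_Icc
    refine IsCompact.of_isClosed_subset hbox hclosed fun M hM => ?_
    intro k _ l _
    have htr := hc M hM.1 hM.2
    obtain ⟨R, hR⟩ := exists_factor hM.1
    have h1 : M k l = (R *ᵥ Pi.single k 1) ⬝ᵥ (R *ᵥ Pi.single l 1) := by
      rw [← dotProduct_factor hR]
      simp
    have h2 : ∀ k, vecNorm (R *ᵥ Pi.single k 1) ^ 2 ≤ c := by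
      intro k
      rw [trace_factor hR] at htr
      exact (Finset.single_le_sum (f := fun k => vecNorm (R *ᵥ Pi.single k 1) ^ 2)
        (fun i _ => sq_nonneg _) (Finset.mem_univ k)).trans htr
    have h3 := abs_dotProduct_le (R *ᵥ Pi.single k 1) (R *ᵥ Pi.single l 1)
    rw [← h1] at h3
    refine abs_le.1 (h3.trans ?_)
    nlinarith [h2 k, h2 l, sq_nonneg (vecNorm (R *ᵥ Pi.single k 1) -
      vecNorm (R *ᵥ Pi.single l 1))]
  set a : ℝ := (1 + ∑ i, vecNorm (X i) ^ 2)⁻¹ with ha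
  have hs : 0 ≤ ∑ i, vecNorm (X i) ^ 2 := Finset.sum_nonneg fun _ _ => sq_nonneg _
  have ha0 : 0 < a := by positivity
  have hquad1 : ∀ x : Fin r → ℝ,
      x ⬝ᵥ (a • (1 : Matrix (Fin r) (Fin r) ℝ)) *ᵥ x = a * vecNorm x ^ 2 := by
    intro x
    rw [smul_mulVec, one_mulVec, dotProduct_smul, smul_eq_mul, vecNorm_sq]
  have hpd1 : (a • (1 : Matrix (Fin r) (Fin r) ℝ)).PosDef := by
    refine posDef_of_quad (by simp) fun x hx => ?_
    rw [hquad1]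
    have := vecNorm_pos hx
    positivity
  have hmem : a • (1 : Matrix (Fin r) (Fin r) ℝ) ∈ S := by
    refine ⟨hpd1.posSemidef, fun i => ?_⟩
    rw [hquad1, ha, inv_mul_le_iff₀ (by positivity)]
    have := Finset.single_le_sum (f := fun i => vecNorm (X i) ^ 2)
        (fun i _ => sq_nonneg _) (Finset.mem_univ i)
    linarith
  obtain ⟨L, hLS, hLmax⟩ := hcomp.exists_isMaxOn ⟨_, hmem⟩
    (Continuous.matrix_det continuous_id).continuousOn
  refine ⟨L, ?_, hLS.2, fun M hM hMX => hLmax ⟨hM.posSemidef, hMX⟩⟩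
  rw [hLS.1.posDef_iff_det_ne_zero]
  exact (hpd1.det_pos.trans_le (hLmax hmem)).ne'

end Ellipsoid

/-! ### The ellipsoid of points near the unit vectors -/

section NearPure

variable {n K : ℕ}

lemma quad_vecMulVec (g x : Fin K → ℝ) : x ⬝ᵥ vecMulVec g g *ᵥ x = (g ⬝ᵥ x) ^ 2 := by
  rw [vecMulVec_mulVec, dotProduct_smul, dotProduct_comm x g, sq]
  simp

lemma trace_mul_vecMulVec_self (M : Matrix (Fin K) (Fin K) ℝ) (g : Fin K → ℝ) :
    (M * vecMulVec g g).trace = g ⬝ᵥ M *ᵥ g := by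
  rw [mul_vecMulVec, trace_vecMulVec, dotProduct_comm]

lemma quad_diagonal (d x : Fin K → ℝ) : x ⬝ᵥ diagonal d *ᵥ x = ∑ j, d j * x j ^ 2 := by
  simp only [dotProduct, mulVec_diagonal]
  exact Finset.sum_congr rfl fun j _ => by ring

lemma trace_mul_diagonal' (M : Matrix (Fin K) (Fin K) ℝ) (d : Fin K → ℝ) :
    (M * diagonal d).trace = ∑ j, d j * M j j := by
  simp only [Matrix.trace, diag_apply, mul_diagonal]
  exact Finset.sum_congr rfl fun j _ => mul_comm _ _

lemma quad_single (M : Matrix (Fin K) (Fin K) ℝ) (k : Fin K) :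
    Pi.single k 1 ⬝ᵥ M *ᵥ Pi.single k 1 = M k k := by
  simp

lemma one_le_sqrt_of_pos (k : Fin K) : 1 ≤ √(K : ℝ) := by
  rw [Real.one_le_sqrt]
  exact_mod_cast Nat.one_le_iff_ne_zero.2 (Fin.pos k).ne'

/-- An ellipsoid that contains small perturbations of all unit vectors is not too small. -/
lemma trace_le_of_near_pure {M : Matrix (Fin K) (Fin K) ℝ} (hM : M.PosSemidef) {η : ℝ}
    (hη0 : 0 ≤ η) (hη : √K * η ≤ 1 / 1000) {v : Fin K → Fin K → ℝ}
    (hv : ∀ k, vecNorm (v k - Pi.single k 1) ≤ η) (hMv : ∀ k, v k ⬝ᵥ M *ᵥ v k ≤ 1) :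
    M.trace ≤ 1.01 * K ∧ ∀ k, M k k ≤ 1.003 := by
  obtain ⟨R, hR⟩ := exists_factor hM
  set f := √M.trace with hf
  have htr0 : 0 ≤ M.trace := hM.trace_nonneg
  have hf0 : 0 ≤ f := Real.sqrt_nonneg _
  have hf2 : f ^ 2 = M.trace := Real.sq_sqrt htr0
  have hRf : OpLe R f := fun x => by
    refine abs_le_of_sq_le_sq' ?_ (mul_nonneg hf0 (vecNorm_nonneg _)) |>.2
    rw [vecNorm_factor_sq hR, mul_pow, hf2]
    exact quad_le_trace hM x
  have h1 : ∀ k, vecNorm (R *ᵥ Pi.single k 1) ≤ 1 + η * f := by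
    intro k
    have h2 : vecNorm (R *ᵥ v k) ≤ 1 := by
      refine abs_le_of_sq_le_sq' ?_ zero_le_one |>.2
      rw [vecNorm_factor_sq hR, one_pow]
      exact hMv k
    have h3 : R *ᵥ Pi.single k 1 = R *ᵥ v k - R *ᵥ (v k - Pi.single k 1) := by
      rw [← mulVec_sub, sub_sub_cancel]
    rw [h3]
    refine (vecNorm_sub_le _ _).trans (add_le_add h2 ((hRf _).trans ?_))
    rw [mul_comm]
    exact mul_le_mul_of_nonneg_right (hv k) hf0
  have hK0 : (0 : ℝ) ≤ √K := Real.sqrt_nonneg _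
  -- A self-bounding inequality: `f² = tr M` is the sum of the `‖R e_k‖²`, each controlled by `1 + η
  -- f`; as `√K * η` is small, the term in `f` is absorbed.
  have h4 : f ≤ √K * (1 + η * f) := by
    refine abs_le_of_sq_le_sq' ?_ (by positivity) |>.2
    rw [hf2, trace_factor hR, mul_pow, Real.sq_sqrt (by positivity)]
    calc ∑ k, vecNorm (R *ᵥ Pi.single k 1) ^ 2 ≤ ∑ _k : Fin K, (1 + η * f) ^ 2 :=
          Finset.sum_le_sum fun k _ => pow_le_pow_left₀ (vecNorm_nonneg _) (h1 k) 2
      _ = K * (1 + η * f) ^ 2 := by simp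
  have h5 : f ≤ 1.0011 * √K := by nlinarith
  have h6 : η * f ≤ 0.0011 := by
    calc η * f ≤ η * (1.0011 * √K) := mul_le_mul_of_nonneg_left h5 hη0
      _ = 1.0011 * (√K * η) := by ring
      _ ≤ 0.0011 := by linarith
  refine ⟨?_, fun k => ?_⟩
  · rw [← hf2]
    calc f ^ 2 ≤ (1.0011 * √K) ^ 2 := pow_le_pow_left₀ hf0 h5 2
      _ = 1.0011 ^ 2 * K := by rw [mul_pow, Real.sq_sqrt (by positivity)]
      _ ≤ 1.01 * K := mul_le_mul_of_nonneg_right (by norm_num) (by positivity)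
  · rw [← quad_single M k, ← vecNorm_factor_sq hR]
    have h7 : vecNorm (R *ᵥ Pi.single k 1) ≤ 1.0011 := (h1 k).trans (by linarith)
    calc vecNorm (R *ᵥ Pi.single k 1) ^ 2 ≤ 1.0011 ^ 2 :=
          pow_le_pow_left₀ (vecNorm_nonneg _) h7 2
      _ ≤ 1.003 := by norm_num

lemma vecNorm_near_single {z : Fin K → ℝ} {k : Fin K} {η : ℝ}
    (hz : vecNorm (z - Pi.single k 1) ≤ η) : 1 - η ≤ vecNorm z ∧ vecNorm z ≤ 1 + η := by
  have h1 : vecNorm (Pi.single k (1 : ℝ)) = 1 := by rw [vecNorm_single, abs_one]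
  constructor
  · have := vecNorm_sub_le z (z - Pi.single k 1)
    rw [sub_sub_cancel, h1] at this
    linarith
  · have := vecNorm_add_le (z - Pi.single k 1) (Pi.single k 1)
    rw [sub_add_cancel, h1] at this
    linarith

lemma near_single_apply_self {z : Fin K → ℝ} {k : Fin K} {η : ℝ}
    (hz : vecNorm (z - Pi.single k 1) ≤ η) : |z k - 1| ≤ η := by
  have := (abs_apply_le_vecNorm _ k).trans hz
  simpa using this

lemma near_single_apply_ne {z : Fin K → ℝ} {k j : Fin K} {η : ℝ}
    (hz : vecNorm (z - Pi.single k 1) ≤ η) (hj : j ≠ k) : |z j| ≤ η := by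
  have := (abs_apply_le_vecNorm _ j).trans hz
  simpa [hj] using this

lemma near_single_dotProduct {z v : Fin K → ℝ} {k : Fin K} {η : ℝ}
    (hz : vecNorm (z - Pi.single k 1) ≤ η) : |v ⬝ᵥ z - v k| ≤ η * vecNorm v := by
  have h1 : v ⬝ᵥ z - v k = (z - Pi.single k 1) ⬝ᵥ v := by
    rw [sub_dotProduct, dotProduct_comm z]
    simp
  rw [h1]
  exact (abs_dotProduct_le _ _).trans (mul_le_mul_of_nonneg_right hz (vecNorm_nonneg _))

variable {X : Matrix (Fin n) (Fin K) ℝ} {L : Matrix (Fin K) (Fin K) ℝ} {η : ℝ} {c : Fin n → Fin K}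

/-- The first order condition with `D = 1 - 1.003 L`: contact points have form value one and squared
norm at most `(1 + η)² ≤ 1.003`. -/
lemma trace_inv_le_of_near_pure (hL : IsMinVolEllipsoid X L)
    (hη : η ≤ 1 / 1000) (hX : ∀ i, vecNorm (X i - Pi.single (c i) 1) ≤ η) :
    L⁻¹.trace ≤ 1.003 * K := by
  have hu : IsUnit L.det := hL.1.det_pos.ne'.isUnit
  have h := hL.trace_inv_mul_nonpos (D := 1 - (1.003 : ℝ) • L)
    (by rw [transpose_sub, transpose_one, transpose_smul, posDef_isSymm hL.1]) fun i hi => by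
      rw [sub_mulVec, dotProduct_sub, one_mulVec, smul_mulVec, dotProduct_smul, hi, ← vecNorm_sq]
      have h1 := (vecNorm_near_single (hX i)).2
      have h2 := vecNorm_nonneg (X i)
      simp only [smul_eq_mul]
      nlinarith
  rw [mul_sub, mul_one, mul_smul_comm, nonsing_inv_mul L hu, trace_sub, trace_smul, trace_one,
    Fintype.card_fin, smul_eq_mul] at h
  linarith

lemma inv_apply_self_ge (hL : L.PosDef) (k : Fin K) (h : L k k ≤ 1.003) : 0.996 ≤ L⁻¹ k k := by
  have h1 := dotProduct_sq_le_quad_mul_quad_inv hL (Pi.single k 1) (Pi.single k 1)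
  rw [quad_single, quad_single] at h1
  simp only [dotProduct_single, Pi.single_eq_same, mul_one, one_pow] at h1
  have h2 := hL.diag_pos (i := k)
  nlinarith

/-- Rows near other vertices have a negligible `k`-th coordinate. If a contact point `x₀` lies near
`e_k`, take `g = L x₀`: then `gᵀ x` is almost one at every contact point near `e_k`, while `gᵀ L⁻¹ g
= 1`. So `e_k e_kᵀ - 1.01 g gᵀ - 2 η² I` is a valid test matrix; if there is no such contact point,
the term in `g` is dropped. -/
lemma inv_apply_self_le (hL : IsMinVolEllipsoid X L) (hη0 : 0 ≤ η) (hη1 : η ≤ 1 / 1000)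
    (hη : K * η ^ 2 ≤ 1 / 1000000)
    (hX : ∀ i, vecNorm (X i - Pi.single (c i) 1) ≤ η) (htr : L.trace ≤ 1.01 * K) (k : Fin K) :
    L⁻¹ k k ≤ 1.02 := by
  have hu : IsUnit L.det := hL.1.det_pos.ne'.isUnit
  have htr' := trace_inv_le_of_near_pure hL hη1 hX
  have hother : ∀ i, c i ≠ k → (X i k) ^ 2 ≤ 2 * η ^ 2 * (X i ⬝ᵥ X i) := by
    intro i hi
    have h1 := near_single_apply_ne (hX i) hi.symm
    have h2 := (vecNorm_near_single (hX i)).1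
    rw [← vecNorm_sq, ← sq_abs]
    have h3 : |X i k| ^ 2 ≤ η ^ 2 := pow_le_pow_left₀ (abs_nonneg _) h1 2
    have h4 : (1 / 2 : ℝ) ≤ vecNorm (X i) ^ 2 := by nlinarith
    nlinarith [sq_nonneg η]
  have hsmall : η ^ 2 * L⁻¹.trace ≤ 0.001 := by nlinarith [sq_nonneg η]
  by_cases hk : ∃ i, c i = k ∧ X i ⬝ᵥ L *ᵥ X i = 1
  · obtain ⟨i₀, hi₀, h0⟩ := hk
    set g := L *ᵥ X i₀ with hg
    have h := hL.trace_inv_mul_nonpos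
      (D := vecMulVec (Pi.single k 1) (Pi.single k 1) - (1.01 : ℝ) • vecMulVec g g
        - (2 * η ^ 2) • (1 : Matrix (Fin K) (Fin K) ℝ))
      (by simp only [transpose_sub, transpose_one, transpose_smul, transpose_vecMulVec])
      fun i hi => by
        rw [sub_mulVec, sub_mulVec, dotProduct_sub, dotProduct_sub, smul_mulVec, smul_mulVec,
          dotProduct_smul, dotProduct_smul, quad_vecMulVec, quad_vecMulVec, one_mulVec,
          single_one_dotProduct]
        simp only [smul_eq_mul]
        by_cases hik : c i = k
        · have h1 := near_single_apply_self (hX i)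
          rw [hik, abs_le] at h1
          have h2 : 0.99999 ≤ g ⬝ᵥ X i := by
            have h3 := quad_le_trace hL.1.posSemidef (X i - X i₀)
            have h4 : vecNorm (X i - X i₀) ≤ 2 * η := by
              have := vecNorm_sub_le (X i - Pi.single k 1) (X i₀ - Pi.single k 1)
              rw [sub_sub_sub_cancel_right] at this
              have h5 := hX i
              have h6 := hX i₀
              rw [hik] at h5
              rw [hi₀] at h6
              linarith
            -- Both points are contact points, so closeness in the `L`-norm means that `gᵀ x` is
            -- close to one.
            have h5 : (X i - X i₀) ⬝ᵥ L *ᵥ (X i - X i₀) = 2 - 2 * (g ⬝ᵥ X i) := by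
              have h6 : X i₀ ⬝ᵥ L *ᵥ X i = g ⬝ᵥ X i := by
                rw [dotProduct_mulVec, ← mulVec_transpose, posDef_isSymm hL.1]
              rw [mulVec_sub, dotProduct_sub, sub_dotProduct, sub_dotProduct, hi, h0, h6,
                dotProduct_comm (X i) (L *ᵥ X i₀)]
              ring
            have h7 : vecNorm (X i - X i₀) ^ 2 ≤ 4 * η ^ 2 := by
              have := pow_le_pow_left₀ (vecNorm_nonneg _) h4 2
              linarith
            have h8 : L.trace * vecNorm (X i - X i₀) ^ 2 ≤ (1.01 * K) * (4 * η ^ 2) :=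
              mul_le_mul htr h7 (sq_nonneg _) (by positivity)
            rw [h5] at h3
            nlinarith
          have h9 : 0 ≤ X i ⬝ᵥ X i := by rw [← vecNorm_sq]; exact sq_nonneg _
          have h10 : 0 ≤ 2 * η ^ 2 * (X i ⬝ᵥ X i) := by positivity
          nlinarith
        · nlinarith [hother i hik, sq_nonneg (g ⬝ᵥ X i)]
    have h1 : g ⬝ᵥ L⁻¹ *ᵥ g = 1 := by
      rw [hg, mulVec_mulVec, nonsing_inv_mul L hu, one_mulVec, dotProduct_comm, h0]
    rw [mul_sub, mul_sub, mul_smul_comm, mul_smul_comm, trace_sub, trace_sub, trace_smul,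
      trace_smul, trace_mul_vecMulVec_self, trace_mul_vecMulVec_self, quad_single, mul_one, h1]
      at h
    simp only [smul_eq_mul] at h
    linarith
  · have h := hL.trace_inv_mul_nonpos
      (D := vecMulVec (Pi.single k 1) (Pi.single k 1)
        - (2 * η ^ 2) • (1 : Matrix (Fin K) (Fin K) ℝ))
      (by simp only [transpose_sub, transpose_one, transpose_smul, transpose_vecMulVec])
      fun i hi => by
        rw [sub_mulVec, dotProduct_sub, smul_mulVec,
          dotProduct_smul, quad_vecMulVec, one_mulVec, single_one_dotProduct]
        simp only [smul_eq_mul]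
        have := hother i fun h' => hk ⟨i, h', hi⟩
        linarith
    rw [mul_sub, mul_smul_comm, trace_sub, trace_smul, trace_mul_vecMulVec_self, quad_single,
      mul_one] at h
    simp only [smul_eq_mul] at h
    linarith

/-- At a row near `e_c`, `(vᵀ x)²` is `v_c²` up to a small relative error and a multiple of `η²
‖v‖²`, hence dominated by a diagonal form. Testing with the difference controls the whole of `L⁻¹`
by its diagonal entries and a small trace term. -/
lemma quad_inv_le_of_near_pure (hL : IsMinVolEllipsoid X L) (hη0 : 0 ≤ η) (hη1 : η ≤ 1 / 1000)
    (hη : K * η ^ 2 ≤ 1 / 1000000)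
    (hX : ∀ i, vecNorm (X i - Pi.single (c i) 1) ≤ η) (hdiag : ∀ k, L⁻¹ k k ≤ 1.02)
    (v : Fin K → ℝ) : v ⬝ᵥ L⁻¹ *ᵥ v ≤ 1.1 * vecNorm v ^ 2 := by
  have htr' := trace_inv_le_of_near_pure hL hη1 hX
  set N := vecNorm v ^ 2 with hN
  have hN0 : 0 ≤ N := sq_nonneg _
  have h := hL.trace_inv_mul_nonpos
      (D := vecMulVec v v - diagonal fun j => 1.0522 * v j ^ 2 + 21.1 * η ^ 2 * N)
      (by simp only [transpose_sub, transpose_vecMulVec, diagonal_transpose])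
      fun i _ => by
        rw [sub_mulVec, dotProduct_sub, quad_vecMulVec, quad_diagonal]
        have h1 := near_single_dotProduct (v := v) (hX i)
        have h2 : (v ⬝ᵥ X i - v (c i)) ^ 2 ≤ η ^ 2 * N := by
          rw [← sq_abs, hN, ← mul_pow]
          exact pow_le_pow_left₀ (abs_nonneg _) h1 2
        -- Young's inequality `(a + b)² ≤ 1.05 a² + 21 b²`, from `(a - 20 b)² ≥ 0`; the constants in
        -- `D` leave room for the factor 0.998 below.
        have h3 : (v ⬝ᵥ X i) ^ 2 ≤ 1.05 * v (c i) ^ 2 + 21 * η ^ 2 * N := by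
          nlinarith [sq_nonneg (v (c i) - 20 * (v ⬝ᵥ X i - v (c i)))]
        have h4 := near_single_apply_self (hX i)
        have h5 : 0.998 ≤ X i (c i) ^ 2 := by
          rw [abs_le] at h4
          nlinarith
        have h6 := Finset.single_le_sum
          (f := fun j => (1.0522 * v j ^ 2 + 21.1 * η ^ 2 * N) * X i j ^ 2)
          (fun j _ => by positivity) (Finset.mem_univ (c i))
        have h7 : (1.0522 * v (c i) ^ 2 + 21.1 * η ^ 2 * N) * 0.998 ≤
            (1.0522 * v (c i) ^ 2 + 21.1 * η ^ 2 * N) * X i (c i) ^ 2 :=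
          mul_le_mul_of_nonneg_left h5 (by positivity)
        have h8 : 0 ≤ η ^ 2 * N := by positivity
        have h9 := sq_nonneg (v (c i))
        have h10 := h7.trans h6
        linarith
  rw [mul_sub, trace_sub, trace_mul_vecMulVec_self, trace_mul_diagonal'] at h
  have h1 : ∑ j, (1.0522 * v j ^ 2 + 21.1 * η ^ 2 * N) * L⁻¹ j j
      = 1.0522 * ∑ j, v j ^ 2 * L⁻¹ j j + 21.1 * N * (η ^ 2 * L⁻¹.trace) := by
    rw [Matrix.trace, Finset.mul_sum, Finset.mul_sum, Finset.mul_sum, ← Finset.sum_add_distrib]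
    exact Finset.sum_congr rfl fun j _ => by rw [diag_apply]; ring
  have h2 : ∑ j, v j ^ 2 * L⁻¹ j j ≤ 1.02 * N := by
    rw [hN, vecNorm_sq, dotProduct, Finset.mul_sum]
    refine Finset.sum_le_sum fun j _ => ?_
    rw [← sq, mul_comm]
    exact mul_le_mul_of_nonneg_right (hdiag j) (sq_nonneg _)
  have hsmall : η ^ 2 * L⁻¹.trace ≤ 0.0001 := by nlinarith [sq_nonneg η]
  have h3 : N * (η ^ 2 * L⁻¹.trace) ≤ N * 0.0001 := mul_le_mul_of_nonneg_left hsmall hN0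
  rw [h1] at h
  linarith

/-- The companion of the upper bound, with the sign of the test matrix reversed: now a diagonal form
lies below `(vᵀ x)²` at the rows. -/
lemma le_quad_inv_of_near_pure (hL : IsMinVolEllipsoid X L) (hη0 : 0 ≤ η) (hη1 : η ≤ 1 / 1000)
    (hη : K * η ^ 2 ≤ 1 / 1000000)
    (hX : ∀ i, vecNorm (X i - Pi.single (c i) 1) ≤ η) (hdiag : ∀ k, 0.996 ≤ L⁻¹ k k)
    (v : Fin K → ℝ) : 0.9 * vecNorm v ^ 2 ≤ v ⬝ᵥ L⁻¹ *ᵥ v := by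
  have htr' := trace_inv_le_of_near_pure hL hη1 hX
  set N := vecNorm v ^ 2 with hN
  have hN0 : 0 ≤ N := sq_nonneg _
  have hNsum : N = ∑ j, v j ^ 2 := by
    rw [hN, vecNorm_sq, dotProduct]
    exact Finset.sum_congr rfl fun j _ => (sq _).symm
  have h := hL.trace_inv_mul_nonpos
      (D := (diagonal fun j => 0.948 * v j ^ 2 - 41 * η ^ 2 * N) - vecMulVec v v)
      (by simp only [transpose_sub, transpose_vecMulVec, diagonal_transpose])
      fun i _ => by
        rw [sub_mulVec, dotProduct_sub, quad_vecMulVec, quad_diagonal]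
        have h1 := near_single_dotProduct (v := v) (hX i)
        have h2 : (v ⬝ᵥ X i - v (c i)) ^ 2 ≤ η ^ 2 * N := by
          rw [← sq_abs, hN, ← mul_pow]
          exact pow_le_pow_left₀ (abs_nonneg _) h1 2
        have h3 : 0.95 * v (c i) ^ 2 - 19 * η ^ 2 * N ≤ (v ⬝ᵥ X i) ^ 2 := by
          nlinarith [sq_nonneg (v (c i) + 20 * (v ⬝ᵥ X i - v (c i)))]
        have h4 := near_single_apply_self (hX i)
        have h5 : X i (c i) ^ 2 ≤ 1.0021 := by
          rw [abs_le] at h4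
          nlinarith
        have h6 : ∑ j, v j ^ 2 * X i j ^ 2 ≤ 1.0021 * v (c i) ^ 2 + η ^ 2 * N := by
          rw [hNsum, Finset.mul_sum, ← Finset.add_sum_erase _ _ (Finset.mem_univ (c i)),
            ← Finset.add_sum_erase _ (fun j => η ^ 2 * v j ^ 2) (Finset.mem_univ (c i))]
          have h7 : ∑ j ∈ Finset.univ.erase (c i), v j ^ 2 * X i j ^ 2 ≤
              ∑ j ∈ Finset.univ.erase (c i), η ^ 2 * v j ^ 2 := by
            refine Finset.sum_le_sum fun j hj => ?_
            have := near_single_apply_ne (hX i) (Finset.ne_of_mem_erase hj)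
            rw [mul_comm]
            refine mul_le_mul_of_nonneg_right ?_ (sq_nonneg _)
            rw [← sq_abs]
            exact pow_le_pow_left₀ (abs_nonneg _) this 2
          have h8 : 0 ≤ η ^ 2 * v (c i) ^ 2 := by positivity
          nlinarith [mul_le_mul_of_nonneg_left h5 (sq_nonneg (v (c i)))]
        have h7 : ∑ j, (0.948 * v j ^ 2 - 41 * η ^ 2 * N) * X i j ^ 2 =
            0.948 * ∑ j, v j ^ 2 * X i j ^ 2 - 41 * η ^ 2 * N * vecNorm (X i) ^ 2 := by
          have h10 : vecNorm (X i) ^ 2 = ∑ j, X i j ^ 2 := by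
            rw [vecNorm_sq, dotProduct]
            exact Finset.sum_congr rfl fun j _ => (sq _).symm
          rw [h10, Finset.mul_sum, Finset.mul_sum, ← Finset.sum_sub_distrib]
          exact Finset.sum_congr rfl fun j _ => by ring
        have h8 : 0.998 ≤ vecNorm (X i) ^ 2 := by
          have := (vecNorm_near_single (hX i)).1
          nlinarith
        have h9 : 0 ≤ η ^ 2 * N := by positivity
        have h10 : η ^ 2 * N * 0.998 ≤ η ^ 2 * N * vecNorm (X i) ^ 2 :=
          mul_le_mul_of_nonneg_left h8 h9
        have h11 := sq_nonneg (v (c i))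
        rw [h7]
        linarith
  rw [mul_sub, trace_sub, trace_mul_vecMulVec_self, trace_mul_diagonal'] at h
  have h1 : ∑ j, (0.948 * v j ^ 2 - 41 * η ^ 2 * N) * L⁻¹ j j
      = 0.948 * ∑ j, v j ^ 2 * L⁻¹ j j - 41 * N * (η ^ 2 * L⁻¹.trace) := by
    rw [Matrix.trace, Finset.mul_sum, Finset.mul_sum, Finset.mul_sum, ← Finset.sum_sub_distrib]
    exact Finset.sum_congr rfl fun j _ => by rw [diag_apply]; ring
  have h2 : 0.996 * N ≤ ∑ j, v j ^ 2 * L⁻¹ j j := by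
    rw [hNsum, Finset.mul_sum]
    refine Finset.sum_le_sum fun j _ => ?_
    rw [mul_comm (v j ^ 2)]
    exact mul_le_mul_of_nonneg_right (hdiag j) (sq_nonneg _)
  have hsmall : η ^ 2 * L⁻¹.trace ≤ 0.0001 := by nlinarith [sq_nonneg η]
  have h3 : N * (η ^ 2 * L⁻¹.trace) ≤ N * 0.0001 := mul_le_mul_of_nonneg_left hsmall hN0
  rw [h1] at h
  linarith

/-- The minimum volume ellipsoid of small perturbations of the unit vectors is close to the unit
ball. -/
lemma IsMinVolEllipsoid.quad_bounds_of_near_pure (hL : IsMinVolEllipsoid X L) (hη0 : 0 ≤ η)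
    (hη : √K * η ≤ 1 / 1000) (hX : ∀ i, vecNorm (X i - Pi.single (c i) 1) ≤ η)
    (hc : Function.Surjective c) (x : Fin K → ℝ) :
    10 / 11 * vecNorm x ^ 2 ≤ x ⬝ᵥ L *ᵥ x ∧ x ⬝ᵥ L *ᵥ x ≤ 10 / 9 * vecNorm x ^ 2 := by
  rcases Nat.eq_zero_or_pos K with rfl | hK
  · rw [Subsingleton.elim x 0, vecNorm_zero]
    simp
  have hs := one_le_sqrt_of_pos (⟨0, hK⟩ : Fin K)
  have hη1 : η ≤ 1 / 1000 := by nlinarith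
  have hη2 : K * η ^ 2 ≤ 1 / 1000000 := by
    have : (K : ℝ) * η ^ 2 = (√K * η) ^ 2 := by rw [mul_pow, Real.sq_sqrt (by positivity)]
    rw [this]
    have h0 : 0 ≤ √K * η := by positivity
    nlinarith
  choose s hs using hc
  obtain ⟨htr, hdiag⟩ := trace_le_of_near_pure hL.1.posSemidef hη0 hη (v := fun k => X (s k))
    (fun k => by have := hX (s k); rwa [hs] at this) fun k => hL.2.1 (s k)
  have h1 := quad_inv_le_of_near_pure hL hη0 hη1 hη2 hX
    (inv_apply_self_le hL hη0 hη1 hη2 hX htr)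
  have h2 := le_quad_inv_of_near_pure hL hη0 hη1 hη2 hX
    fun k => inv_apply_self_ge hL.1 k (hdiag k)
  -- Duality turns the bounds 1.1 and 0.9 for `L⁻¹` into `10 / 11` and `10 / 9` for `L`.
  have h3 := quad_inv_le_of_le_quad hL.1 h1 x
  have h4 := quad_le_of_le_quad_inv hL.1 (by norm_num) h2 x
  constructor <;> linarith

end NearPure

/-! ### Convexity on the standard simplex -/

section Simplex

variable {K : ℕ} {θ : Fin K → ℝ}

lemma apply_le_one_of_mem_stdSimplex (hθ : θ ∈ stdSimplex ℝ (Fin K)) (m : Fin K) : θ m ≤ 1 := by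
  rw [← hθ.2]
  exact Finset.single_le_sum (fun j _ => hθ.1 j) (Finset.mem_univ m)

/-- The right side is the ℓ¹ norm of `θ - e_m`. -/
lemma vecNorm_sub_single_le (hθ : θ ∈ stdSimplex ℝ (Fin K)) (m : Fin K) :
    vecNorm (θ - Pi.single m 1) ≤ 2 * (1 - θ m) := by
  set w : Fin K → ℝ := θ - Pi.single m 1 with hw
  have h1 : w = ∑ j, w j • Pi.single j (1 : ℝ) := by
    ext i
    simp [Finset.sum_apply, Pi.single_apply]
  rw [h1]
  refine (vecNorm_sum_le _ _).trans ?_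
  have h2 : ∀ j, vecNorm (w j • Pi.single j (1 : ℝ)) = |w j| := by
    intro j
    rw [vecNorm_smul, vecNorm_single, abs_one, mul_one]
  simp only [h2]
  rw [← Finset.add_sum_erase _ _ (Finset.mem_univ m)]
  have h3 : ∑ j ∈ Finset.univ.erase m, |w j|
      = ∑ j ∈ Finset.univ.erase m, θ j := by
    refine Finset.sum_congr rfl fun j hj => ?_
    rw [hw, Pi.sub_apply, Pi.single_eq_of_ne (Finset.ne_of_mem_erase hj), sub_zero,
      abs_of_nonneg (hθ.1 j)]
  have h4 := Finset.add_sum_erase Finset.univ θ (Finset.mem_univ m)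
  rw [hθ.2] at h4
  have h5 := apply_le_one_of_mem_stdSimplex hθ m
  rw [h3, hw, Pi.sub_apply, Pi.single_eq_same, abs_of_nonpos (by linarith)]
  linarith

lemma vecNorm_sq_le_of_apply_le (hθ : θ ∈ stdSimplex ℝ (Fin K)) {t : ℝ} (ht : ∀ k, θ k ≤ t) :
    vecNorm θ ^ 2 ≤ t := by
  rw [vecNorm_sq, dotProduct]
  calc ∑ j, θ j * θ j ≤ ∑ j, t * θ j :=
        Finset.sum_le_sum fun j _ => mul_le_mul_of_nonneg_right (ht j) (hθ.1 j)
    _ = t := by rw [← Finset.mul_sum, hθ.2, mul_one]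

lemma vecNorm_le_one_of_mem_stdSimplex (hθ : θ ∈ stdSimplex ℝ (Fin K)) : vecNorm θ ≤ 1 := by
  have := vecNorm_sq_le_of_apply_le hθ fun k => apply_le_one_of_mem_stdSimplex hθ k
  nlinarith [vecNorm_nonneg θ]

lemma one_le_vecNorm_single_sub {x : Fin K → ℝ} {m : Fin K} (hx : x m = 0) :
    1 ≤ vecNorm (Pi.single m 1 - x) := by
  have := abs_apply_le_vecNorm (Pi.single m 1 - x) m
  simpa [hx] using this

variable {E : Type*} [NormedAddCommGroup E] [InnerProductSpace ℝ E]

lemma norm_map_le_of_mem_stdSimplex (S : (Fin K → ℝ) →ₗ[ℝ] E) (hθ : θ ∈ stdSimplex ℝ (Fin K))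
    {μ : ℝ} (hμ : ∀ k, ‖S (Pi.single k 1)‖ ≤ μ) : ‖S θ‖ ≤ μ := by
  have h1 : θ = ∑ j, θ j • Pi.single j (1 : ℝ) := by
    ext i
    simp [Finset.sum_apply, Pi.single_apply]
  calc ‖S θ‖ = ‖∑ j, θ j • S (Pi.single j 1)‖ := by
        conv_lhs => rw [h1]
        simp only [map_sum, map_smul]
    _ ≤ ∑ j, ‖θ j • S (Pi.single j 1)‖ := norm_sum_le _ _
    _ ≤ ∑ j, θ j * μ := Finset.sum_le_sum fun j _ => by
        rw [norm_smul, Real.norm_eq_abs, abs_of_nonneg (hθ.1 j)]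
        exact mul_le_mul_of_nonneg_left (hμ j) (hθ.1 j)
    _ = μ := by rw [← Finset.sum_mul, hθ.2, one_mul]

/-- Splitting a point of the simplex at the vertex `m`. -/
lemma exists_split_of_mem_stdSimplex (hθ : θ ∈ stdSimplex ℝ (Fin K)) {m : Fin K} (hm : θ m < 1) :
    ∃ x ∈ stdSimplex ℝ (Fin K), x m = 0 ∧ θ = θ m • Pi.single m 1 + (1 - θ m) • x := by
  have h0 : 0 < 1 - θ m := by linarith
  refine ⟨(1 - θ m)⁻¹ • (θ - θ m • Pi.single m 1), ⟨fun j => ?_, ?_⟩, ?_, ?_⟩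
  · by_cases hj : j = m
    · subst hj; simp
    · have := hθ.1 j
      simp only [Pi.smul_apply, Pi.sub_apply, Pi.single_eq_of_ne hj, smul_eq_mul, mul_zero,
        sub_zero]
      positivity
  · have h1 : ∑ j, (θ - θ m • Pi.single m (1 : ℝ) : Fin K → ℝ) j = 1 - θ m := by
      simp only [Pi.sub_apply, Pi.smul_apply, Finset.sum_sub_distrib, hθ.2, smul_eq_mul,
        ← Finset.mul_sum]
      simp
    simp only [Pi.smul_apply (1 - θ m)⁻¹, smul_eq_mul, ← Finset.mul_sum]
    rw [h1, inv_mul_cancel₀ h0.ne']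
  · simp
  · rw [smul_smul, mul_inv_cancel₀ h0.ne', one_smul, add_sub_cancel]

/-- Strong convexity of the squared norm: split `θ` between `e_m` and the opposite face, and use `‖t
a + (1 - t) b‖² = t ‖a‖² + (1 - t) ‖b‖² - t (1 - t) ‖a - b‖²`. The deficit is what separates
vertices from other points, both for the ellipsoid and for successive projection. -/
lemma norm_map_sq_le_of_mem_stdSimplex (S : (Fin K → ℝ) →ₗ[ℝ] E)
    (hθ : θ ∈ stdSimplex ℝ (Fin K)) {μ : ℝ} (hμ : ∀ k, ‖S (Pi.single k 1)‖ ≤ μ) {m : Fin K}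
    {d : ℝ} (hd0 : 0 ≤ d)
    (hd : ∀ x ∈ stdSimplex ℝ (Fin K), x m = 0 → d ≤ ‖S (Pi.single m 1 - x)‖) :
    ‖S θ‖ ^ 2 ≤ μ ^ 2 - θ m * (1 - θ m) * d ^ 2 := by
  have hm1 := apply_le_one_of_mem_stdSimplex hθ m
  have hm0 := hθ.1 m
  rcases hm1.eq_or_lt with h | h
  · have := norm_map_le_of_mem_stdSimplex S hθ hμ
    rw [h]
    nlinarith [norm_nonneg (S θ)]
  · obtain ⟨x, hx, hxm, hsplit⟩ := exists_split_of_mem_stdSimplex hθ h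
    set t := θ m
    have h1 : S θ = t • S (Pi.single m 1) + (1 - t) • S x := by
      rw [hsplit, map_add, map_smul, map_smul]
    have h2 := hd x hx hxm
    rw [map_sub] at h2
    set a := S (Pi.single m 1)
    set b := S x
    have ha : ‖a‖ ≤ μ := hμ m
    have hb : ‖b‖ ≤ μ := norm_map_le_of_mem_stdSimplex S hx hμ
    have h3 : ‖S θ‖ ^ 2 = t * ‖a‖ ^ 2 + (1 - t) * ‖b‖ ^ 2 - t * (1 - t) * ‖a - b‖ ^ 2 := by
      rw [h1, norm_add_sq_real, norm_sub_sq_real, norm_smul, norm_smul, real_inner_smul_left,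
        real_inner_smul_right, mul_pow, mul_pow, Real.norm_eq_abs, Real.norm_eq_abs, sq_abs, sq_abs]
      ring
    have h4 : ‖a‖ ^ 2 ≤ μ ^ 2 := pow_le_pow_left₀ (norm_nonneg _) ha 2
    have h5 : ‖b‖ ^ 2 ≤ μ ^ 2 := pow_le_pow_left₀ (norm_nonneg _) hb 2
    have h6 : d ^ 2 ≤ ‖a - b‖ ^ 2 := pow_le_pow_left₀ hd0 h2 2
    have h7 : 0 ≤ 1 - t := by linarith
    have h8 : 0 ≤ t * (1 - t) := mul_nonneg hm0 h7
    rw [h3]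
    nlinarith [mul_le_mul_of_nonneg_left h4 hm0, mul_le_mul_of_nonneg_left h5 h7,
      mul_le_mul_of_nonneg_left h6 h8]

end Simplex

/-! ### The ellipsoid of a noisy simplex -/

section NoisySimplex

variable {n K : ℕ} {Θ Y : Matrix (Fin n) (Fin K) ℝ} {L : Matrix (Fin K) (Fin K) ℝ} {η : ℝ}

/-- The map `x ↦ M x` with values in Euclidean space. -/
def eucLin {m k : ℕ} (M : Matrix (Fin m) (Fin k) ℝ) :
    (Fin k → ℝ) →ₗ[ℝ] EuclideanSpace ℝ (Fin m) :=
  (WithLp.linearEquiv 2 ℝ (Fin m → ℝ)).symm.toLinearMap ∘ₗ M.mulVecLin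

lemma eucLin_apply {m k : ℕ} (M : Matrix (Fin m) (Fin k) ℝ) (x : Fin k → ℝ) :
    eucLin M x = WithLp.toLp 2 (M *ᵥ x) := rfl

lemma norm_eucLin {m k : ℕ} (M : Matrix (Fin m) (Fin k) ℝ) (x : Fin k → ℝ) :
    ‖eucLin M x‖ = vecNorm (M *ᵥ x) := by
  rw [eucLin_apply, vecNorm_eq_norm]

/-- An ellipsoid close to the unit ball that contains perturbations of the unit vectors contains
all perturbations of points of the simplex that are away from the unit vectors. -/
lemma quad_le_one_of_away_from_vertices (hL : L.PosDef) (hη0 : 0 ≤ η) (hη : η ≤ 1 / 1000)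
    (hlow : ∀ x, 10 / 11 * vecNorm x ^ 2 ≤ x ⬝ᵥ L *ᵥ x)
    (hup : ∀ x, x ⬝ᵥ L *ᵥ x ≤ 10 / 9 * vecNorm x ^ 2) {v : Fin K → Fin K → ℝ}
    (hv : ∀ k, vecNorm (v k - Pi.single k 1) ≤ η) (hv1 : ∀ k, v k ⬝ᵥ L *ᵥ v k ≤ 1)
    {θ y : Fin K → ℝ} (hθ : θ ∈ stdSimplex ℝ (Fin K)) (hθ1 : ∀ k, θ k < 1 - 10 * η)
    (hy : vecNorm (y - θ) ≤ η) : y ⬝ᵥ L *ᵥ y ≤ 1 := by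
  obtain ⟨R, hR⟩ := exists_factor hL.posSemidef
  have hRup : ∀ x, vecNorm (R *ᵥ x) ≤ 1.06 * vecNorm x := by
    intro x
    refine abs_le_of_sq_le_sq' ?_ (mul_nonneg (by norm_num) (vecNorm_nonneg _)) |>.2
    rw [vecNorm_factor_sq hR, mul_pow]
    have := hup x
    nlinarith [sq_nonneg (vecNorm x)]
  have hμ : ∀ k, ‖eucLin R (Pi.single k 1)‖ ≤ 1 + 1.06 * η := by
    intro k
    rw [norm_eucLin]
    have h2 : vecNorm (R *ᵥ v k) ≤ 1 := by
      refine abs_le_of_sq_le_sq' ?_ zero_le_one |>.2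
      rw [vecNorm_factor_sq hR, one_pow]
      exact hv1 k
    have h3 : R *ᵥ Pi.single k 1 = R *ᵥ v k - R *ᵥ (v k - Pi.single k 1) := by
      rw [← mulVec_sub, sub_sub_cancel]
    rw [h3]
    have := hRup (v k - Pi.single k 1)
    have := vecNorm_sub_le (R *ᵥ v k) (R *ᵥ (v k - Pi.single k 1))
    have := hv k
    linarith
  have hne : (Finset.univ : Finset (Fin K)).Nonempty := by
    by_contra h
    rw [Finset.not_nonempty_iff_eq_empty] at h
    have := hθ.2
    rw [h] at this
    simp at this
  obtain ⟨m, -, hm⟩ := Finset.exists_max_image Finset.univ θ hne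
  -- If all coordinates are below one half, `‖θ‖² ≤ 1 / 2` suffices. Otherwise the largest
  -- coordinate `t` has `t (1 - t) ≥ 5 η`, and the convexity deficit outweighs the noise in the
  -- vertices and in `y`; this fixes the threshold `10 η`.
  have hRθ : vecNorm (R *ᵥ θ) ≤ 1 - 1.06 * η := by
    refine abs_le_of_sq_le_sq' ?_ (by linarith) |>.2
    by_cases ht : θ m < 1 / 2
    · rw [vecNorm_factor_sq hR]
      have h1 := vecNorm_sq_le_of_apply_le hθ fun k => hm k (Finset.mem_univ k)
      have h2 := hup θ
      nlinarith
    · push Not at ht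
      have h1 := norm_map_sq_le_of_mem_stdSimplex (eucLin R) hθ hμ (m := m) (d := 0.95)
        (by norm_num) fun x _ hxm => by
          rw [norm_eucLin]
          refine abs_le_of_sq_le_sq' ?_ (vecNorm_nonneg _) |>.2
          rw [vecNorm_factor_sq hR]
          have h3 := one_le_vecNorm_single_sub hxm
          have h4 := hlow (Pi.single m 1 - x)
          nlinarith
      rw [norm_eucLin] at h1
      have h2 := hθ1 m
      have h3 : 1 / 2 * (10 * η) ≤ θ m * (1 - θ m) :=
        mul_le_mul ht (by linarith) (by positivity) (by linarith)
      nlinarith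
  have hfin : vecNorm (R *ᵥ y) ≤ 1 := by
    have h1 : R *ᵥ y = R *ᵥ θ + R *ᵥ (y - θ) := by
      rw [← mulVec_add, add_sub_cancel]
    rw [h1]
    have := vecNorm_add_le (R *ᵥ θ) (R *ᵥ (y - θ))
    have := hRup (y - θ)
    linarith
  rw [← vecNorm_factor_sq hR]
  exact pow_le_one₀ (vecNorm_nonneg _) hfin

/-- The minimum volume ellipsoid of small perturbations of points of the simplex that include the
unit vectors is close to the unit ball. -/
lemma IsMinVolEllipsoid.quad_bounds (hL : IsMinVolEllipsoid Y L) (hη0 : 0 ≤ η)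
    (hη : √K * η ≤ 1 / 21000) (hΘ : ∀ i, Θ i ∈ stdSimplex ℝ (Fin K))
    (hpure : ∀ k, ∃ i, Θ i = Pi.single k 1) (hY : ∀ i, vecNorm (Y i - Θ i) ≤ η)
    (x : Fin K → ℝ) :
    10 / 11 * vecNorm x ^ 2 ≤ x ⬝ᵥ L *ᵥ x ∧ x ⬝ᵥ L *ᵥ x ≤ 10 / 9 * vecNorm x ^ 2 := by
  classical
  rcases Nat.eq_zero_or_pos K with rfl | hK
  · rw [Subsingleton.elim x 0, vecNorm_zero]
    simp
  have hs := one_le_sqrt_of_pos (⟨0, hK⟩ : Fin K)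
  have hη1 : η ≤ 1 / 21000 := by nlinarith
  choose p hp using hpure
  set k₀ : Fin K := ⟨0, hK⟩
  -- In `X`, rows not near a vertex are replaced by the row of one pure node, so that every row of
  -- `X` is within `21 η = 2 * 10 η + η` of a unit vector.
  set c : Fin n → Fin K := fun i => if h : ∃ m, 1 - 10 * η ≤ Θ i m then h.choose else k₀ with hc
  set X : Matrix (Fin n) (Fin K) ℝ :=
    fun i => if ∃ m, 1 - 10 * η ≤ Θ i m then Y i else Y (p k₀) with hX
  have hYp : ∀ k, vecNorm (Y (p k) - Pi.single k 1) ≤ η := fun k => by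
    rw [← hp k]; exact hY _
  have hXc : ∀ i, vecNorm (X i - Pi.single (c i) 1) ≤ 21 * η := by
    intro i
    by_cases h : ∃ m, 1 - 10 * η ≤ Θ i m
    · have h1 : X i = Y i := if_pos h
      have h2 : c i = h.choose := dif_pos h
      have h3 := h.choose_spec
      rw [← h2] at h3
      rw [h1]
      have h4 := vecNorm_add_le (Y i - Θ i) (Θ i - Pi.single (c i) 1)
      rw [sub_add_sub_cancel] at h4
      have h5 := vecNorm_sub_single_le (hΘ i) (c i)
      have h6 := hY i
      linarith
    · have h1 : X i = Y (p k₀) := if_neg h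
      have h2 : c i = k₀ := dif_neg h
      rw [h1, h2]
      linarith [hYp k₀]
  have hXp : ∀ k, X (p k) = Y (p k) := by
    intro k
    refine if_pos ⟨k, ?_⟩
    rw [hp, Pi.single_eq_same]
    linarith
  have hcp : ∀ k, c (p k) = k := by
    intro k
    have h : ∃ m, 1 - 10 * η ≤ Θ (p k) m := ⟨k, by rw [hp, Pi.single_eq_same]; linarith⟩
    have h2 : c (p k) = h.choose := dif_pos h
    have h3 := h.choose_spec
    rw [← h2, hp] at h3
    by_contra hne
    rw [Pi.single_eq_of_ne hne] at h3
    linarith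
  obtain ⟨L₀, hL₀⟩ := exists_isMinVolEllipsoid X (1.01 * K) fun M hM hMX =>
    (trace_le_of_near_pure hM hη0 (by linarith) hYp fun k => by
      rw [← hXp]; exact hMX _).1
  have hb := hL₀.quad_bounds_of_near_pure (η := 21 * η) (by linarith) (by linarith) hXc
    fun k => ⟨p k, hcp k⟩
  have hL₀Y : ∀ i, Y i ⬝ᵥ L₀ *ᵥ Y i ≤ 1 := by
    intro i
    by_cases h : ∃ m, 1 - 10 * η ≤ Θ i m
    · have h1 : X i = Y i := if_pos h
      rw [← h1]
      exact hL₀.2.1 i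
    · push Not at h
      exact quad_le_one_of_away_from_vertices hL₀.1 hη0 (by linarith) (fun x => (hb x).1)
        (fun x => (hb x).2) hYp (fun k => by rw [← hXp]; exact hL₀.2.1 _) (hΘ i) h (hY i)
  have hLX : ∀ i, X i ⬝ᵥ L *ᵥ X i ≤ 1 := by
    intro i
    by_cases h : ∃ m, 1 - 10 * η ≤ Θ i m
    · have h1 : X i = Y i := if_pos h
      rw [h1]
      exact hL.2.1 i
    · have h1 : X i = Y (p k₀) := if_neg h
      rw [h1]
      exact hL.2.1 _
  -- Each of `L` and `L₀` is feasible for the other problem, so by uniqueness they coincide.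
  rw [hL₀.eq_of_det_le hL.1 hLX (hL.2.2 L₀ hL₀.1 hL₀Y)]
  exact hb x

end NoisySimplex

/-! ### Robustness of successive projection -/

section SPA

variable {n K r : ℕ} {Θ Y : Matrix (Fin n) (Fin K) ℝ} {η : ℝ}
  {T : (Fin K → ℝ) →ₗ[ℝ] EuclideanSpace ℝ (Fin r)} {J : Fin K → Fin n}

lemma norm_map_le_sum {θ : Fin K → ℝ} (S : (Fin K → ℝ) →ₗ[ℝ] EuclideanSpace ℝ (Fin r))
    (hθ : θ ∈ stdSimplex ℝ (Fin K)) : ‖S θ‖ ≤ ∑ j, θ j * ‖S (Pi.single j 1)‖ := by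
  have h1 : θ = ∑ j, θ j • Pi.single j (1 : ℝ) := by
    ext i
    simp [Finset.sum_apply, Pi.single_apply]
  calc ‖S θ‖ = ‖∑ j, θ j • S (Pi.single j 1)‖ := by
        conv_lhs => rw [h1]
        simp only [map_sum, map_smul]
    _ ≤ ∑ j, ‖θ j • S (Pi.single j 1)‖ := norm_sum_le _ _
    _ = ∑ j, θ j * ‖S (Pi.single j 1)‖ := Finset.sum_congr rfl fun j _ => by
        rw [norm_smul, Real.norm_eq_abs, abs_of_nonneg (hθ.1 j)]

lemma exists_coeff_of_mem_span {V : Type*} [AddCommGroup V] [Module ℝ V] {x : Fin K → V}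
    {k : Fin K} {v : V} (hv : v ∈ Submodule.span ℝ {y | ∃ l < k, y = x l}) :
    ∃ a : Fin K → ℝ, (∀ l, ¬ l < k → a l = 0) ∧ v = ∑ l, a l • x l := by
  induction hv using Submodule.span_induction with
  | mem y hy =>
    obtain ⟨l, hl, rfl⟩ := hy
    refine ⟨Pi.single l 1, fun j hj => ?_, ?_⟩
    · rw [Pi.single_eq_of_ne]
      rintro rfl
      exact hj hl
    · rw [Finset.sum_eq_single l (by intro j _ hj; simp [hj]) (by simp)]
      simp
  | zero => exact ⟨0, fun _ _ => rfl, by simp⟩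
  | add y z _ _ hy hz =>
    obtain ⟨a, ha, rfl⟩ := hy
    obtain ⟨b, hb, rfl⟩ := hz
    refine ⟨a + b, fun l hl => by simp [ha l hl, hb l hl], ?_⟩
    simp only [Pi.add_apply, add_smul, Finset.sum_add_distrib]
  | smul t y _ hy =>
    obtain ⟨a, ha, rfl⟩ := hy
    refine ⟨t • a, fun l hl => by simp [ha l hl], ?_⟩
    simp only [Pi.smul_apply, smul_assoc, Finset.smul_sum]

/-- The residual of `v` after projecting out the points selected before step `k`. -/
lemma exists_residual_eq {x : Fin n → EuclideanSpace ℝ (Fin r)} (J : Fin K → Fin n) (k : Fin K)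
    (v : EuclideanSpace ℝ (Fin r)) :
    ∃ a : Fin K → ℝ, (∀ l, ¬ l < k → a l = 0) ∧
      (Submodule.span ℝ {y | ∃ l < k, y = x (J l)})ᗮ.starProjection v
        = v - ∑ l, a l • x (J l) := by
  obtain ⟨a, ha, h⟩ := exists_coeff_of_mem_span (x := fun l => x (J l))
    (Submodule.starProjection_apply_mem (Submodule.span ℝ {y | ∃ l < k, y = x (J l)}) v)
  refine ⟨a, ha, ?_⟩
  rw [← h, Submodule.starProjection_orthogonal_val]

lemma residual_selected_eq_zero {x : Fin n → EuclideanSpace ℝ (Fin r)} (J : Fin K → Fin n)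
    {k l : Fin K} (hl : l < k) :
    (Submodule.span ℝ {y | ∃ l < k, y = x (J l)})ᗮ.starProjection (x (J l)) = 0 := by
  rw [Submodule.starProjection_orthogonal_val, sub_eq_zero, eq_comm,
    Submodule.starProjection_eq_self_iff]
  exact Submodule.subset_span ⟨l, hl, rfl⟩

/-- Unused vertices are far from the span of points close to other vertices. -/
lemma le_vecNorm_sub_sum {y : Fin K → Fin K → ℝ} {s : Fin K → Fin K} {k : Fin K} {ε : ℝ}
    (hε0 : 0 ≤ ε) (hε : √K * ε ≤ 1 / 1000)
    (hs : ∀ l < k, vecNorm (y l - Pi.single (s l) 1) ≤ ε)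
    (hinj : Set.InjOn s {l | l < k}) {a : Fin K → ℝ} (ha : ∀ l, ¬ l < k → a l = 0)
    {m : Fin K} (hm : ∀ l < k, s l ≠ m) {x : Fin K → ℝ} (hx : x m = 0) (hx1 : vecNorm x ≤ 1) :
    0.997 ≤ vecNorm (Pi.single m 1 - x - ∑ l, a l • y l) := by
  set u : Fin K → ℝ := ∑ l, a l • Pi.single (s l) (1 : ℝ) with hu
  have hum : u m = 0 := by
    rw [hu, Finset.sum_apply]
    refine Finset.sum_eq_zero fun l _ => ?_
    by_cases hl : l < k
    · simp [(hm l hl).symm]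
    · simp [ha l hl]
  have hus : ∀ l < k, u (s l) = a l := by
    intro l hl
    rw [hu, Finset.sum_apply, Finset.sum_eq_single l]
    · simp
    · intro j _ hj
      by_cases hjk : j < k
      · have : s l ≠ s j := fun h => hj (hinj hl hjk h).symm
        simp [this]
      · simp [ha j hjk]
    · simp
  -- By injectivity of `s` on the steps before `k`, the coefficients `a` reappear as distinct
  -- coordinates of `u`.
  have hau : vecNorm a ≤ vecNorm u := by
    refine abs_le_of_sq_le_sq' ?_ (vecNorm_nonneg _) |>.2
    rw [vecNorm_sq, vecNorm_sq, dotProduct, dotProduct]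
    have h1 : ∑ l, a l * a l = ∑ l ∈ Finset.univ.filter (· < k), a l * a l := by
      rw [Finset.sum_filter]
      refine Finset.sum_congr rfl fun l _ => ?_
      by_cases hl : l < k
      · rw [if_pos hl]
      · rw [if_neg hl, ha l hl, mul_zero]
    have h2 : ∑ l ∈ Finset.univ.filter (· < k), a l * a l
        = ∑ j ∈ (Finset.univ.filter (· < k)).image s, u j * u j := by
      rw [Finset.sum_image]
      · refine Finset.sum_congr rfl fun l hl => ?_
        rw [hus l (Finset.mem_filter.1 hl).2]
      · intro i hi j hj
        simp only [Finset.coe_filter, Finset.mem_univ, true_and] at hi hj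
        exact fun h => hinj hi hj h
    rw [h1, h2]
    exact Finset.sum_le_sum_of_subset_of_nonneg (Finset.subset_univ _)
      fun j _ _ => mul_self_nonneg _
  set w : Fin K → ℝ := Pi.single m 1 - x - u with hw
  have hw1 : 1 ≤ vecNorm w := by
    have := abs_apply_le_vecNorm w m
    simpa [hw, hx, hum] using this
  -- `‖e_m - x‖ ≤ 2 ≤ 2 ‖w‖`. This makes the error of replacing vertices by selected points relative
  -- to `‖w‖`, hence the constant 0.997.
  have huw : vecNorm u ≤ 3 * vecNorm w := by
    have h1 : u = Pi.single m 1 - x - w := by rw [hw, sub_sub_cancel]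
    have h2 := vecNorm_sub_le (Pi.single m 1 - x) w
    have h3 := vecNorm_sub_le (Pi.single m 1) x
    rw [vecNorm_single, abs_one] at h3
    rw [← h1] at h2
    linarith
  have herr : vecNorm (∑ l, a l • (y l - Pi.single (s l) 1)) ≤ (√K * ε) * vecNorm a := by
    calc vecNorm (∑ l, a l • (y l - Pi.single (s l) 1))
        ≤ ∑ l, vecNorm (a l • (y l - Pi.single (s l) 1)) := vecNorm_sum_le _ _
      _ ≤ ∑ l, |a l| * ε := by
          refine Finset.sum_le_sum fun l _ => ?_
          rw [vecNorm_smul]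
          by_cases hl : l < k
          · exact mul_le_mul_of_nonneg_left (hs l hl) (abs_nonneg _)
          · simp [ha l hl]
      _ = ((fun l => |a l|) ⬝ᵥ fun _ => 1) * ε := by
          simp [dotProduct, Finset.sum_mul]
      _ ≤ (vecNorm (fun l => |a l|) * vecNorm fun _ : Fin K => (1 : ℝ)) * ε :=
          mul_le_mul_of_nonneg_right (dotProduct_le _ _) hε0
      _ = (√K * ε) * vecNorm a := by
          simp only [vecNorm, sq_abs, one_pow, Finset.sum_const, Finset.card_univ,
            Fintype.card_fin, nsmul_eq_mul, mul_one]
          ring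
  have hsplit : w = (Pi.single m 1 - x - ∑ l, a l • y l)
      + ∑ l, a l • (y l - Pi.single (s l) 1) := by
    simp only [smul_sub, Finset.sum_sub_distrib]
    rw [hw, hu]
    abel
  have h1 := vecNorm_add_le (Pi.single m 1 - x - ∑ l, a l • y l)
    (∑ l, a l • (y l - Pi.single (s l) 1))
  rw [← hsplit] at h1
  have h2 : (√K * ε) * vecNorm a ≤ 1 / 1000 * (3 * vecNorm w) :=
    mul_le_mul hε (hau.trans huw) (vecNorm_nonneg _) (by norm_num)
  linarith

/-- One step of the successive projection algorithm selects a point close to a new vertex. -/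
lemma IsSPAOutput.exists_near_vertex (hJ : IsSPAOutput (fun i => T (Y i)) J)
    (hlow : ∀ x, 0.9 * vecNorm x ≤ ‖T x‖) (hup : ∀ x, ‖T x‖ ≤ 1.06 * vecNorm x) (hη0 : 0 ≤ η)
    (hη : √K * η ≤ 1 / 24000) (hΘ : ∀ i, Θ i ∈ stdSimplex ℝ (Fin K))
    (hpure : ∀ k, ∃ i, Θ i = Pi.single k 1) (hY : ∀ i, vecNorm (Y i - Θ i) ≤ η)
    {k : Fin K} {s : Fin K → Fin K} (hs : ∀ l < k, vecNorm (Y (J l) - Pi.single (s l) 1) ≤ 24 * η)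
    (hinj : Set.InjOn s {l | l < k}) :
    ∃ m, vecNorm (Y (J k) - Pi.single m 1) ≤ 24 * η ∧ ∀ l < k, s l ≠ m := by
  have hK1 := one_le_sqrt_of_pos k
  have hη1 : η ≤ 1 / 24000 := by nlinarith
  set W := Submodule.span ℝ {y | ∃ l < k, y = T (Y (J l))} with hW
  set S : (Fin K → ℝ) →ₗ[ℝ] EuclideanSpace ℝ (Fin r) :=
    (Wᗮ.starProjection : EuclideanSpace ℝ (Fin r) →ₗ[ℝ] EuclideanSpace ℝ (Fin r)) ∘ₗ T with hS
  have hSapp : ∀ x, S x = Wᗮ.starProjection (T x) := fun _ => rfl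
  have hSup : ∀ x, ‖S x‖ ≤ 1.06 * vecNorm x := fun x =>
    (Submodule.norm_starProjection_apply_le _ _).trans (hup x)
  have hdist : ∀ m, (∀ l < k, s l ≠ m) → ∀ x : Fin K → ℝ, x m = 0 → vecNorm x ≤ 1 →
      0.89 ≤ ‖S (Pi.single m 1 - x)‖ := by
    intro m hm x hxm hx1
    obtain ⟨a, ha, h⟩ := exists_residual_eq (x := fun i => T (Y i)) J k (T (Pi.single m 1 - x))
    have h1 : S (Pi.single m 1 - x) = T (Pi.single m 1 - x - ∑ l, a l • Y (J l)) := by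
      rw [hSapp, h, map_sub T (Pi.single m 1 - x), map_sum]
      simp only [map_smul]
    have h2 := le_vecNorm_sub_sum (y := fun l => Y (J l)) (ε := 24 * η) (by positivity)
      (by linarith) hs hinj ha hm hxm hx1
    rw [h1]
    have h3 := hlow (Pi.single m 1 - x - ∑ l, a l • Y (J l))
    linarith
  have hused : ∀ l < k, ‖S (Pi.single (s l) 1)‖ ≤ 0.01 := by
    intro l hl
    have h1 : S (Y (J l)) = 0 := residual_selected_eq_zero (x := fun i => T (Y i)) J hl
    have h2 : S (Pi.single (s l) 1) = - S (Y (J l) - Pi.single (s l) 1) := by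
      rw [map_sub, h1, zero_sub, neg_neg]
    rw [h2, norm_neg]
    have := hSup (Y (J l) - Pi.single (s l) 1)
    have := hs l hl
    linarith
  -- Pigeonhole: fewer than `K` vertices have been used.
  obtain ⟨m₁, hm₁⟩ : ∃ m, ∀ l < k, s l ≠ m := by
    by_contra! hcon
    have h1 : (Finset.univ : Finset (Fin K)) ⊆ (Finset.Iio k).image s := by
      intro m _
      obtain ⟨l, hl, hlm⟩ := hcon m
      exact Finset.mem_image.2 ⟨l, Finset.mem_Iio.2 hl, hlm⟩
    have h2 := (Finset.card_le_card h1).trans Finset.card_image_le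
    rw [Finset.card_univ, Fintype.card_fin, Fin.card_Iio] at h2
    omega
  obtain ⟨m₀, hm₀, hmax⟩ := Finset.exists_max_image
    (Finset.univ.filter fun m => ∀ l < k, s l ≠ m) (fun m => ‖S (Pi.single m 1)‖)
    ⟨m₁, Finset.mem_filter.2 ⟨Finset.mem_univ _, hm₁⟩⟩
  have hm₀' := (Finset.mem_filter.1 hm₀).2
  set μ := ‖S (Pi.single m₀ 1)‖ with hμdef
  have hμ1 : 0.89 ≤ μ := by
    have := hdist m₀ hm₀' 0 rfl (by rw [vecNorm_zero]; exact zero_le_one)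
    rwa [sub_zero] at this
  have hμ2 : μ ≤ 1.06 := by
    have := hSup (Pi.single m₀ 1)
    rwa [vecNorm_single, abs_one, mul_one] at this
  have hμ : ∀ j, ‖S (Pi.single j 1)‖ ≤ μ := by
    intro j
    by_cases hj : ∀ l < k, s l ≠ j
    · exact hmax j (Finset.mem_filter.2 ⟨Finset.mem_univ _, hj⟩)
    · push Not at hj
      obtain ⟨l, hl, rfl⟩ := hj
      have := hused l hl
      linarith
  set θ := Θ (J k) with hθdef
  have hθ : θ ∈ stdSimplex ℝ (Fin K) := hΘ (J k)
  -- The noisy pure row at `m₀` competes with the selected row; the comparison costs `1.06 * η` on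
  -- either side.
  have hSθ : μ - 2.12 * η ≤ ‖S θ‖ := by
    obtain ⟨p, hp⟩ := hpure m₀
    have h1 : ‖S (Y p)‖ ≤ ‖S (Y (J k))‖ := hJ.2 k p
    have h2 : ∀ i, ‖S (Y i) - S (Θ i)‖ ≤ 1.06 * η := by
      intro i
      rw [← map_sub]
      have := hSup (Y i - Θ i)
      have := hY i
      linarith
    have h3 := norm_sub_norm_le (S (Θ p)) (S (Y p))
    rw [norm_sub_rev, hp] at h3
    have h4 := norm_sub_norm_le (S (Y (J k))) (S (Θ (J k)))
    have h5 := h2 p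
    rw [hp] at h5
    have h6 := h2 (J k)
    rw [← hμdef] at h3
    linarith
  obtain ⟨m, -, hm⟩ := Finset.exists_max_image Finset.univ θ ⟨k, Finset.mem_univ _⟩
  have hm1 := apply_le_one_of_mem_stdSimplex hθ m
  have ht : 1 / 2 ≤ θ m := by
    by_contra! hlt
    have h1 := vecNorm_sq_le_of_apply_le hθ fun j => hm j (Finset.mem_univ j)
    have h2 : ‖S θ‖ ^ 2 ≤ (1.06 * vecNorm θ) ^ 2 := pow_le_pow_left₀ (norm_nonneg _) (hSup θ) 2
    have h3 : 0.88 ≤ ‖S θ‖ := by linarith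
    nlinarith
  -- A used vertex has a tiny residual, so weight at least one half on it would make the selected
  -- residual too short.
  have hunused : ∀ l < k, s l ≠ m := by
    rintro l hl rfl
    have h1 := norm_map_le_sum S hθ
    rw [← Finset.add_sum_erase _ _ (Finset.mem_univ (s l))] at h1
    have h2 : ∑ j ∈ Finset.univ.erase (s l), θ j * ‖S (Pi.single j 1)‖
        ≤ ∑ j ∈ Finset.univ.erase (s l), θ j * μ :=
      Finset.sum_le_sum fun j _ => mul_le_mul_of_nonneg_left (hμ j) (hθ.1 j)
    rw [← Finset.sum_mul] at h2
    have h3 := Finset.add_sum_erase Finset.univ θ (Finset.mem_univ (s l))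
    rw [hθ.2] at h3
    have h4 : ∑ j ∈ Finset.univ.erase (s l), θ j = 1 - θ (s l) := by linarith
    rw [h4] at h2
    have h5 : θ (s l) * ‖S (Pi.single (s l) 1)‖ ≤ θ (s l) * 0.01 :=
      mul_le_mul_of_nonneg_left (hused l hl) (hθ.1 _)
    nlinarith
  refine ⟨m, ?_, hunused⟩
  -- Near-maximal length leaves room only for a deficit of order `η`, so `1 - θ m ≤ 11.4 * η`; then
  -- `2 * 11.4 + 1 ≤ 24`.
  have h1 := norm_map_sq_le_of_mem_stdSimplex S hθ hμ (m := m) (d := 0.89) (by norm_num)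
    fun x hx hxm => hdist m hunused x hxm (vecNorm_le_one_of_mem_stdSimplex hx)
  have h2 : (μ - 2.12 * η) ^ 2 ≤ ‖S θ‖ ^ 2 := pow_le_pow_left₀ (by linarith) hSθ 2
  have h3 : 1 / 2 * (1 - θ m) ≤ θ m * (1 - θ m) :=
    mul_le_mul_of_nonneg_right ht (by linarith)
  have h4 : η * μ ≤ η * 1.06 := mul_le_mul_of_nonneg_left hμ2 hη0
  have h5 : 1 - θ m ≤ 11.4 * η := by nlinarith
  have h6 := vecNorm_sub_single_le hθ m
  have h7 := vecNorm_add_le (Y (J k) - Θ (J k)) (Θ (J k) - Pi.single m 1)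
  rw [sub_add_sub_cancel] at h7
  have h8 := hY (J k)
  linarith

/-- Robustness of the successive projection algorithm on a well-conditioned simplex. -/
lemma IsSPAOutput.exists_perm (hJ : IsSPAOutput (fun i => T (Y i)) J)
    (hlow : ∀ x, 0.9 * vecNorm x ≤ ‖T x‖) (hup : ∀ x, ‖T x‖ ≤ 1.06 * vecNorm x) (hη0 : 0 ≤ η)
    (hη : √K * η ≤ 1 / 24000) (hΘ : ∀ i, Θ i ∈ stdSimplex ℝ (Fin K))
    (hpure : ∀ k, ∃ i, Θ i = Pi.single k 1) (hY : ∀ i, vecNorm (Y i - Θ i) ≤ η) :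
    ∃ σ : Equiv.Perm (Fin K), ∀ k, vecNorm (Y (J k) - Pi.single (σ k) 1) ≤ 24 * η := by
  have key : ∀ N ≤ K, ∃ s : Fin K → Fin K,
      (∀ l : Fin K, (l : ℕ) < N → vecNorm (Y (J l) - Pi.single (s l) 1) ≤ 24 * η) ∧
        Set.InjOn s {l | (l : ℕ) < N} := by
    intro N
    induction N with
    | zero => exact fun _ => ⟨id, fun l hl => absurd hl (Nat.not_lt_zero _), by simp⟩
    | succ N ih =>
      intro hN
      obtain ⟨s, hs, hinj⟩ := ih (by omega)
      set k : Fin K := ⟨N, hN⟩ with hk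
      obtain ⟨m, hm, hne⟩ := hJ.exists_near_vertex hlow hup hη0 hη hΘ hpure hY (k := k) (s := s)
        (fun l hl => hs l hl) hinj
      have hup1 : ∀ l : Fin K, (l : ℕ) < N → Function.update s k m l = s l := fun l hl =>
        Function.update_of_ne (by rintro rfl; exact lt_irrefl _ hl) _ _
      have hup2 : Function.update s k m k = m := Function.update_self _ _ _
      have hcase : ∀ l : Fin K, (l : ℕ) < N + 1 → (l : ℕ) < N ∨ l = k := by
        intro l hl
        rcases Nat.lt_succ_iff_lt_or_eq.1 hl with h | h
        · exact Or.inl h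
        · exact Or.inr (Fin.ext h)
      refine ⟨Function.update s k m, fun l hl => ?_, fun i hi j hj hij => ?_⟩
      · rcases hcase l hl with h | rfl
        · rw [hup1 l h]
          exact hs l h
        · rw [hup2]
          exact hm
      · rcases hcase i hi with h | h <;> rcases hcase j hj with h' | h'
        · rw [hup1 i h, hup1 j h'] at hij
          exact hinj h h' hij
        · rw [h', hup1 i h, hup2] at hij
          exact absurd hij (hne i h)
        · rw [h, hup1 j h', hup2] at hij
          exact absurd hij.symm (hne j h')
        · rw [h, h']
  obtain ⟨s, hs, hinj⟩ := key K le_rfl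
  have hinj' : Function.Injective s := fun i j h => hinj i.2 j.2 h
  exact ⟨Equiv.ofBijective s (Finite.injective_iff_bijective.1 hinj'), fun k => hs k k.2⟩

end SPA

/-! ### Lower bounds for the pivots without a noise condition -/

section Pivots

variable {n K : ℕ} {X : Matrix (Fin n) (Fin K) ℝ} {Q : Matrix (Fin K) (Fin K) ℝ}
  {J : Fin K → Fin n}

lemma norm_precond_le_one (hQ : Q.PosDef) (hL : IsMinVolEllipsoid X (Q * Q)) (i : Fin n) :
    ‖(WithLp.toLp 2 (Q *ᵥ X i) : EuclideanSpace ℝ (Fin K))‖ ≤ 1 := by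
  rw [← vecNorm_eq_norm]
  refine abs_le_of_sq_le_sq' ?_ zero_le_one |>.2
  rw [vecNorm_factor_sq (L := Q * Q) (by rw [posDef_isSymm hQ]), one_pow]
  exact hL.2.1 i

/-- The residuals selected by the preconditioned successive projection algorithm are not small. -/
lemma one_le_sqrt_mul_norm_residual (hQ : Q.PosDef) (hL : IsMinVolEllipsoid X (Q * Q))
    (hJ : IsSPAOutput (fun i => WithLp.toLp 2 (Q *ᵥ X i)) J) (k : Fin K) :
    1 ≤ √K * ‖(Submodule.span ℝ {y | ∃ l < k, y =
      (WithLp.toLp 2 (Q *ᵥ X (J l)) : EuclideanSpace ℝ (Fin K))})ᗮ.starProjection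
        (WithLp.toLp 2 (Q *ᵥ X (J k)))‖ := by
  set W := Submodule.span ℝ {y | ∃ l < k, y =
      (WithLp.toLp 2 (Q *ᵥ X (J l)) : EuclideanSpace ℝ (Fin K))} with hW
  set r := ‖Wᗮ.starProjection (WithLp.toLp 2 (Q *ᵥ X (J k)))‖ with hr
  have hfin : Module.finrank ℝ W < K := by
    have h1 : {y | ∃ l < k, y = (WithLp.toLp 2 (Q *ᵥ X (J l)) : EuclideanSpace ℝ (Fin K))}
        = ((Finset.Iio k).image fun l =>
          (WithLp.toLp 2 (Q *ᵥ X (J l)) : EuclideanSpace ℝ (Fin K)) : Finset _) := by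
      ext y
      simp [eq_comm]
    rw [hW, h1]
    refine (finrank_span_finset_le_card _).trans_lt (Finset.card_image_le.trans_lt ?_)
    rw [Fin.card_Iio]
    exact k.2
  have hne : Wᗮ ≠ ⊥ := by
    intro h
    rw [Submodule.orthogonal_eq_bot_iff] at h
    rw [h, finrank_top] at hfin
    simp at hfin
  obtain ⟨v, hv, hv0⟩ := Submodule.exists_mem_ne_zero_of_ne_bot hne
  set q : Fin K → ℝ := v.ofLp with hq
  have hvq : ‖v‖ ^ 2 = q ⬝ᵥ q := by rw [norm_eq_vecNorm, vecNorm_sq]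
  have hQu : IsUnit Q.det := hQ.det_pos.ne'.isUnit
  have hQt := posDef_isSymm hQ
  have hinner : ∀ x, (Q *ᵥ q) ⬝ᵥ x =
      inner ℝ v (Wᗮ.starProjection (WithLp.toLp 2 (Q *ᵥ x))) := by
    intro x
    rw [← Submodule.inner_starProjection_left_eq_right,
      (Submodule.starProjection_eq_self_iff (K := Wᗮ)).2 hv]
    rw [← hQt, mulVec_transpose, ← dotProduct_mulVec, hQt]
    simp [PiLp.inner_apply, dotProduct, mul_comm, hq]
  -- For `v` orthogonal to the earlier selections, all preconditioned points satisfy `|⟨v, Q x⟩| ≤ r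
  -- ‖v‖`. The test matrix says so at the contact points, and its trace condition reads `‖v‖² ≤ K r²
  -- ‖v‖²`.
  have h := hL.trace_inv_mul_nonpos
    (D := vecMulVec (Q *ᵥ q) (Q *ᵥ q) - (r ^ 2 * ‖v‖ ^ 2) • (Q * Q))
    (by rw [transpose_sub, transpose_vecMulVec, transpose_smul, transpose_mul, hQt])
    fun i hi => by
      rw [sub_mulVec, dotProduct_sub, quad_vecMulVec, smul_mulVec, dotProduct_smul, hi, hinner,
        smul_eq_mul, mul_one, ← mul_pow, ← sq_abs, sub_nonpos]
      refine pow_le_pow_left₀ (abs_nonneg _) ((abs_real_inner_le_norm _ _).trans ?_) 2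
      rw [mul_comm]
      exact mul_le_mul_of_nonneg_right (hJ.2 k i) (norm_nonneg _)
  have hinv : (Q * Q)⁻¹ * (Q * Q) = 1 := nonsing_inv_mul _ (by rw [det_mul]; exact hQu.mul hQu)
  have h2 : (Q *ᵥ q) ⬝ᵥ (Q * Q)⁻¹ *ᵥ (Q *ᵥ q) = ‖v‖ ^ 2 := by
    rw [Matrix.mul_inv_rev, ← mulVec_mulVec, mulVec_mulVec q, nonsing_inv_mul Q hQu, one_mulVec]
    nth_rw 1 [← hQt]
    rw [mulVec_transpose, ← dotProduct_mulVec, mulVec_mulVec, mul_nonsing_inv Q hQu, one_mulVec,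
      hvq]
  rw [mul_sub, mul_smul_comm, hinv, trace_sub, trace_smul, trace_one, Fintype.card_fin,
    trace_mul_vecMulVec_self, h2, smul_eq_mul] at h
  have hvpos : 0 < ‖v‖ ^ 2 := by
    have := norm_pos_iff.2 hv0
    positivity
  have h3 : 1 ≤ K * r ^ 2 := by
    by_contra! hlt
    nlinarith
  have h4 : (√K * r) ^ 2 = K * r ^ 2 := by rw [mul_pow, Real.sq_sqrt (by positivity)]
  rw [← h4] at h3
  exact (one_le_sq_iff₀ (by positivity)).1 h3

/-- The coefficients of a combination of the selected points are bounded. -/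
lemma abs_coeff_le (hQ : Q.PosDef) (hL : IsMinVolEllipsoid X (Q * Q))
    (hJ : IsSPAOutput (fun i => WithLp.toLp 2 (Q *ᵥ X i)) J) (a : Fin K → ℝ) (l : Fin K) :
    |a l| ≤ √K * (1 + √K) ^ K *
      ‖∑ j, a j • (WithLp.toLp 2 (Q *ᵥ X (J j)) : EuclideanSpace ℝ (Fin K))‖ := by
  set p : Fin n → EuclideanSpace ℝ (Fin K) := fun i => WithLp.toLp 2 (Q *ᵥ X i) with hp
  have hK0 : 0 ≤ √(K : ℝ) := Real.sqrt_nonneg _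
  -- Back substitution: projecting off the earlier points isolates the last coefficient, bounded by
  -- `√K` times the norm of the sum. Removing its term enlarges the norm by a factor of at most `1 +
  -- √K`.
  have key : ∀ N ≤ K, ∀ a : Fin K → ℝ, (∀ l : Fin K, ¬ (l : ℕ) < N → a l = 0) → ∀ l,
      |a l| ≤ √K * (1 + √K) ^ N * ‖∑ j, a j • p (J j)‖ := by
    intro N
    induction N with
    | zero =>
      intro _ a ha l
      rw [ha l (Nat.not_lt_zero _), abs_zero]
      positivity
    | succ N ih =>
      intro hN a ha l
      set k : Fin K := ⟨N, hN⟩ with hk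
      set s := ‖∑ j, a j • p (J j)‖ with hs
      have hak : |a k| ≤ √K * s := by
        have h1 := one_le_sqrt_mul_norm_residual hQ hL hJ k
        set W := Submodule.span ℝ {y | ∃ l < k, y =
          (WithLp.toLp 2 (Q *ᵥ X (J l)) : EuclideanSpace ℝ (Fin K))} with hW
        have h2 : Wᗮ.starProjection (∑ j, a j • p (J j))
            = a k • Wᗮ.starProjection (p (J k)) := by
          rw [map_sum, Finset.sum_eq_single k]
          · rw [map_smul]
          · intro j _ hjk
            rw [map_smul]
            by_cases hj : j < k
            · have : Wᗮ.starProjection (p (J j)) = 0 :=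
                residual_selected_eq_zero (x := p) J hj
              rw [this, smul_zero]
            · have : ¬ (j : ℕ) < N + 1 := by
                intro h
                have h3 : (j : ℕ) ≠ N := fun h' => hjk (Fin.ext h')
                exact hj (Fin.lt_def.2 (by simp only [hk]; omega))
              rw [ha j this, zero_smul]
          · simp
        have h3 := Submodule.norm_starProjection_apply_le Wᗮ (∑ j, a j • p (J j))
        rw [h2, norm_smul, Real.norm_eq_abs] at h3
        calc |a k| = |a k| * 1 := (mul_one _).symm
          _ ≤ |a k| * (√K * ‖Wᗮ.starProjection (p (J k))‖) :=
            mul_le_mul_of_nonneg_left h1 (abs_nonneg _)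
          _ = √K * (|a k| * ‖Wᗮ.starProjection (p (J k))‖) := by ring
          _ ≤ √K * s := mul_le_mul_of_nonneg_left h3 hK0
      have hs0 : 0 ≤ s := norm_nonneg _
      by_cases hl : l = k
      · subst hl
        refine hak.trans (mul_le_mul_of_nonneg_right ?_ hs0)
        exact le_mul_of_one_le_right hK0 (one_le_pow₀ (by linarith))
      · set b := Function.update a k 0 with hb
        have hbs : ∑ j, b j • p (J j) = ∑ j, a j • p (J j) - a k • p (J k) := by
          rw [eq_sub_iff_add_eq, ← Finset.add_sum_erase _ _ (Finset.mem_univ k),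
            ← Finset.add_sum_erase _ (fun j => a j • p (J j)) (Finset.mem_univ k)]
          have h1 : ∑ j ∈ Finset.univ.erase k, b j • p (J j)
              = ∑ j ∈ Finset.univ.erase k, a j • p (J j) :=
            Finset.sum_congr rfl fun j hj => by
              rw [hb, Function.update_of_ne (Finset.ne_of_mem_erase hj)]
          rw [h1, hb, Function.update_self, zero_smul, zero_add, add_comm]
        have hbn : ‖∑ j, b j • p (J j)‖ ≤ (1 + √K) * s := by
          rw [hbs]
          have h1 := norm_sub_le (∑ j, a j • p (J j)) (a k • p (J k))
          have h2 := norm_precond_le_one hQ hL (J k)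
          rw [norm_smul, Real.norm_eq_abs] at h1
          have h3 : |a k| * ‖p (J k)‖ ≤ |a k| * 1 :=
            mul_le_mul_of_nonneg_left h2 (abs_nonneg _)
          linarith
        have h1 := ih (by omega) b (fun j hj => by
          by_cases hjk : j = k
          · rw [hjk, hb, Function.update_self]
          · rw [hb, Function.update_of_ne hjk]
            refine ha j fun h => hj ?_
            have h3 : (j : ℕ) ≠ N := fun h' => hjk (Fin.ext h')
            omega) l
        rw [hb, Function.update_of_ne hl] at h1
        calc |a l| ≤ √K * (1 + √K) ^ N * ‖∑ j, b j • p (J j)‖ := h1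
          _ ≤ √K * (1 + √K) ^ N * ((1 + √K) * s) :=
            mul_le_mul_of_nonneg_left hbn (by positivity)
          _ = √K * (1 + √K) ^ (N + 1) * s := by ring
  exact key K le_rfl a (fun l hl => absurd l.2 hl) l

lemma toLp_mulVec_sum (Q : Matrix (Fin K) (Fin K) ℝ) (a : Fin K → ℝ) (x : Fin K → Fin K → ℝ) :
    (WithLp.toLp 2 (Q *ᵥ ∑ j, a j • x j) : EuclideanSpace ℝ (Fin K))
      = ∑ j, a j • WithLp.toLp 2 (Q *ᵥ x j) := by
  have : ∀ x, (WithLp.toLp 2 (Q *ᵥ x) : EuclideanSpace ℝ (Fin K)) = eucLin Q x := fun _ => rfl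
  simp only [this, map_sum, map_smul]

/-- The coefficient bound applied to a vanishing combination of the selected rows gives their linear
independence. -/
lemma isUnit_spocF (h : IsPrecondSPAOutput X J) : IsUnit (spocF X J) := by
  obtain ⟨Q, hQ, hL, hJ⟩ := h
  rw [← vecMul_injective_iff_isUnit]
  refine (injective_iff_map_eq_zero (Matrix.vecMulLinear (spocF X J))).2 fun a ha => ?_
  rw [vecMulLinear_apply] at ha
  have h1 : ∑ j, a j • X (J j) = 0 := by
    rw [← ha]
    ext i
    simp [vecMul, dotProduct, spocF]
  ext l
  have h2 := abs_coeff_le hQ hL hJ a l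
  rw [← toLp_mulVec_sum Q a fun j => X (J j), h1, mulVec_zero] at h2
  simpa using h2

lemma spocTheta_eq (h : IsUnit (spocF X J)) : spocTheta X J = X * (spocF X J)⁻¹ := by
  have h1 := (isUnit_iff_isUnit_det _).1 h
  have h2 : IsUnit (spocF X J)ᵀ.det := by rwa [det_transpose]
  rw [spocTheta, Matrix.mul_inv_rev, Matrix.mul_assoc, ← Matrix.mul_assoc (spocF X J)ᵀ,
    mul_nonsing_inv _ h2, Matrix.one_mul]

/-- The estimated membership vectors are bounded. -/
lemma abs_spocTheta_le (h : IsPrecondSPAOutput X J) (i : Fin n) (l : Fin K) :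
    |spocTheta X J i l| ≤ √K * (1 + √K) ^ K := by
  have hu := isUnit_spocF h
  obtain ⟨Q, hQ, hL, hJ⟩ := h
  have h1 : spocTheta X J * spocF X J = X := by
    rw [spocTheta_eq hu, Matrix.mul_assoc, nonsing_inv_mul _ ((isUnit_iff_isUnit_det _).1 hu),
      Matrix.mul_one]
  have h2 : ∑ j, spocTheta X J i j • X (J j) = X i := by
    ext k
    have := congrFun (congrFun h1 i) k
    rw [← this, Finset.sum_apply, Matrix.mul_apply]
    rfl
  have h3 := abs_coeff_le hQ hL hJ (spocTheta X J i) l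
  rw [← toLp_mulVec_sum Q (spocTheta X J i) fun j => X (J j), h2] at h3
  refine h3.trans (mul_le_of_le_one_right (by positivity) (norm_precond_le_one hQ hL i))

end Pivots

/-! ### A crude error bound depending on `K` -/

section Crude

lemma permMatrix_mul_transpose_self {K : ℕ} (σ : Equiv.Perm (Fin K)) :
    σ.permMatrix ℝ * (σ.permMatrix ℝ)ᵀ = 1 := by
  ext i j
  simp only [Matrix.mul_apply, transpose_apply, Equiv.Perm.permMatrix, PEquiv.toMatrix_apply,
    Equiv.toPEquiv_apply, Option.mem_some_iff, Matrix.one_apply, mul_ite, mul_one, mul_zero]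
  rw [Finset.sum_eq_single (σ j)]
  · simp
  · intro x _ hx
    simp [hx.symm]
  · simp

lemma permMatrix_transpose_mul_self {K : ℕ} (σ : Equiv.Perm (Fin K)) :
    (σ.permMatrix ℝ)ᵀ * σ.permMatrix ℝ = 1 :=
  mul_eq_one_comm.1 (permMatrix_mul_transpose_self σ)

variable {n K : ℕ} {Θ : Matrix (Fin n) (Fin K) ℝ} {X : Matrix (Fin n) (Fin K) ℝ}
  {J : Fin K → Fin n}

/-- As its rows sum to one, `Θ` maps the all-ones vector to the all-ones vector. -/
lemma sqrt_le_sqrt_mul_singVal (hΘ : ∀ i, Θ i ∈ stdSimplex ℝ (Fin K)) :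
    √n ≤ √K * singVal Θ 1 := by
  have h1 := opLe_singVal_one Θ fun _ => 1
  have h2 : Θ *ᵥ (fun _ => 1) = fun _ => 1 := by
    ext i
    rw [mulVec, dotProduct]
    simpa using (hΘ i).2
  rw [h2] at h1
  simp only [vecNorm, one_pow, Finset.sum_const, Finset.card_univ, Fintype.card_fin, nsmul_eq_mul,
    mul_one] at h1
  linarith

/-- The error is at most a multiple, depending on `K`, of the norm of the membership matrix. -/
lemma frobNorm_spocTheta_sub_le (hΘ : ∀ i, Θ i ∈ stdSimplex ℝ (Fin K))
    (h : IsPrecondSPAOutput X J) (σ : Equiv.Perm (Fin K)) :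
    frobNorm (spocTheta X J - Θ * (σ.permMatrix ℝ)ᵀ) ≤
      (K * (1 + √K) ^ K + 1) * (√K * singVal Θ 1) := by
  have h1 : frobNorm (spocTheta X J) ≤ √n * (K * (1 + √K) ^ K) := by
    refine frobNorm_le_of_rows (by positivity) fun i => ?_
    refine abs_le_of_sq_le_sq' ?_ (by positivity) |>.2
    have hsq : vecNorm (spocTheta X J i) ^ 2 = ∑ l, (spocTheta X J i l) ^ 2 := by
      rw [vecNorm_sq, dotProduct]
      exact Finset.sum_congr rfl fun j _ => (sq _).symm
    rw [hsq]
    calc ∑ l, (spocTheta X J i l) ^ 2 ≤ ∑ _l : Fin K, (√K * (1 + √K) ^ K) ^ 2 :=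
          Finset.sum_le_sum fun l _ => by
            rw [← sq_abs]
            exact pow_le_pow_left₀ (abs_nonneg _) (abs_spocTheta_le h i l) 2
      _ = (K * (1 + √K) ^ K) ^ 2 := by
          rw [Finset.sum_const, Finset.card_univ, Fintype.card_fin, nsmul_eq_mul, mul_pow,
            Real.sq_sqrt (by positivity)]
          ring
  have h2 : frobNorm (Θ * (σ.permMatrix ℝ)ᵀ) ≤ √n * 1 := by
    refine frobNorm_le_of_rows zero_le_one fun i => ?_
    have hop : OpLe (σ.permMatrix ℝ)ᵀᵀ 1 := by
      rw [transpose_transpose]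
      exact opLe_of_orthonormal (permMatrix_transpose_mul_self σ)
    refine (hop.vecNorm_row_mul Θ i).trans ?_
    rw [one_mul]
    exact vecNorm_le_one_of_mem_stdSimplex (hΘ i)
  have h3 := frobNorm_sub_le (spocTheta X J) (Θ * (σ.permMatrix ℝ)ᵀ)
  have h4 := sqrt_le_sqrt_mul_singVal hΘ
  have h5 : (0 : ℝ) ≤ K * (1 + √K) ^ K + 1 := by positivity
  nlinarith [mul_le_mul_of_nonneg_left h4 h5]

end Crude

/-! ### Perturbation of leading eigenvectors -/

section Eigen

variable {n K : ℕ}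

lemma opLe_diagonal {d : Fin K → ℝ} {a : ℝ} (ha : 0 ≤ a) (h : ∀ k, |d k| ≤ a) :
    OpLe (diagonal d) a := fun v => by
  refine abs_le_of_sq_le_sq' ?_ (mul_nonneg ha (vecNorm_nonneg _)) |>.2
  rw [mul_pow, vecNorm_sq, vecNorm_sq, dotProduct, dotProduct, Finset.mul_sum]
  refine Finset.sum_le_sum fun j _ => ?_
  rw [mulVec_diagonal]
  have h1 : d j ^ 2 ≤ a ^ 2 := by
    rw [← sq_abs]
    exact pow_le_pow_left₀ (abs_nonneg _) (h j) 2
  nlinarith [mul_le_mul_of_nonneg_right h1 (mul_self_nonneg (v j))]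

/-- The spectral norm of a symmetric matrix is bounded by its eigenvalues. -/
lemma opLe_of_eigenvalues {M : Matrix (Fin n) (Fin n) ℝ} (hM : Mᵀ = M) {a : ℝ} (ha : 0 ≤ a)
    (h : ∀ (v : Fin n → ℝ) (μ : ℝ), v ≠ 0 → M *ᵥ v = μ • v → |μ| ≤ a) : OpLe M a := by
  have hH : M.IsHermitian := by rwa [IsHermitian, conjTranspose_eq_transpose_of_trivial]
  have h1 := hH.spectral_theorem
  rw [Unitary.conjStarAlgAut_apply] at h1
  set W : Matrix (Fin n) (Fin n) ℝ := (hH.eigenvectorUnitary : Matrix (Fin n) (Fin n) ℝ) with hW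
  have h2 : star W = Wᵀ := conjTranspose_eq_transpose_of_trivial W
  have h3 : Wᵀ * W = 1 := by
    rw [← h2]
    exact Unitary.coe_star_mul_self hH.eigenvectorUnitary
  have h4 : ∀ j, |hH.eigenvalues j| ≤ a := by
    intro j
    refine h (hH.eigenvectorBasis j).ofLp (hH.eigenvalues j) ?_ ?_
    · intro h0
      have := hH.eigenvectorBasis.orthonormal.1 j
      rw [norm_eq_vecNorm, h0, vecNorm_zero] at this
      exact zero_ne_one this
    · exact hH.mulVec_eigenvectorBasis j
  have h5 : OpLe (diagonal (RCLike.ofReal ∘ hH.eigenvalues) : Matrix (Fin n) (Fin n) ℝ) a :=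
    opLe_diagonal ha h4
  have h6 := ((opLe_of_orthonormal h3).mul zero_le_one h5).mul (by linarith)
    ((opLe_of_orthonormal h3).transpose zero_le_one)
  rw [one_mul, mul_one] at h6
  rw [h1, h2]
  exact h6

variable {M : Matrix (Fin n) (Fin n) ℝ} {U : Matrix (Fin n) (Fin K) ℝ} {d : Fin K → ℝ}

lemma IsLeadingEigen.transpose_mul (h : IsLeadingEigen M U d) (hM : Mᵀ = M) :
    Uᵀ * M = diagonal d * Uᵀ := by
  have := congrArg transpose h.eigen
  rwa [Matrix.transpose_mul, Matrix.transpose_mul, hM, diagonal_transpose] at this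

/-- Deflation: `N = M - U diag(d) Uᵀ` agrees with `M` on the complement of the columns of `U`, and
its eigenvectors for nonzero eigenvalues lie in that complement, where `leading` applies. -/
lemma IsLeadingEigen.vecNorm_mulVec_le (h : IsLeadingEigen M U d) (hM : Mᵀ = M) (k : Fin K)
    {z : Fin n → ℝ} (hz : Uᵀ *ᵥ z = 0) : vecNorm (M *ᵥ z) ≤ |d k| * vecNorm z := by
  set N := M - U * (diagonal d * Uᵀ) with hN
  have hUN : Uᵀ * N = 0 := by
    rw [hN, Matrix.mul_sub, h.transpose_mul hM, ← Matrix.mul_assoc, h.orthonormal, Matrix.one_mul,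
      sub_self]
  have hNt : Nᵀ = N := by
    rw [hN, transpose_sub, hM, Matrix.transpose_mul, Matrix.transpose_mul, transpose_transpose,
      diagonal_transpose, Matrix.mul_assoc]
  have hNop : OpLe N |d k| := by
    refine opLe_of_eigenvalues hNt (abs_nonneg _) fun v μ hv hμ => ?_
    by_cases hμ0 : μ = 0
    · rw [hμ0, abs_zero]
      exact abs_nonneg _
    · have h1 : Uᵀ *ᵥ v = 0 := by
        have h2 : μ • (Uᵀ *ᵥ v) = 0 := by
          rw [← mulVec_smul, ← hμ, mulVec_mulVec, hUN, zero_mulVec]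
        exact (smul_eq_zero.1 h2).resolve_left hμ0
      refine h.leading v μ hv ?_ h1 k
      rw [← hμ, hN, sub_mulVec, ← mulVec_mulVec, ← mulVec_mulVec, h1, mulVec_zero, mulVec_zero,
        sub_zero]
  have h3 : M *ᵥ z = N *ᵥ z := by
    rw [hN, sub_mulVec, ← mulVec_mulVec, ← mulVec_mulVec, hz, mulVec_zero, mulVec_zero, sub_zero]
  rw [h3]
  exact hNop z

/-- Leading eigenvalues are bounded below by lower bounds for the matrix on a subspace of
dimension `K`. -/
lemma IsLeadingEigen.le_abs (h : IsLeadingEigen M U d) (hM : Mᵀ = M)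
    {V : Matrix (Fin n) (Fin K) ℝ} (hV : Vᵀ * V = 1) {μ : ℝ}
    (hμ : ∀ y, μ * vecNorm y ≤ vecNorm (M *ᵥ (V *ᵥ y))) (k : Fin K) : μ ≤ |d k| := by
  -- The Courant–Fischer dimension count: `K - 1` linear conditions on `K` unknowns. For this `y`,
  -- `V y` involves only the `k`-th leading eigenvector and the complement, where `M` stretches by
  -- at most `|d k|`.
  obtain ⟨y, hy, hy0⟩ : ∃ y : Fin K → ℝ, (∀ j, j ≠ k → ((Uᵀ * V) *ᵥ y) j = 0) ∧ y ≠ 0 := by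
    set f : (Fin K → ℝ) →ₗ[ℝ] ({j // j ≠ k} → ℝ) :=
      (LinearMap.funLeft ℝ ℝ (Subtype.val : {j // j ≠ k} → Fin K)) ∘ₗ (Uᵀ * V).mulVecLin with hf
    have hlt : Module.finrank ℝ ({j // j ≠ k} → ℝ) < Module.finrank ℝ (Fin K → ℝ) := by
      rw [Module.finrank_fintype_fun_eq_card, Module.finrank_fintype_fun_eq_card]
      exact Fintype.card_subtype_lt (x := k) (by simp)
    obtain ⟨y, hy, hy0⟩ := Submodule.exists_mem_ne_zero_of_ne_bot
      (LinearMap.ker_ne_bot_of_finrank_lt (f := f) hlt)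
    exact ⟨y, fun j hj => congrFun (LinearMap.mem_ker.1 hy) ⟨j, hj⟩, hy0⟩
  set x := V *ᵥ y with hx
  have hxn : vecNorm x = vecNorm y := vecNorm_mulVec_of_orthonormal hV y
  set a := (Uᵀ *ᵥ x) k with ha
  have hUx : Uᵀ *ᵥ x = Pi.single k a := by
    ext j
    by_cases hj : j = k
    · rw [hj, Pi.single_eq_same]
    · rw [Pi.single_eq_of_ne hj, hx, mulVec_mulVec]
      exact hy j hj
  set z := x - U *ᵥ (Pi.single k a) with hz
  have hUz : Uᵀ *ᵥ z = 0 := by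
    rw [hz, mulVec_sub, mulVec_mulVec _ Uᵀ U, h.orthonormal, one_mulVec, hUx, sub_self]
  have horth : ∀ (w : Fin n → ℝ) (c : Fin K → ℝ), Uᵀ *ᵥ w = 0 →
      vecNorm (U *ᵥ c + w) ^ 2 = vecNorm c ^ 2 + vecNorm w ^ 2 := by
    intro w c hw
    have h1 : w ⬝ᵥ U *ᵥ c = 0 := by
      rw [dotProduct_mulVec, ← mulVec_transpose, hw, zero_dotProduct]
    have h2 : vecNorm (U *ᵥ c) ^ 2 = vecNorm c ^ 2 := by
      rw [vecNorm_mulVec_of_orthonormal h.orthonormal]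
    rw [← h2, vecNorm_sq, vecNorm_sq, vecNorm_sq, add_dotProduct, dotProduct_add, dotProduct_add,
      dotProduct_comm (U *ᵥ c) w, h1]
    ring
  have hxz : x = U *ᵥ (Pi.single k a) + z := by rw [hz, add_sub_cancel]
  have hMx : M *ᵥ x = U *ᵥ (Pi.single k (d k * a)) + M *ᵥ z := by
    have h1 : diagonal d *ᵥ Pi.single k a = Pi.single k (d k * a) := by
      ext j
      rw [mulVec_diagonal]
      by_cases hj : j = k
      · rw [hj, Pi.single_eq_same, Pi.single_eq_same]
      · rw [Pi.single_eq_of_ne hj, Pi.single_eq_of_ne hj, mul_zero]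
    conv_lhs => rw [hxz]
    rw [mulVec_add, mulVec_mulVec, h.eigen, ← mulVec_mulVec, h1]
  have hUMz : Uᵀ *ᵥ (M *ᵥ z) = 0 := by
    rw [mulVec_mulVec, h.transpose_mul hM, ← mulVec_mulVec, hUz, mulVec_zero]
  have h1 := horth (M *ᵥ z) (Pi.single k (d k * a)) hUMz
  have h2 := horth z (Pi.single k a) hUz
  rw [← hMx, vecNorm_single, sq_abs, mul_pow] at h1
  rw [← hxz, vecNorm_single, sq_abs] at h2
  have h3 := pow_le_pow_left₀ (vecNorm_nonneg _) (h.vecNorm_mulVec_le hM k hUz) 2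
  rw [mul_pow, sq_abs] at h3
  have h4 : vecNorm (M *ᵥ x) ≤ |d k| * vecNorm x := by
    refine abs_le_of_sq_le_sq' ?_ (mul_nonneg (abs_nonneg _) (vecNorm_nonneg _)) |>.2
    rw [mul_pow, sq_abs, h1, h2]
    linarith
  have h5 := hμ y
  rw [← hx] at h5
  rw [hxn] at h4
  exact le_of_mul_le_mul_right (h5.trans h4) (vecNorm_pos hy0)

variable {P A : Matrix (Fin n) (Fin n) ℝ} {Uhat : Matrix (Fin n) (Fin K) ℝ} {dhat : Fin K → ℝ}
  {δ s : ℝ}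

lemma opLe_diagonal_inv {d : Fin K → ℝ} {a : ℝ} (ha : 0 < a) (h : ∀ k, a ≤ |d k|) :
    OpLe (diagonal fun k => (d k)⁻¹) a⁻¹ :=
  opLe_diagonal (by positivity) fun k => by
    rw [abs_inv]
    exact inv_anti₀ ha (h k)

/-- Rowwise and spectral perturbation bounds for the leading eigenvectors. -/
lemma exists_eigenvector_perturbation (hP : Pᵀ = P) (hU : IsLeadingEigen P U d)
    (hUh : IsLeadingEigen A Uhat dhat) (hδ0 : 0 ≤ δ) (hδ : OpLe (A - P) δ) (hs : 0 < s)
    (hd : ∀ k, s ≤ |d k|) (hdh : ∀ k, s / 2 ≤ |dhat k|) (hrange : (1 - U * Uᵀ) * P = 0) :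
    ∃ O : Matrix (Fin K) (Fin K) ℝ, IsUnit O ∧ OpLe O⁻¹ 2 ∧ OpLe (Uhat - U * O) (10 * (δ / s)) ∧
      ∀ i, vecNorm ((Uhat - U * O) i) ≤
        14 * (vecNorm (A i) * δ / s ^ 2) + vecNorm (((A - P) * U) i) / s := by
  have hUo := opLe_of_orthonormal hU.orthonormal
  have hUto := hUo.transpose zero_le_one
  have hUho := opLe_of_orthonormal hUh.orthonormal
  set Di : Matrix (Fin K) (Fin K) ℝ := diagonal fun k => (d k)⁻¹ with hDi
  set Dhi : Matrix (Fin K) (Fin K) ℝ := diagonal fun k => (dhat k)⁻¹ with hDhi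
  have hDio : OpLe Di s⁻¹ := opLe_diagonal_inv hs hd
  have hDhio : OpLe Dhi (s / 2)⁻¹ := opLe_diagonal_inv (by linarith) hdh
  have hdne : ∀ k, d k ≠ 0 := fun k h0 => by have := hd k; rw [h0, abs_zero] at this; linarith
  have hdhne : ∀ k, dhat k ≠ 0 := fun k h0 => by
    have := hdh k; rw [h0, abs_zero] at this; linarith
  have hDDi : diagonal d * Di = 1 := by
    rw [hDi, diagonal_mul_diagonal, ← diagonal_one]
    congr 1
    ext k
    exact mul_inv_cancel₀ (hdne k)
  have hDiD : Di * diagonal d = 1 := mul_eq_one_comm.1 hDDi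
  have hDDhi : diagonal dhat * Dhi = 1 := by
    rw [hDhi, diagonal_mul_diagonal, ← diagonal_one]
    congr 1
    ext k
    exact mul_inv_cancel₀ (hdhne k)
  set E₁ := Uhat * Dhi with hE₁
  set E₂ := U * Di with hE₂
  set M := Uᵀ * Uhat with hM
  have hAE : A * E₁ = Uhat := by
    rw [hE₁, ← Matrix.mul_assoc, hUh.eigen, Matrix.mul_assoc, hDDhi, Matrix.mul_one]
  have hPE : P * E₂ = U := by
    rw [hE₂, ← Matrix.mul_assoc, hU.eigen, Matrix.mul_assoc, hDDi, Matrix.mul_one]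
  have hE₁o : OpLe E₁ (1 * (s / 2)⁻¹) := hUho.mul zero_le_one hDhio
  -- `Uhat = A * E₁`, and the projection kills `P`, so only `A - P` contributes.
  have hres : (1 - U * Uᵀ) * Uhat = (1 - U * Uᵀ) * ((A - P) * E₁) := by
    rw [Matrix.sub_mul A, hAE, Matrix.mul_sub, ← Matrix.mul_assoc _ P, hrange, Matrix.zero_mul,
      sub_zero]
  have hreso : OpLe ((1 - U * Uᵀ) * Uhat) (2 * (δ / s)) := by
    rw [hres]
    refine ((opLe_one_sub_proj hU.orthonormal).mul zero_le_one (hδ.mul hδ0 hE₁o)).mono (le_of_eq ?_)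
    field_simp
  have hMo : OpLe M 1 := by
    have := hUto.mul zero_le_one hUho
    rwa [one_mul] at this
  have hδs : 0 ≤ δ / s := by positivity
  -- For `δ / s ≤ 1 / 4` the overlap `Uᵀ * Uhat` itself is invertible with a bounded inverse, so `O`
  -- need not be orthogonal. Otherwise `8 (δ / s) ≥ 2`, and the identity will do.
  obtain ⟨O, hOu, hOo, hOi, hMO⟩ : ∃ O : Matrix (Fin K) (Fin K) ℝ, IsUnit O ∧ OpLe O 1 ∧
      OpLe O⁻¹ 2 ∧ OpLe (M - O) (8 * (δ / s)) := by
    by_cases hsmall : 2 * (δ / s) ≤ 1 / 2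
    · have hlow : ∀ x, vecNorm x ≤ 2 * vecNorm (M *ᵥ x) := by
        intro x
        have h1 : Uhat *ᵥ x = U *ᵥ (M *ᵥ x) + ((1 - U * Uᵀ) * Uhat) *ᵥ x := by
          rw [mulVec_mulVec, ← add_mulVec, hM, Matrix.sub_mul, Matrix.one_mul, Matrix.mul_assoc,
            add_sub_cancel]
        have h2 := vecNorm_add_le (U *ᵥ (M *ᵥ x)) (((1 - U * Uᵀ) * Uhat) *ᵥ x)
        rw [← h1, vecNorm_mulVec_of_orthonormal hUh.orthonormal,
          vecNorm_mulVec_of_orthonormal hU.orthonormal] at h2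
        have h3 := hreso.mono hsmall x
        linarith
      have hMu : IsUnit M := by
        rw [← mulVec_injective_iff_isUnit]
        refine (injective_iff_map_eq_zero M.mulVecLin).2 fun x hx => ?_
        have h1 := hlow x
        rw [mulVecLin_apply] at hx
        rw [hx, vecNorm_zero, mul_zero] at h1
        exact vecNorm_eq_zero.1 (le_antisymm h1 (vecNorm_nonneg _))
      refine ⟨M, hMu, hMo, fun x => ?_, fun x => ?_⟩
      · have h1 := hlow (M⁻¹ *ᵥ x)
        rwa [mulVec_mulVec, mul_nonsing_inv M ((isUnit_iff_isUnit_det M).1 hMu), one_mulVec] at h1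
      · rw [sub_self, zero_mulVec, vecNorm_zero]
        have := vecNorm_nonneg x
        positivity
    · refine ⟨1, isUnit_one, opLe_one, ?_, (hMo.sub opLe_one).mono (by linarith)⟩
      rw [inv_one]
      exact opLe_one.mono one_le_two
  refine ⟨O, hOu, hOi, ?_, fun i => ?_⟩
  · have h1 : Uhat - U * O = (1 - U * Uᵀ) * Uhat + U * (M - O) := by
      rw [hM, Matrix.sub_mul, Matrix.one_mul, Matrix.mul_sub, Matrix.mul_assoc]
      abel
    rw [h1]
    refine (hreso.add (hUo.mul zero_le_one hMO)).mono (le_of_eq ?_)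
    ring
  -- With a factor `A` or `(A - P) * U` on the left, the `i`-th row of the error involves only the
  -- `i`-th row of that factor.
  · have h1 : Uhat - U * O = A * (E₁ - E₂ * O) + ((A - P) * U) * (Di * O) := by
      have h2 : ((A - P) * U) * (Di * O) = (A - P) * (E₂ * O) := by
        rw [hE₂]
        simp only [Matrix.mul_assoc]
      rw [h2, Matrix.mul_sub, Matrix.sub_mul, hAE, ← Matrix.mul_assoc P, hPE]
      abel
    have h2 : E₁ - E₂ * O = ((1 - U * Uᵀ) * Uhat) * Dhi + U * (Di * (Uᵀ * ((P - A) * E₁)))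
        + U * (Di * (M - O)) := by
      have h3 : Di * (Uᵀ * ((P - A) * E₁)) = Uᵀ * E₁ - Di * M := by
        rw [Matrix.sub_mul, hAE, Matrix.mul_sub, ← Matrix.mul_assoc Uᵀ P, hU.transpose_mul hP,
          Matrix.mul_sub, Matrix.mul_assoc (diagonal d), ← Matrix.mul_assoc Di, hDiD,
          Matrix.one_mul]
      rw [h3, Matrix.mul_assoc _ Uhat, ← hE₁, Matrix.sub_mul, Matrix.one_mul, Matrix.mul_sub,
        Matrix.mul_sub, Matrix.mul_sub, hE₂]
      simp only [Matrix.mul_assoc]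
      abel
    have hPAo : OpLe (P - A) δ := by
      have := hδ.neg
      rwa [neg_sub] at this
    -- The three terms of `h2` contribute `4 + 2 + 8 = 14`.
    have hEo : OpLe (E₁ - E₂ * O) (14 * (δ / s ^ 2)) := by
      rw [h2]
      refine (((hreso.mul (by positivity) hDhio).add (hUo.mul zero_le_one (hDio.mul (by positivity)
        (hUto.mul zero_le_one (hPAo.mul hδ0 hE₁o))))).add (hUo.mul zero_le_one
          (hDio.mul (by positivity) hMO))).mono (le_of_eq ?_)
      field_simp
      ring
    have h3 := (hEo.transpose (by positivity)).vecNorm_row_mul A i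
    have h4 := ((hDio.mul (by positivity) hOo).transpose (by positivity)).vecNorm_row_mul
      ((A - P) * U) i
    have h5 : (Uhat - U * O) i = (A * (E₁ - E₂ * O)) i + (((A - P) * U) * (Di * O)) i := by
      rw [h1]; rfl
    rw [h5]
    refine (vecNorm_add_le _ _).trans (add_le_add (h3.trans (le_of_eq ?_)) (h4.trans (le_of_eq ?_)))
    · ring
    · rw [mul_one, div_eq_inv_mul]

end Eigen

/-! ### Linear algebra of the membership model -/

section Model

variable {n K : ℕ} {Θ : Matrix (Fin n) (Fin K) ℝ} {B : Matrix (Fin K) (Fin K) ℝ}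
  {P A : Matrix (Fin n) (Fin n) ℝ} {U : Matrix (Fin n) (Fin K) ℝ} {F : Matrix (Fin K) (Fin K) ℝ}

lemma IsIdentifiableMMSB.mem_stdSimplex (h : IsIdentifiableMMSB Θ B) (i : Fin n) :
    Θ i ∈ stdSimplex ℝ (Fin K) :=
  ⟨fun k => (h.mem_Icc i k).1, h.row_sum i⟩

lemma IsIdentifiableMMSB.exists_eq_single (h : IsIdentifiableMMSB Θ B) (k : Fin K) :
    ∃ i, Θ i = Pi.single k 1 := by
  obtain ⟨i, hi⟩ := h.pure_node k
  refine ⟨i, ?_⟩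
  have h1 := vecNorm_sub_single_le (h.mem_stdSimplex i) k
  rw [hi, sub_self, mul_zero] at h1
  exact sub_eq_zero.1 (vecNorm_eq_zero.1 (le_antisymm h1 (vecNorm_nonneg _)))

lemma IsIdentifiableMMSB.le (h : IsIdentifiableMMSB Θ B) : K ≤ n := by
  choose p hp using h.exists_eq_single
  have hinj : Function.Injective p := by
    intro i j hij
    by_contra hne
    have h1 : Θ (p i) i = 1 := by rw [hp, Pi.single_eq_same]
    rw [hij, hp, Pi.single_eq_of_ne hne] at h1
    exact zero_ne_one h1
  simpa using Fintype.card_le_of_injective p hinj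

lemma isUnit_of_rank_eq (h : B.rank = K) : IsUnit B := by
  rw [← mulVec_surjective_iff_isUnit]
  have h1 : LinearMap.range B.mulVecLin = ⊤ := by
    apply Submodule.eq_top_of_finrank_eq
    rw [Module.finrank_fintype_fun_eq_card, Fintype.card_fin]
    exact h
  exact LinearMap.range_eq_top.1 h1

lemma transpose_mul_mul_factor (hU : Uᵀ * U = 1) (hUF : U = Θ * F) : Uᵀ * Θ * F = 1 := by
  rw [Matrix.mul_assoc, ← hUF, hU]

lemma isUnit_factor (hU : Uᵀ * U = 1) (hUF : U = Θ * F) : IsUnit F :=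
  IsUnit.of_mul_eq_one_right _ (transpose_mul_mul_factor hU hUF)

/-- This bounds the norm of `F⁻¹` by the largest singular value of `Θ`. -/
lemma inv_factor (hU : Uᵀ * U = 1) (hUF : U = Θ * F) : F⁻¹ = Uᵀ * Θ :=
  inv_eq_left_inv (transpose_mul_mul_factor hU hUF)

lemma mul_inv_factor (hU : Uᵀ * U = 1) (hUF : U = Θ * F) : U * F⁻¹ = Θ := by
  rw [hUF, Matrix.mul_assoc,
    mul_nonsing_inv F ((isUnit_iff_isUnit_det F).1 (isUnit_factor hU hUF)), Matrix.mul_one]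

lemma one_sub_proj_mul_eq_zero (hU : Uᵀ * U = 1) (hUF : U = Θ * F) (hP : P = Θ * B * Θᵀ) :
    (1 - U * Uᵀ) * P = 0 := by
  have h1 : U * (Uᵀ * Θ) = Θ := by rw [← inv_factor hU hUF, mul_inv_factor hU hUF]
  rw [hP, Matrix.mul_assoc Θ, ← Matrix.mul_assoc _ Θ, Matrix.sub_mul, Matrix.one_mul,
    Matrix.mul_assoc, h1, sub_self, Matrix.zero_mul]

lemma singVal_membership_pos (hK : 1 ≤ K) (hU : Uᵀ * U = 1) (hUF : U = Θ * F) :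
    0 < singVal Θ K := by
  refine singVal_pos_of_rank hK ?_
  have h1 := rank_mul_le_right Uᵀ Θ
  rw [← inv_factor hU hUF,
    rank_of_isUnit _ (isUnit_nonsing_inv_iff.2 (isUnit_factor hU hUF)), Fintype.card_fin] at h1
  exact h1

lemma singVal_mean_pos (hK : 1 ≤ K) (hU : Uᵀ * U = 1) (hUF : U = Θ * F) (hP : P = Θ * B * Θᵀ)
    (hB : B.rank = K) : 0 < singVal P K := by
  refine singVal_pos_of_rank hK ?_
  have hF := isUnit_nonsing_inv_iff.2 (isUnit_factor hU hUF)
  have h1 : Uᵀ * (P * U) = F⁻¹ * B * F⁻¹ᵀ := by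
    rw [inv_factor hU hUF, hP, Matrix.transpose_mul, transpose_transpose]
    simp only [Matrix.mul_assoc]
  have h2 : IsUnit (F⁻¹ * B * F⁻¹ᵀ) := (hF.mul (isUnit_of_rank_eq hB)).mul (by
    rw [isUnit_iff_isUnit_det, det_transpose]
    exact (isUnit_iff_isUnit_det _).1 hF)
  have h3 := (rank_mul_le_right Uᵀ (P * U)).trans (rank_mul_le_left P U)
  rwa [h1, rank_of_isUnit _ h2, Fintype.card_fin] at h3

/-- `Θ = U * F⁻¹` has the norm of `F⁻¹`. This translates a condition on `β` in terms of `λ_K(F)`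
into one on `λ_max(Θ) β`. -/
lemma singVal_factor_mul_le_one (hU : Uᵀ * U = 1) (hUF : U = Θ * F) :
    singVal F K * singVal Θ 1 ≤ 1 := by
  obtain ⟨V, hV, h⟩ := exists_singVal_subspace F le_rfl
  have hV' : V * Vᵀ = 1 := mul_eq_one_comm.1 hV
  have hlow : ∀ x, singVal F K * vecNorm x ≤ vecNorm (F *ᵥ x) := by
    intro x
    have h1 := h (Vᵀ *ᵥ x)
    rwa [mulVec_mulVec _ V Vᵀ, hV', one_mulVec, vecNorm_mulVec_of_orthonormal
      (by rwa [transpose_transpose])] at h1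
  rcases (singVal_nonneg F K).eq_or_lt with h0 | h0
  · rw [← h0, zero_mul]
    exact zero_le_one
  · have h1 : singVal Θ 1 ≤ (singVal F K)⁻¹ := by
      refine singVal_one_le (by positivity) fun x => ?_
      rw [← mul_inv_factor hU hUF, ← mulVec_mulVec, vecNorm_mulVec_of_orthonormal hU,
        le_inv_mul_iff₀ h0]
      have h2 := hlow (F⁻¹ *ᵥ x)
      rwa [mulVec_mulVec, mul_nonsing_inv F ((isUnit_iff_isUnit_det F).1 (isUnit_factor hU hUF)),
        one_mulVec] at h2
    calc singVal F K * singVal Θ 1 ≤ singVal F K * (singVal F K)⁻¹ :=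
          mul_le_mul_of_nonneg_left h1 h0.le
      _ = 1 := mul_inv_cancel₀ h0.ne'

lemma one_le_condNumber {m : ℕ} {M : Matrix (Fin m) (Fin n) ℝ} (hK : 1 ≤ K)
    (h : 0 < singVal M K) : 1 ≤ condNumber K M := by
  rw [condNumber, one_le_div h]
  exact singVal_anti M hK

lemma betaRow_nonneg (A P : Matrix (Fin n) (Fin n) ℝ) (U : Matrix (Fin n) (Fin K) ℝ) (i : Fin n) :
    0 ≤ betaRow A P U i := by
  have h1 := singVal_nonneg P K
  have h2 := singVal_nonneg P 1
  have h3 := specNorm_nonneg (A - P)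
  have h4 := vecNorm_nonneg (A i)
  have h5 := vecNorm_nonneg (((A - P) * U) i)
  unfold betaRow condNumber
  positivity

lemma betaRow_le_beta (A P : Matrix (Fin n) (Fin n) ℝ) (U : Matrix (Fin n) (Fin K) ℝ) (i : Fin n) :
    betaRow A P U i ≤ beta A P U :=
  le_ciSup (f := betaRow A P U) (Set.finite_range _).bddAbove i

lemma beta_nonneg (A P : Matrix (Fin n) (Fin n) ℝ) (U : Matrix (Fin n) (Fin K) ℝ) :
    0 ≤ beta A P U :=
  Real.iSup_nonneg fun i => betaRow_nonneg A P U i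

lemma le_betaRow (hK : 1 ≤ K) (hs : 0 < singVal P K) (i : Fin n) :
    14 * (vecNorm (A i) * specNorm (A - P) / singVal P K ^ 2)
      + vecNorm (((A - P) * U) i) / singVal P K ≤ betaRow A P U i := by
  have h1 := one_le_condNumber hK hs
  have h2 := one_le_sqrt_of_pos (⟨0, hK⟩ : Fin K)
  have h3 : (14 : ℝ) ≤ 23 * √K * condNumber K P := by nlinarith
  have h4 : 0 ≤ vecNorm (A i) * specNorm (A - P) / singVal P K ^ 2 := by
    have := vecNorm_nonneg (A i)
    have := specNorm_nonneg (A - P)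
    positivity
  unfold betaRow
  exact add_le_add (mul_le_mul_of_nonneg_right h3 h4) le_rfl

/-- The powers of `κ(Θ)` are not needed by the argument; being at least one, they are inserted here.
-/
lemma le_nodeBound {C : ℝ} (hC : 0 ≤ C) (hκ : 1 ≤ condNumber K Θ) :
    C * √K * singVal Θ 1 ^ 2 * beta A P U
      + C * √K * singVal Θ 1 * (specNorm (A - P) / singVal P K) ≤ nodeBound C Θ A P U := by
  have h1 := singVal_nonneg Θ 1
  have h2 := beta_nonneg A P U
  have h3 := specNorm_nonneg (A - P)
  have h4 := singVal_nonneg P K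
  have h5 : 1 ≤ condNumber K Θ ^ 3 := one_le_pow₀ hκ
  have h6 : 0 ≤ C * √K * singVal Θ 1 ^ 2 * beta A P U := by positivity
  have h7 : 0 ≤ C * √K * singVal Θ 1 * (specNorm (A - P) / singVal P K) := by positivity
  unfold nodeBound
  nlinarith [mul_le_mul_of_nonneg_left h5 h6, mul_le_mul_of_nonneg_left hκ h7]

lemma nodeBound_mono {C D : ℝ} (hCD : C ≤ D) :
    nodeBound C Θ A P U ≤ nodeBound D Θ A P U := by
  have h1 := singVal_nonneg Θ 1
  have h2 := beta_nonneg A P U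
  have h3 := specNorm_nonneg (A - P)
  have h4 := singVal_nonneg P K
  have h5 : 0 ≤ condNumber K Θ := div_nonneg h1 (singVal_nonneg Θ K)
  unfold nodeBound
  gcongr

end Model

/-! ### From the ellipsoid and the projections to the estimate -/

section Robust

variable {n K : ℕ} {Θ X : Matrix (Fin n) (Fin K) ℝ} {G : Matrix (Fin K) (Fin K) ℝ}
  {J : Fin K → Fin n} {η : ℝ}

/-- The preconditioned successive projection algorithm applied to `X = Y G`, where the rows of `Y`
are close to points of the simplex, selects rows close to the unit vectors. -/
lemma exists_perm_of_isPrecondSPAOutput {Y : Matrix (Fin n) (Fin K) ℝ} (hG : IsUnit G)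
    (hX : X = Y * G) (hJ : IsPrecondSPAOutput X J) (hη0 : 0 ≤ η) (hη : √K * η ≤ 1 / 24000)
    (hΘ : ∀ i, Θ i ∈ stdSimplex ℝ (Fin K)) (hpure : ∀ k, ∃ i, Θ i = Pi.single k 1)
    (hY : ∀ i, vecNorm (Y i - Θ i) ≤ η) :
    ∃ σ : Equiv.Perm (Fin K), ∀ k, vecNorm (Y (J k) - Pi.single (σ k) 1) ≤ 24 * η := by
  obtain ⟨Q, hQ, hL, hSPA⟩ := hJ
  rw [hX] at hL
  -- In the coordinates of `Y` the ellipsoid is `G * L * Gᵀ`, and the preconditioned points are the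
  -- images of the rows of `Y` under the near isometry `Q * Gᵀ`.
  have hb := (hL.of_mul hG).quad_bounds hη0 (by linarith) hΘ hpure hY
  have hfac : G * (Q * Q) * Gᵀ = (Q * Gᵀ)ᵀ * (Q * Gᵀ) := by
    rw [Matrix.transpose_mul, transpose_transpose, posDef_isSymm hQ]
    simp only [Matrix.mul_assoc]
  have hT : (fun i => WithLp.toLp 2 (Q *ᵥ X i)) = fun i => eucLin (Q * Gᵀ) (Y i) := by
    ext1 i
    have h1 : X i = Gᵀ *ᵥ Y i := by rw [hX, mulVec_transpose]; rfl
    rw [eucLin_apply, ← mulVec_mulVec, h1]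
  rw [hT] at hSPA
  refine hSPA.exists_perm (fun x => ?_) (fun x => ?_) hη0 hη hΘ hpure hY
  · rw [norm_eucLin]
    refine abs_le_of_sq_le_sq' ?_ (vecNorm_nonneg _) |>.2
    rw [vecNorm_factor_sq hfac, mul_pow]
    have := (hb x).1
    nlinarith [sq_nonneg (vecNorm x)]
  · rw [norm_eucLin]
    refine abs_le_of_sq_le_sq' ?_ (mul_nonneg (by norm_num) (vecNorm_nonneg _)) |>.2
    rw [vecNorm_factor_sq hfac, mul_pow]
    have := (hb x).2
    nlinarith [sq_nonneg (vecNorm x)]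

/-- The estimation error if all selected rows are close to the unit vectors. -/
lemma frobNorm_spocTheta_sub_le_of_near {Y : Matrix (Fin n) (Fin K) ℝ} (hG : IsUnit G)
    (hX : X = Y * G) (hu : IsUnit (spocF X J)) (hη0 : 0 ≤ η) (hη : √K * η ≤ 1 / 24000)
    {σ : Equiv.Perm (Fin K)} (hσ : ∀ k, vecNorm (Y (J k) - Pi.single (σ k) 1) ≤ 24 * η) :
    frobNorm (spocTheta X J - Θ * (σ.permMatrix ℝ)ᵀ) ≤
      2 * (frobNorm (Y - Θ) + singVal Θ 1 * (√K * (24 * η))) := by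
  have hGd := (isUnit_iff_isUnit_det G).1 hG
  set S := σ.permMatrix ℝ with hS
  set R := spocF Y J with hR
  have hXR : spocF X J = R * G := by rw [hX]; rfl
  have hRu : IsUnit R := by
    rw [hXR] at hu
    have := hu.mul (isUnit_nonsing_inv_iff.2 hG)
    rwa [Matrix.mul_assoc, mul_nonsing_inv G hGd, Matrix.mul_one] at this
  have hRd := (isUnit_iff_isUnit_det R).1 hRu
  set E := R - S with hE
  have hEf : frobNorm E ≤ √K * (24 * η) := by
    refine frobNorm_le_of_rows (by positivity) fun k => ?_
    have h1 : E k = Y (J k) - Pi.single (σ k) 1 := by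
      ext j
      simp [hE, hR, hS, spocF, Equiv.Perm.permMatrix, PEquiv.toMatrix_apply, Pi.single_apply,
        eq_comm]
    rw [h1]
    exact hσ k
  have hEo : OpLe E (1 / 2) := (opLe_frobNorm E).mono (by linarith)
  have hSt : Sᵀ * S = 1 := permMatrix_transpose_mul_self σ
  have hSo : OpLe Sᵀ 1 := (opLe_of_orthonormal hSt).transpose zero_le_one
  -- `R` differs from a permutation matrix by `E`, of norm at most one half.
  have hRo : OpLe R⁻¹ 2 := by
    intro x
    set y := R⁻¹ *ᵥ x with hy
    have h1 : R *ᵥ y = x := by rw [hy, mulVec_mulVec, mul_nonsing_inv R hRd, one_mulVec]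
    have h2 : S *ᵥ y = R *ᵥ y - E *ᵥ y := by rw [hE, sub_mulVec, sub_sub_cancel]
    have h3 := vecNorm_sub_le (R *ᵥ y) (E *ᵥ y)
    rw [← h2, vecNorm_mulVec_of_orthonormal hSt, h1] at h3
    have h4 := hEo y
    linarith
  have hθ : spocTheta X J - Θ * Sᵀ = ((Y - Θ) - (Θ * Sᵀ) * E) * R⁻¹ := by
    have h1 : spocTheta X J = Y * R⁻¹ := by
      rw [spocTheta_eq hu, hXR, hX, Matrix.mul_inv_rev, Matrix.mul_assoc Y, ← Matrix.mul_assoc G,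
        mul_nonsing_inv G hGd, Matrix.one_mul]
    have h2 : (Y - Θ) - (Θ * Sᵀ) * E = Y - (Θ * Sᵀ) * R := by
      rw [hE, Matrix.mul_sub, Matrix.mul_assoc Θ Sᵀ S, hSt, Matrix.mul_one]
      abel
    rw [h1, h2, Matrix.sub_mul, Matrix.mul_assoc _ R, mul_nonsing_inv R hRd, Matrix.mul_one]
  have hΘS : OpLe (Θ * Sᵀ) (singVal Θ 1) := by
    have := (opLe_singVal_one Θ).mul (singVal_nonneg _ _) hSo
    rwa [mul_one] at this
  rw [hθ]
  refine (frobNorm_mul_le_right zero_le_two (hRo.transpose zero_le_two) _).trans ?_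
  refine mul_le_mul_of_nonneg_left ((frobNorm_sub_le _ _).trans ?_) zero_le_two
  refine add_le_add le_rfl ((frobNorm_mul_le_left (singVal_nonneg _ _) hΘS E).trans ?_)
  exact mul_le_mul_of_nonneg_left hEf (singVal_nonneg _ _)

end Robust

/-! ### The two noise regimes -/

section Main

variable {n K : ℕ} {Θ : Matrix (Fin n) (Fin K) ℝ} {B : Matrix (Fin K) (Fin K) ℝ}
  {P A : Matrix (Fin n) (Fin n) ℝ} {U Uhat : Matrix (Fin n) (Fin K) ℝ} {d dhat : Fin K → ℝ}
  {F : Matrix (Fin K) (Fin K) ℝ} {J : Fin K → Fin n}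

/-- The error bound with an absolute constant for small noise. -/
lemma exists_perm_frobNorm_le (hK : 1 ≤ K) (hΘ : IsIdentifiableMMSB Θ B) (hP : P = Θ * B * Θᵀ)
    (hA : A.IsSymm) (hAP : specNorm (A - P) ≤ singVal P K / 2) (hU : IsLeadingEigen P U d)
    (hUF : U = Θ * F) (hUh : IsLeadingEigen A Uhat dhat) (hJ : IsPrecondSPAOutput Uhat J)
    (hsmall : √K * (2 * singVal Θ 1 * beta A P U) ≤ 1 / 24000) :
    ∃ σ : Equiv.Perm (Fin K),
      frobNorm (spocTheta Uhat J - Θ * (σ.permMatrix ℝ)ᵀ) ≤ nodeBound 96 Θ A P U := by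
  have hs := singVal_mean_pos hK hU.orthonormal hUF hP hΘ.B_rank
  have hPt : Pᵀ = P := by
    rw [hP, Matrix.transpose_mul, Matrix.transpose_mul, transpose_transpose, hΘ.B_symm.eq,
      Matrix.mul_assoc]
  set s := singVal P K with hsdef
  set δ := specNorm (A - P) with hδdef
  have hδ0 : 0 ≤ δ := specNorm_nonneg _
  obtain ⟨V, hV, hVP⟩ := exists_singVal_subspace P hΘ.le
  have hd := hU.le_abs hPt hV hVP
  -- Weyl's inequality: on the top singular subspace of `P`, `A` is bounded below by `s - δ ≥ s /
  -- 2`.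
  have hdh := hUh.le_abs (μ := s / 2) hA.eq hV fun y => by
    have h1 := opLe_specNorm (A - P) (V *ᵥ y)
    rw [vecNorm_mulVec_of_orthonormal hV] at h1
    have h2 : P *ᵥ (V *ᵥ y) = A *ᵥ (V *ᵥ y) - (A - P) *ᵥ (V *ᵥ y) := by
      rw [sub_mulVec, sub_sub_cancel]
    have h3 := vecNorm_sub_le (A *ᵥ (V *ᵥ y)) ((A - P) *ᵥ (V *ᵥ y))
    rw [← h2] at h3
    have h4 := hVP y
    nlinarith [vecNorm_nonneg y]
  obtain ⟨O, hO, hOi, hop, hrow⟩ := exists_eigenvector_perturbation hPt hU hUh hδ0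
    (opLe_specNorm (A - P)) hs hd hdh (one_sub_proj_mul_eq_zero hU.orthonormal hUF hP)
  have hF := isUnit_factor hU.orthonormal hUF
  set G := F * O with hG
  have hGu : IsUnit G := hF.mul hO
  have hGd := (isUnit_iff_isUnit_det G).1 hGu
  set Y := Uhat * G⁻¹ with hY
  set lm := singVal Θ 1 with hlm
  have hlm0 : 0 ≤ lm := singVal_nonneg _ _
  have hXY : Uhat = Y * G := by
    rw [hY, Matrix.mul_assoc, nonsing_inv_mul G hGd, Matrix.mul_one]
  have hGi : OpLe G⁻¹ (2 * lm) := by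
    rw [hG, Matrix.mul_inv_rev, inv_factor hU.orthonormal hUF]
    have h1 := hOi.mul zero_le_two (((opLe_of_orthonormal hU.orthonormal).transpose
      zero_le_one).mul zero_le_one (opLe_singVal_one Θ))
    rwa [one_mul] at h1
  have hGit := hGi.transpose (by positivity)
  have hYΘ : Y - Θ = (Uhat - U * O) * G⁻¹ := by
    have h1 : U * O * G⁻¹ = Θ := by
      rw [hUF, Matrix.mul_assoc Θ, ← hG, Matrix.mul_assoc, mul_nonsing_inv G hGd, Matrix.mul_one]
    rw [Matrix.sub_mul, h1]
  have hβ0 := beta_nonneg A P U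
  set η := 2 * lm * beta A P U with hη
  have hη0 : 0 ≤ η := by positivity
  have hYrow : ∀ i, vecNorm (Y i - Θ i) ≤ η := by
    intro i
    have h1 : Y i - Θ i = ((Uhat - U * O) * G⁻¹) i := by rw [← hYΘ]; rfl
    rw [h1]
    refine (hGit.vecNorm_row_mul _ i).trans (mul_le_mul_of_nonneg_left ?_ (by positivity))
    exact (hrow i).trans ((le_betaRow hK hs i).trans (betaRow_le_beta A P U i))
  have hYfrob : frobNorm (Y - Θ) ≤ 2 * lm * (√K * (10 * (δ / s))) := by
    rw [hYΘ]
    refine (frobNorm_mul_le_right (by positivity) hGit _).trans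
      (mul_le_mul_of_nonneg_left ?_ (by positivity))
    exact hop.frobNorm_le (by positivity)
  obtain ⟨σ, hσ⟩ := exists_perm_of_isPrecondSPAOutput hGu hXY hJ hη0 hsmall hΘ.mem_stdSimplex
    hΘ.exists_eq_single hYrow
  refine ⟨σ, ?_⟩
  have h1 := frobNorm_spocTheta_sub_le_of_near (Θ := Θ) hGu hXY (isUnit_spocF hJ) hη0 hsmall hσ
  have h2 := le_nodeBound (A := A) (P := P) (U := U) (C := 96) (by norm_num)
    (one_le_condNumber hK (singVal_membership_pos hK hU.orthonormal hUF))
  refine h1.trans (le_trans ?_ h2)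
  rw [← hlm, ← hδdef, ← hsdef]
  have h3 : 0 ≤ √K * lm * (δ / s) := by positivity
  calc 2 * (frobNorm (Y - Θ) + lm * (√K * (24 * η)))
      ≤ 2 * (2 * lm * (√K * (10 * (δ / s))) + lm * (√K * (24 * η))) := by linarith
    _ = 96 * √K * lm ^ 2 * beta A P U + 40 * (√K * lm * (δ / s)) := by rw [hη]; ring
    _ ≤ 96 * √K * lm ^ 2 * beta A P U + 96 * √K * lm * (δ / s) := by linarith

/-- The error bound with a constant depending on `K` for large noise. -/
lemma frobNorm_le_of_large (hK : 1 ≤ K) (hΘ : IsIdentifiableMMSB Θ B)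
    (hU : Uᵀ * U = 1) (hUF : U = Θ * F) (hJ : IsPrecondSPAOutput Uhat J)
    (hlarge : 1 / 24000 ≤ √K * (2 * singVal Θ 1 * beta A P U)) (σ : Equiv.Perm (Fin K)) :
    frobNorm (spocTheta Uhat J - Θ * (σ.permMatrix ℝ)ᵀ) ≤
      nodeBound (48000 * √K * (K * (1 + √K) ^ K + 1)) Θ A P U := by
  set D : ℝ := K * (1 + √K) ^ K + 1 with hD
  have hD0 : 0 ≤ D := by positivity
  have hlm := singVal_nonneg Θ 1
  have h1 := frobNorm_spocTheta_sub_le hΘ.mem_stdSimplex hJ σ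
  refine (h1.trans ?_).trans (le_nodeBound (by positivity)
    (one_le_condNumber hK (singVal_membership_pos hK hU hUF)))
  have h2 : 0 ≤ 48000 * √K * D * √K * singVal Θ 1 * (specNorm (A - P) / singVal P K) := by
    have := specNorm_nonneg (A - P)
    have := singVal_nonneg P K
    positivity
  -- The crude bound is multiplied by `24000 * √K * η ≥ 1`, with `η = 2 λ_max(Θ) β`, whence the
  -- constant 48000.
  have h3 : D * (√K * singVal Θ 1) * (1 / 24000) ≤
      D * (√K * singVal Θ 1) * (√K * (2 * singVal Θ 1 * beta A P U)) :=
    mul_le_mul_of_nonneg_left hlarge (by positivity)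
  linarith

end Main

end SPOC

theorem theorem4 :
    ∃ (c₁ C : ℝ) (C' : ℕ → ℝ), 0 < c₁ ∧ 0 < C ∧ (∀ K, 0 < C' K) ∧
      ∀ (n K : ℕ), 1 ≤ K →
      ∀ (Θ : Matrix (Fin n) (Fin K) ℝ) (B : Matrix (Fin K) (Fin K) ℝ)
        (P A : Matrix (Fin n) (Fin n) ℝ)
        (U : Matrix (Fin n) (Fin K) ℝ) (d : Fin K → ℝ) (F : Matrix (Fin K) (Fin K) ℝ)
        (Uhat : Matrix (Fin n) (Fin K) ℝ) (dhat : Fin K → ℝ) (J : Fin K → Fin n),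
        SPOC.IsIdentifiableMMSB Θ B →
        P = Θ * B * Θ.transpose →
        A.IsSymm →
        SPOC.specNorm (A - P) ≤ SPOC.singVal P K / 2 →
        SPOC.IsLeadingEigen P U d →
        U = Θ * F →
        SPOC.IsLeadingEigen A Uhat dhat →
        SPOC.IsPrecondSPAOutput Uhat J →
        IsUnit (SPOC.spocF Uhat J * (SPOC.spocF Uhat J).transpose) ∧
        ∃ σ : Equiv.Perm (Fin K),
          SPOC.frobNorm (SPOC.spocTheta Uhat J - Θ * (σ.permMatrix ℝ).transpose)
              ≤ SPOC.nodeBound (C' K) Θ A P U ∧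
          (SPOC.beta A P U ≤ c₁ * SPOC.singVal F K / Real.sqrt K →
            SPOC.frobNorm (SPOC.spocTheta Uhat J - Θ * (σ.permMatrix ℝ).transpose)
              ≤ SPOC.nodeBound C Θ A P U) := by
  -- `c₁` is half of the threshold 1/24000 because of the factor 2 in `η`; the `K`-dependent
  -- constant covers both regimes by adding their constants.
  refine ⟨1 / 48000, 96, fun K => 96 + 48000 * √K * (K * (1 + √K) ^ K + 1), by norm_num,
    by norm_num, fun K => by positivity, ?_⟩
  intro n K hK Θ B P A U d F Uhat dhat J hΘ hP hA hAP hU hUF hUh hJ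
  have hu := SPOC.isUnit_spocF hJ
  refine ⟨hu.mul ?_, ?_⟩
  · rw [Matrix.isUnit_iff_isUnit_det, Matrix.det_transpose]
    exact (Matrix.isUnit_iff_isUnit_det _).1 hu
  have hpos : (0 : ℝ) ≤ 48000 * √K * (K * (1 + √K) ^ K + 1) := by positivity
  by_cases hsmall : √K * (2 * SPOC.singVal Θ 1 * SPOC.beta A P U) ≤ 1 / 24000
  · obtain ⟨σ, hσ⟩ := SPOC.exists_perm_frobNorm_le hK hΘ hP hA hAP hU hUF hUh hJ hsmall
    exact ⟨σ, hσ.trans (SPOC.nodeBound_mono (by linarith)), fun _ => hσ⟩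
  -- For large noise any permutation works, and the hypothesis of the sharper claim fails since
  -- `λ_K(F) λ_max(Θ) ≤ 1`.
  · refine ⟨1, (SPOC.frobNorm_le_of_large hK hΘ hU.orthonormal hUF hJ (not_le.1 hsmall).le
      1).trans (SPOC.nodeBound_mono (by linarith)), fun hβ => absurd ?_ hsmall⟩
    have hs : (0 : ℝ) < √K := zero_lt_one.trans_le (SPOC.one_le_sqrt_of_pos (⟨0, hK⟩ : Fin K))
    rw [le_div_iff₀ hs] at hβ
    have h1 := SPOC.singVal_factor_mul_le_one hU.orthonormal hUF
    have h2 := mul_le_mul_of_nonneg_right hβ (SPOC.singVal_nonneg Θ 1)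
    linarith
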